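/- Let $M,N$ be smooth finite-dimensional (Hausdorff, second countable) manifolds without boundary and $p:N\to M$ a smooth map. A *diffusion operator* $\mathcal L$ on a manifold is a linear operator given in every chart by $\mathcal L=\frac12\sum a^{ij}\partial_i\partial_j+\sum b^i\partial_i$ with smooth coefficients and $(a^{ij})$ positive semi-definite. Its *symbol* $\sigma^{\mathcal L}_x:T_x^*M\to T_xM$ is determined by $df(\sigma^{\mathcal L}(dg))=\frac12\bigl(\mathcal L(fg)-(\mathcal Lf)g-f\,\mathcal Lg\bigr)$, and $\delta^{\mathcal L}$ is the linear first order operator from $C^1$ one-forms to continuous functions with $\delta^{\mathcal L}(f\phi)=df(\sigma^{\mathcal L}\phi)+f\,\delta^{\mathcal L}\phi$ and $\delta^{\mathcal L}(df)=\mathcal Lf$. $\mathcal L$ is *cohesive* if $\sigma^{\mathcal L}$ has constant non-zero rank and $\mathcal L$ is *along* the image of $\sigma^{\mathcal L}$, i.e. $\delta^{\mathcal L}\phi=0$ for every $C^1$ one-form $\phi$ vanishing on this image. Let $\mathcal A$ on $M$ and $\mathcal B$ on $N$ be diffusion operators with $\mathcal B$ *over* $\mathcal A$, i.e. $\mathcal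 B(f\circ p)=(\mathcal Af)\circ p$ for all smooth $f:M\to\mathbb R$, and let $\mathcal A$ be cohesive. Put $E_x=\operatorname{Im}\sigma^{\mathcal A}_x$. The induced semi-connection is given by the horizontal spaces $H_u=h_u(E_{p(u)})\subset T_uN$, where the horizontal lift map $h_u:E_{p(u)}\to T_uN$ is determined by $h_u\circ\sigma^{\mathcal A}_{p(u)}=\sigma^{\mathcal B}_u\circ(T_up)^*$. A Lipschitz curve $\sigma:[0,T]\to M$ is *$E$-horizontal* if $\dot\sigma(t)\in E_{\sigma(t)}$ for almost all $t$; a *horizontal lift* of $\sigma$ is a Lipschitz curve $\tilde\sigma$ in $N$ with $p\circ\tilde\sigma=\sigma$ and $\dot{\tilde\sigma}(t)\in H_{\tilde\sigma(t)}$ for almost all $t$. Assume that the semi-connection is *complete*: every Lipschitz $E$-horizontal curve $\sigma:[0,T]\to M$ has a horizontal lift from every point of $p^{-1}(\sigma(0))$. Let $\mathcal D^0(x)$ be the set of end points of Lipschitz $E$-horizontal curves starting at $x$. 1. Let $\sigma:[0,T]\to M$ be a Lipschitz $E$-horizontal curve from $x$ to $z$ (so $z\in\mathcal D^0(x)$).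 There is a bijection $p^{-1}(x)\to p^{-1}(z)$ (the holonomy of $\sigma$) which maps $u$ to the end point of every horizontal lift of $\sigma$ starting at $u$, and it is a diffeomorphism in the sense that it and its inverse are locally restrictions of smooth maps defined on open subsets of $N$. If $p^{-1}(x)$ is an embedded submanifold of $N$ of dimension $k$, then so is $p^{-1}(z)$ (and they are diffeomorphic by the holonomy). Moreover $z$ is a regular value of $p$ if and only if $x$ is. 2. If $\mathcal D^0(x)$ is dense in $M$ for every $x\in M$ and $p$ is proper, then $p$ is a smooth locally trivial bundle: there is a smooth manifold $F$ such that $M$ is covered by open sets $U$ with a diffeomorphism $p^{-1}(U)\cong U\times F$ over $U$. 3. If $M$ is connected and $E$ satisfies Hörmander's condition (the Lie algebra of vector fields generated by the smooth sections of $E$ spans $T_yM$ at each $y\in M$), then $p$ is a submersion, and all its fibres are embedded submanifolds of $N$ of the same dimension, diffeomorphic to each other. -/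

import Mathlib

open Set Filter Topology MeasureTheory
open scoped Manifold ContDiff

/-! ### Diffusion operators on a smooth manifold -/

section Operators

variable {m : ℕ} {M : Type*} [TopologicalSpace M] [ChartedSpace (EuclideanSpace ℝ (Fin m)) M]

/-- Differential of a real function at `x`, as a cotangent vector. -/
noncomputable def differentialAt (f : M → ℝ) (x : M) : TangentSpace (𝓡 m) x →L[ℝ] ℝ :=
  mfderiv (𝓡 m) 𝓘(ℝ, ℝ) f x

/-- `L` is a diffusion operator: a smooth, semi-elliptic second order differential operator with
`L 1 = 0`. That is, in every chart
`L = ½ ∑ aⁱʲ ∂ᵢ ∂ⱼ + ∑ bⁱ ∂ᵢ` with smooth coefficients and `(aⁱʲ)` positive semi-definite. -/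
def IsDiffusionOperator (L : C^∞⟮𝓡 m, M; ℝ⟯ →ₗ[ℝ] C^∞⟮𝓡 m, M; ℝ⟯) : Prop :=
  ∀ c : M, ∃ (a : EuclideanSpace ℝ (Fin m) → Matrix (Fin m) (Fin m) ℝ)
      (b : EuclideanSpace ℝ (Fin m) → Fin m → ℝ),
    (∀ i j, ContDiffOn ℝ ∞ (fun y => a y i j) (extChartAt (𝓡 m) c).target) ∧
    (∀ i, ContDiffOn ℝ ∞ (fun y => b y i) (extChartAt (𝓡 m) c).target) ∧
    (∀ y ∈ (extChartAt (𝓡 m) c).target, (a y).PosSemidef) ∧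
    ∀ (f : C^∞⟮𝓡 m, M; ℝ⟯), ∀ y ∈ (extChartAt (𝓡 m) c).target,
      L f ((extChartAt (𝓡 m) c).symm y) =
        (1 / 2) * ∑ i, ∑ j, a y i j *
          fderiv ℝ (fderiv ℝ (f ∘ (extChartAt (𝓡 m) c).symm)) y
            (EuclideanSpace.single i 1) (EuclideanSpace.single j 1) +
        ∑ i, b y i * fderiv ℝ (f ∘ (extChartAt (𝓡 m) c).symm) y (EuclideanSpace.single i 1)

/-- `Γ(f, g) = ½ (L (f g) - (L f) g - f (L g))`. -/
noncomputable def carreDuChamp (L : C^∞⟮𝓡 m, M; ℝ⟯ →ₗ[ℝ] C^∞⟮𝓡 m, M; ℝ⟯)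
    (f g : C^∞⟮𝓡 m, M; ℝ⟯) (x : M) : ℝ :=
  (1 / 2) * (L (f * g) x - L f x * g x - f x * L g x)

/-- The linear map `s : T*ₓM → TₓM` satisfies `df (s (dg)) = ½ (L (f g) - (L f) g - f (L g))`
at `x`. -/
def IsSymbolAt (L : C^∞⟮𝓡 m, M; ℝ⟯ →ₗ[ℝ] C^∞⟮𝓡 m, M; ℝ⟯) (x : M)
    (s : (TangentSpace (𝓡 m) x →L[ℝ] ℝ) →ₗ[ℝ] TangentSpace (𝓡 m) x) : Prop :=
  ∀ f g : C^∞⟮𝓡 m, M; ℝ⟯,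
    differentialAt f x (s (differentialAt g x)) = carreDuChamp L f g x

open Classical in
/-- The symbol `σᴸₓ : T*ₓM → TₓM`. For a diffusion operator on a Hausdorff manifold it is the
unique linear map with the property `IsSymbolAt`, see `isSymbolAt_symbol` and
`IsSymbolAt.unique`. -/
noncomputable def symbol (L : C^∞⟮𝓡 m, M; ℝ⟯ →ₗ[ℝ] C^∞⟮𝓡 m, M; ℝ⟯) (x : M) :
    (TangentSpace (𝓡 m) x →L[ℝ] ℝ) →ₗ[ℝ] TangentSpace (𝓡 m) x :=
  if h : ∃ s, IsSymbolAt L x s then h.choose else 0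

/-- Every cotangent vector is the differential of a smooth function. -/
theorem exists_differentialAt_eq [IsManifold (𝓡 m) ∞ M] [T2Space M] (x : M)
    (α : TangentSpace (𝓡 m) x →L[ℝ] ℝ) :
    ∃ g : C^∞⟮𝓡 m, M; ℝ⟯, differentialAt g x = α := by
  let β : EuclideanSpace ℝ (Fin m) →L[ℝ] ℝ := α
  obtain ⟨b⟩ : Nonempty (SmoothBumpFunction (𝓡 m) x) := inferInstance
  let h : M → ℝ := fun y => β (extChartAt (𝓡 m) x y)
  have hh : ContMDiffOn (𝓡 m) 𝓘(ℝ, ℝ) ∞ h (chartAt (EuclideanSpace ℝ (Fin m)) x).source := by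
    have h1 : ContMDiffOn (𝓡 m) 𝓘(ℝ, EuclideanSpace ℝ (Fin m)) ∞ (extChartAt (𝓡 m) x)
        (chartAt (EuclideanSpace ℝ (Fin m)) x).source := contMDiffOn_extChartAt
    exact (β.contDiff.contMDiff).comp_contMDiffOn h1
  refine ⟨⟨fun y => b y • h y, b.contMDiff_smul hh⟩, ?_⟩
  have hev : (fun y => b y • h y) =ᶠ[𝓝 x] h := by
    filter_upwards [b.eventuallyEq_one] with y hy
    simp [hy]
  have hmd : MDifferentiableAt (𝓡 m) 𝓘(ℝ, ℝ) h x :=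
    ((hh.contMDiffAt ((chartAt (EuclideanSpace ℝ (Fin m)) x).open_source.mem_nhds
      (mem_chart_source _ x))).mdifferentiableAt (by simp))
  have key : mfderiv (𝓡 m) 𝓘(ℝ, ℝ) (fun y => b y • h y) x = α := by
    have e2 : writtenInExtChartAt (𝓡 m) 𝓘(ℝ, ℝ) x h =ᶠ[𝓝 (extChartAt (𝓡 m) x x)] β := by
      filter_upwards [extChartAt_target_mem_nhds (I := 𝓡 m) x] with y hy
      simp only [writtenInExtChartAt, extChartAt_model_space_eq_id, PartialEquiv.refl_coe,
        Function.comp_apply, id, h]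
      rw [(extChartAt (𝓡 m) x).right_inv hy]
    have e3 : fderivWithin ℝ (writtenInExtChartAt (𝓡 m) 𝓘(ℝ, ℝ) x h) (range (𝓡 m))
        (extChartAt (𝓡 m) x x) = β := by
      simp only [modelWithCornersSelf_coe, range_id, fderivWithin_univ]
      rw [e2.fderiv_eq]
      exact β.fderiv
    exact hev.mfderiv_eq.trans (hmd.mfderiv.trans e3)
  exact key

/-- The symbol is unique. -/
theorem IsSymbolAt.unique [IsManifold (𝓡 m) ∞ M] [T2Space M]
    {L : C^∞⟮𝓡 m, M; ℝ⟯ →ₗ[ℝ] C^∞⟮𝓡 m, M; ℝ⟯} {x : M}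
    {s s' : (TangentSpace (𝓡 m) x →L[ℝ] ℝ) →ₗ[ℝ] TangentSpace (𝓡 m) x}
    (hs : IsSymbolAt L x s) (hs' : IsSymbolAt L x s') : s = s' := by
  ext1 α
  obtain ⟨g, rfl⟩ := exists_differentialAt_eq x α
  have h : ∀ β : TangentSpace (𝓡 m) x →L[ℝ] ℝ,
      β (s (differentialAt g x)) = β (s' (differentialAt g x)) := by
    intro β
    obtain ⟨f, rfl⟩ := exists_differentialAt_eq x β
    rw [hs f g, hs' f g]
  have h2 : ∀ v w : EuclideanSpace ℝ (Fin m),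
      (∀ β : EuclideanSpace ℝ (Fin m) →L[ℝ] ℝ, β v = β w) → v = w := by
    intro v w hvw
    ext i
    exact hvw (EuclideanSpace.proj i)
  exact h2 _ _ h

/-- A diffusion operator has a symbol. -/
theorem isSymbolAt_symbol [IsManifold (𝓡 m) ∞ M]
    {L : C^∞⟮𝓡 m, M; ℝ⟯ →ₗ[ℝ] C^∞⟮𝓡 m, M; ℝ⟯} (hL : IsDiffusionOperator L) (x : M) :
    IsSymbolAt L x (symbol L x) := by
  classical
  have hex : ∃ s, IsSymbolAt L x s := by
    obtain ⟨a, b, -, -, hpos, hloc⟩ := hL x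
    set c := extChartAt (𝓡 m) x with hc
    set y₀ : EuclideanSpace ℝ (Fin m) := c x with hy₀
    have hy₀t : y₀ ∈ c.target := mem_extChartAt_target (I := 𝓡 m) x
    have hinv : c.symm y₀ = x := extChartAt_to_inv (I := 𝓡 m) x
    have hnhds : c.target ∈ 𝓝 y₀ := extChartAt_target_mem_nhds (I := 𝓡 m) x
    let e : Fin m → EuclideanSpace ℝ (Fin m) := fun i => EuclideanSpace.single i 1
    -- differential in the chart
    have hd : ∀ f : C^∞⟮𝓡 m, M; ℝ⟯, differentialAt f x = fderiv ℝ (f ∘ c.symm) y₀ := by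
      intro f
      have hmd : MDifferentiableAt (𝓡 m) 𝓘(ℝ, ℝ) f x :=
        f.contMDiff.contMDiffAt.mdifferentiableAt (by simp)
      have e3 : fderivWithin ℝ (writtenInExtChartAt (𝓡 m) 𝓘(ℝ, ℝ) x f) (range (𝓡 m))
          (extChartAt (𝓡 m) x x) = fderiv ℝ (f ∘ c.symm) y₀ := by
        simp only [modelWithCornersSelf_coe, range_id, fderivWithin_univ]
        rfl
      exact hmd.mfderiv.trans e3
    have hsm : ∀ f : C^∞⟮𝓡 m, M; ℝ⟯, ContDiffAt ℝ ∞ (f ∘ c.symm) y₀ := by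
      intro f
      have h1 : ContMDiffOn 𝓘(ℝ, EuclideanSpace ℝ (Fin m)) 𝓘(ℝ, ℝ) ∞ (f ∘ c.symm) c.target :=
        f.contMDiff.comp_contMDiffOn (contMDiffOn_extChartAt_symm x)
      exact (contMDiffOn_iff_contDiffOn.1 h1).contDiffAt hnhds
    let S : (EuclideanSpace ℝ (Fin m) →L[ℝ] ℝ) →ₗ[ℝ] EuclideanSpace ℝ (Fin m) :=
      { toFun := fun α => ∑ i, ((1 / 2) * ∑ j, a y₀ i j * α (e j)) • e i
        map_add' := by
          intro α β
          simp [mul_add, Finset.sum_add_distrib, add_smul]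
        map_smul' := by
          intro r α
          simp only [smul_apply, smul_eq_mul, RingHom.id_apply,
            Finset.smul_sum, smul_smul]
          refine Finset.sum_congr rfl fun i _ => ?_
          congr 1
          rw [Finset.mul_sum, Finset.mul_sum, Finset.mul_sum]
          exact Finset.sum_congr rfl fun j _ => by ring }
    refine ⟨S, fun f g => ?_⟩
    rw [hd f, hd g]
    set F := f ∘ c.symm with hF
    set G := g ∘ c.symm with hG
    have hFs := hsm f
    have hGs := hsm g
    have hfg : ((f * g : C^∞⟮𝓡 m, M; ℝ⟯) : M → ℝ) ∘ c.symm = F * G := rfl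
    -- first derivative of the product near the point
    have hev1 : fderiv ℝ (F * G) =ᶠ[𝓝 y₀] fun y => F y • fderiv ℝ G y + G y • fderiv ℝ F y := by
      have hF1 : ContDiffAt ℝ 1 F y₀ := hFs.of_le (by exact_mod_cast le_top)
      have hG1 : ContDiffAt ℝ 1 G y₀ := hGs.of_le (by exact_mod_cast le_top)
      filter_upwards [hF1.eventually (by simp), hG1.eventually (by simp)] with y h1 h2
      exact fderiv_mul (h1.differentiableAt (by simp)) (h2.differentiableAt (by simp))
    have hFd : DifferentiableAt ℝ F y₀ := hFs.differentiableAt (by simp)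
    have hGd : DifferentiableAt ℝ G y₀ := hGs.differentiableAt (by simp)
    have hFd2 : DifferentiableAt ℝ (fderiv ℝ F) y₀ :=
      (hFs.fderiv_right (m := ∞) (by simp)).differentiableAt (by simp)
    have hGd2 : DifferentiableAt ℝ (fderiv ℝ G) y₀ :=
      (hGs.fderiv_right (m := ∞) (by simp)).differentiableAt (by simp)
    have h2 : ∀ v w, fderiv ℝ (fderiv ℝ (F * G)) y₀ v w =
        F y₀ * fderiv ℝ (fderiv ℝ G) y₀ v w + fderiv ℝ F y₀ v * fderiv ℝ G y₀ w +
        (G y₀ * fderiv ℝ (fderiv ℝ F) y₀ v w + fderiv ℝ G y₀ v * fderiv ℝ F y₀ w) := by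
      intro v w
      rw [hev1.fderiv_eq]
      rw [fderiv_fun_add (hFd.fun_smul hGd2) (hGd.fun_smul hFd2), fderiv_fun_smul hFd hGd2,
        fderiv_fun_smul hGd hFd2]
      simp
    have h1 : ∀ v, fderiv ℝ (F * G) y₀ v = F y₀ * fderiv ℝ G y₀ v + G y₀ * fderiv ℝ F y₀ v := by
      intro v
      rw [hev1.eq_of_nhds]
      simp
    have hsymm : ∀ i j, a y₀ i j = a y₀ j i := fun i j => by
      have := (hpos y₀ hy₀t).isHermitian.apply i j
      simpa using this.symm
    have hLf := hloc f y₀ hy₀t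
    have hLg := hloc g y₀ hy₀t
    have hLfg := hloc (f * g) y₀ hy₀t
    rw [hinv] at hLf hLg hLfg
    rw [hfg] at hLfg
    have hFx : f x = F y₀ := by simp [hF, hinv]
    have hGx : g x = G y₀ := by simp [hG, hinv]
    rw [carreDuChamp, hLf, hLg, hLfg, hFx, hGx]
    change fderiv ℝ F y₀ (∑ i, ((1 / 2) * ∑ j, a y₀ i j * fderiv ℝ G y₀ (e j)) • e i) = _
    simp only [h1, h2, map_sum, map_smul, smul_eq_mul]
    have hswap : ∑ i, ∑ j, a y₀ i j * (fderiv ℝ G y₀ (e i) * fderiv ℝ F y₀ (e j)) =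
        ∑ i, ∑ j, a y₀ i j * (fderiv ℝ F y₀ (e i) * fderiv ℝ G y₀ (e j)) := by
      rw [Finset.sum_comm]
      refine Finset.sum_congr rfl fun i _ => Finset.sum_congr rfl fun j _ => ?_
      rw [hsymm j i]; ring
    have hl : ∑ i, 1 / 2 * (∑ j, a y₀ i j * fderiv ℝ G y₀ (e j)) * fderiv ℝ F y₀ (e i) =
        1 / 2 * ∑ i, ∑ j, a y₀ i j * (fderiv ℝ F y₀ (e i) * fderiv ℝ G y₀ (e j)) := by
      rw [Finset.mul_sum]
      refine Finset.sum_congr rfl fun i _ => ?_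
      rw [mul_assoc, Finset.sum_mul]
      congr 1
      exact Finset.sum_congr rfl fun j _ => by ring
    rw [hl]
    have hexp : ∑ i, ∑ j, a y₀ i j *
        (F y₀ * fderiv ℝ (fderiv ℝ G) y₀ (e i) (e j) +
          fderiv ℝ F y₀ (e i) * fderiv ℝ G y₀ (e j) +
        (G y₀ * fderiv ℝ (fderiv ℝ F) y₀ (e i) (e j) +
          fderiv ℝ G y₀ (e i) * fderiv ℝ F y₀ (e j))) =
        F y₀ * (∑ i, ∑ j, a y₀ i j * fderiv ℝ (fderiv ℝ G) y₀ (e i) (e j)) +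
        G y₀ * (∑ i, ∑ j, a y₀ i j * fderiv ℝ (fderiv ℝ F) y₀ (e i) (e j)) +
        (∑ i, ∑ j, a y₀ i j * (fderiv ℝ F y₀ (e i) * fderiv ℝ G y₀ (e j)) +
        ∑ i, ∑ j, a y₀ i j * (fderiv ℝ G y₀ (e i) * fderiv ℝ F y₀ (e j))) := by
      simp only [Finset.mul_sum, ← Finset.sum_add_distrib]
      exact Finset.sum_congr rfl fun i _ => Finset.sum_congr rfl fun j _ => by ring
    have hexp1 : ∑ i, b y₀ i * (F y₀ * fderiv ℝ G y₀ (e i) + G y₀ * fderiv ℝ F y₀ (e i)) =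
        F y₀ * (∑ i, b y₀ i * fderiv ℝ G y₀ (e i)) +
        G y₀ * (∑ i, b y₀ i * fderiv ℝ F y₀ (e i)) := by
      simp only [Finset.mul_sum, ← Finset.sum_add_distrib]
      exact Finset.sum_congr rfl fun i _ => by ring
    simp only [e] at hexp hexp1 hswap ⊢
    rw [hexp, hexp1, hswap]
    ring
  rw [symbol, dif_pos hex]
  exact hex.choose_spec

/-- `Eₓ`, the image of the symbol at `x`. -/
noncomputable def symbolImage (L : C^∞⟮𝓡 m, M; ℝ⟯ →ₗ[ℝ] C^∞⟮𝓡 m, M; ℝ⟯) (x : M) :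
    Submodule ℝ (TangentSpace (𝓡 m) x) :=
  LinearMap.range (symbol L x)

/-- `φ` is a `C¹` differential one-form on `M`. -/
def IsC1OneForm (φ : ∀ x : M, TangentSpace (𝓡 m) x →L[ℝ] ℝ) : Prop :=
  ∀ c : M, ContDiffOn ℝ 1
    (fun y : EuclideanSpace ℝ (Fin m) =>
      ((φ ((extChartAt (𝓡 m) c).symm y)).comp
        (mfderiv 𝓘(ℝ, EuclideanSpace ℝ (Fin m)) (𝓡 m) (extChartAt (𝓡 m) c).symm y) :
        EuclideanSpace ℝ (Fin m) →L[ℝ] ℝ))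
    (extChartAt (𝓡 m) c).target

/-- `δ` is the first order operator associated with `L`, from `C¹` one-forms to continuous
functions: it is linear, `δ (f φ) = df (σᴸ φ) + f δ φ` and `δ (df) = L f`. -/
structure IsAssociatedFirstOrder (L : C^∞⟮𝓡 m, M; ℝ⟯ →ₗ[ℝ] C^∞⟮𝓡 m, M; ℝ⟯)
    (δ : (∀ x : M, TangentSpace (𝓡 m) x →L[ℝ] ℝ) → M → ℝ) : Prop where
  continuous : ∀ φ, IsC1OneForm φ → Continuous (δ φ)
  add : ∀ φ ψ, IsC1OneForm φ → IsC1OneForm ψ → ∀ x, δ (fun y => φ y + ψ y) x = δ φ x + δ ψ x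
  smul : ∀ (f : C^1⟮𝓡 m, M; ℝ⟯) φ, IsC1OneForm φ → ∀ x,
    δ (fun y => f y • φ y) x = differentialAt f x (symbol L x (φ x)) + f x * δ φ x
  differential : ∀ (f : C^∞⟮𝓡 m, M; ℝ⟯) x, δ (fun y => differentialAt f y) x = L f x

/-- `L` is along the distribution `S`: `δᴸ φ = 0` for all `C¹` one-forms `φ` vanishing on `S`. -/
def IsAlong (L : C^∞⟮𝓡 m, M; ℝ⟯ →ₗ[ℝ] C^∞⟮𝓡 m, M; ℝ⟯)
    (S : ∀ x : M, Submodule ℝ (TangentSpace (𝓡 m) x)) : Prop :=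
  ∃ δ, IsAssociatedFirstOrder L δ ∧
    ∀ φ, IsC1OneForm φ → (∀ x, ∀ v ∈ S x, φ x v = 0) → ∀ x, δ φ x = 0

/-- A diffusion operator is cohesive if its symbol has constant non-zero rank and it is along the
image of its symbol. -/
structure IsCohesive (L : C^∞⟮𝓡 m, M; ℝ⟯ →ₗ[ℝ] C^∞⟮𝓡 m, M; ℝ⟯) : Prop where
  constantRank : ∃ r : ℕ, r ≠ 0 ∧ ∀ x : M, Module.finrank ℝ (symbolImage L x) = r
  along : IsAlong L (symbolImage L)

/-! ### Horizontal curves and the Hörmander condition for a distribution -/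

/-- `σ` is Lipschitz on `[0, T]`, in terms of charts. As `[0, T]` is compact this is the same as
being Lipschitz for (any) Riemannian distance. -/
def IsLipschitzCurve (m : ℕ) {M : Type*} [TopologicalSpace M]
    [ChartedSpace (EuclideanSpace ℝ (Fin m)) M] (σ : ℝ → M) (T : ℝ) : Prop :=
  ContinuousOn σ (Icc 0 T) ∧ ∀ t ∈ Icc (0 : ℝ) T, ∃ K, ∃ s ∈ 𝓝[Icc 0 T] t,
    LipschitzOnWith K (fun r => extChartAt (𝓡 m) (σ t) (σ r)) s

/-- `σ : [0, T] → M` is Lipschitz and its derivative is in the distribution `D` almost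
everywhere. Only the values of `σ` on `[0, T]` matter. -/
def IsHorizontalCurve (D : ∀ x : M, Submodule ℝ (TangentSpace (𝓡 m) x)) (σ : ℝ → M) (T : ℝ) :
    Prop :=
  IsLipschitzCurve m σ T ∧ ∀ᵐ t ∂(volume.restrict (Ioo 0 T)),
    MDifferentiableAt 𝓘(ℝ, ℝ) (𝓡 m) σ t ∧ mfderiv 𝓘(ℝ, ℝ) (𝓡 m) σ t (1 : ℝ) ∈ D (σ t)

/-- `𝓓⁰(x)`: the points which can be reached from `x` along Lipschitz curves with derivative in
`E` almost everywhere. -/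
def reachableSet (E : ∀ x : M, Submodule ℝ (TangentSpace (𝓡 m) x)) (x : M) : Set M :=
  {z | ∃ (T : ℝ) (σ : ℝ → M), 0 ≤ T ∧ IsHorizontalCurve E σ T ∧ σ 0 = x ∧ σ T = z}

/-- The Lie algebra of vector fields generated by the smooth sections of `E`. -/
inductive InGeneratedLieAlgebra [IsManifold (𝓡 m) ∞ M]
    (E : ∀ x : M, Submodule ℝ (TangentSpace (𝓡 m) x)) :
    (∀ x : M, TangentSpace (𝓡 m) x) → Prop
  | section_mem (V : ∀ x : M, TangentSpace (𝓡 m) x)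
      (hV : ContMDiff (𝓡 m) (𝓡 m).tangent ∞ (fun x => (⟨x, V x⟩ : TangentBundle (𝓡 m) M)))
      (hE : ∀ x, V x ∈ E x) : InGeneratedLieAlgebra E V
  | add (V W : ∀ x : M, TangentSpace (𝓡 m) x) (hV : InGeneratedLieAlgebra E V)
      (hW : InGeneratedLieAlgebra E W) : InGeneratedLieAlgebra E (fun x => V x + W x)
  | smul (c : ℝ) (V : ∀ x : M, TangentSpace (𝓡 m) x) (hV : InGeneratedLieAlgebra E V) :
      InGeneratedLieAlgebra E (fun x => c • V x)
  | bracket (V W : ∀ x : M, TangentSpace (𝓡 m) x) (hV : InGeneratedLieAlgebra E V)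
      (hW : InGeneratedLieAlgebra E W) :
      InGeneratedLieAlgebra E (VectorField.mlieBracket (𝓡 m) V W)

/-- The Lie algebra of vector fields generated by the sections of `E` spans each tangent space. -/
def HormanderCondition [IsManifold (𝓡 m) ∞ M]
    (E : ∀ x : M, Submodule ℝ (TangentSpace (𝓡 m) x)) : Prop :=
  ∀ (y : M) (v : TangentSpace (𝓡 m) y), ∃ V, InGeneratedLieAlgebra E V ∧ V y = v

end Operators

/-! ### The induced semi-connection -/

section SemiConnection

variable {m n : ℕ} {M N : Type*}
  [TopologicalSpace M] [ChartedSpace (EuclideanSpace ℝ (Fin m)) M]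
  [TopologicalSpace N] [ChartedSpace (EuclideanSpace ℝ (Fin n)) N]

/-- `B` is over `A`: `B (f ∘ p) = (A f) ∘ p`. -/
def IsOver (p : C^∞⟮𝓡 n, N; 𝓡 m, M⟯)
    (B : C^∞⟮𝓡 n, N; ℝ⟯ →ₗ[ℝ] C^∞⟮𝓡 n, N; ℝ⟯)
    (A : C^∞⟮𝓡 m, M; ℝ⟯ →ₗ[ℝ] C^∞⟮𝓡 m, M; ℝ⟯) : Prop :=
  ∀ f : C^∞⟮𝓡 m, M; ℝ⟯, B (f.comp p) = (A f).comp p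

/-- The horizontal space `H_u` of the semi-connection induced by `B`. The horizontal lift map
`h_u : E_{p u} → T_u N` is determined by `h_u ∘ σᴬ = σᴮ_u ∘ (T_u p)^*`; as `E` is the image of
`σᴬ`, its image `H_u` is the image of `σᴮ_u ∘ (T_u p)^*`. -/
noncomputable def horizontalSpace (p : C^∞⟮𝓡 n, N; 𝓡 m, M⟯)
    (B : C^∞⟮𝓡 n, N; ℝ⟯ →ₗ[ℝ] C^∞⟮𝓡 n, N; ℝ⟯) (u : N) :
    Submodule ℝ (TangentSpace (𝓡 n) u) :=
  LinearMap.range (symbol B u ∘ₗ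
    (ContinuousLinearMap.precomp ℝ (mfderiv (𝓡 n) (𝓡 m) p u)).toLinearMap)

/-- `τ` is a horizontal lift to `N` of the curve `σ : [0, T] → M`, for the horizontal
distribution `H`. -/
def IsHorizontalLift (p : N → M) (H : ∀ u : N, Submodule ℝ (TangentSpace (𝓡 n) u))
    (σ : ℝ → M) (τ : ℝ → N) (T : ℝ) : Prop :=
  IsHorizontalCurve H τ T ∧ ∀ t ∈ Icc (0 : ℝ) T, p (τ t) = σ t

/-- Completeness: each Lipschitz curve with derivatives in `E` almost everywhere has a horizontal
lift from every point above its starting point. -/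
def IsCompleteSemiConnection (p : N → M) (E : ∀ x : M, Submodule ℝ (TangentSpace (𝓡 m) x))
    (H : ∀ u : N, Submodule ℝ (TangentSpace (𝓡 n) u)) : Prop :=
  ∀ (T : ℝ) (σ : ℝ → M), 0 ≤ T → IsHorizontalCurve E σ T → ∀ u : N, p u = σ 0 →
    ∃ τ : ℝ → N, IsHorizontalLift p H σ τ T ∧ τ 0 = u

/-- `x` is a regular value of `p` (points outside the image are regular values). -/
def IsRegularValue (m n : ℕ) {M N : Type*}
    [TopologicalSpace M] [ChartedSpace (EuclideanSpace ℝ (Fin m)) M]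
    [TopologicalSpace N] [ChartedSpace (EuclideanSpace ℝ (Fin n)) N] (p : N → M) (x : M) : Prop :=
  ∀ u : N, p u = x → Function.Surjective (mfderiv (𝓡 n) (𝓡 m) p u)

end SemiConnection

/-! ### Submanifolds, diffeomorphisms between subsets, locally trivial bundles -/

universe u v

/-- `S` is a (smooth, embedded) submanifold of `N` of dimension `k`. -/
def IsEmbeddedSubmanifold (n : ℕ) {N : Type v} [TopologicalSpace N]
    [ChartedSpace (EuclideanSpace ℝ (Fin n)) N] (k : ℕ) (S : Set N) : Prop :=
  ∃ (P : Type v) (_ : TopologicalSpace P) (_ : ChartedSpace (EuclideanSpace ℝ (Fin k)) P)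
    (_ : IsManifold (𝓡 k) ∞ P) (i : P → N),
    Manifold.IsSmoothEmbedding (𝓡 k) (𝓡 n) ∞ i ∧ range i = S

/-- A map between two subsets of `N` is smooth if near each point it is the restriction of a smooth
map defined on an open subset of `N`. Between embedded submanifolds this is smoothness for their
manifold structures. -/
def IsSmoothBetween (n : ℕ) {N : Type v} [TopologicalSpace N]
    [ChartedSpace (EuclideanSpace ℝ (Fin n)) N] {S S' : Set N} (f : S → S') : Prop :=
  ∀ u : S, ∃ (U : Set N) (g : N → N), IsOpen U ∧ (u : N) ∈ U ∧
    ContMDiffOn (𝓡 n) (𝓡 n) ∞ g U ∧ ∀ w : S, (w : N) ∈ U → g w = f w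

/-- A bijection between two subsets of `N` is a diffeomorphism if it and its inverse are smooth. -/
def IsDiffeoBetween (n : ℕ) {N : Type v} [TopologicalSpace N]
    [ChartedSpace (EuclideanSpace ℝ (Fin n)) N] {S S' : Set N} (f : S ≃ S') : Prop :=
  IsSmoothBetween n f ∧ IsSmoothBetween n f.symm

/-- `p : N → M` is a smooth locally trivial bundle: there is a smooth manifold `F` such that `M` is
covered by open sets `U` with a diffeomorphism `p⁻¹(U) ≃ U × F` over `U`. -/
def IsLocallyTrivialBundle (m n : ℕ) {M : Type u} {N : Type v}
    [TopologicalSpace M] [ChartedSpace (EuclideanSpace ℝ (Fin m)) M]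
    [TopologicalSpace N] [ChartedSpace (EuclideanSpace ℝ (Fin n)) N] (p : N → M) : Prop :=
  ∃ (k : ℕ) (F : Type v) (_ : TopologicalSpace F) (_ : ChartedSpace (EuclideanSpace ℝ (Fin k)) F),
    IsManifold (𝓡 k) ∞ F ∧ T2Space F ∧ SecondCountableTopology F ∧
    ∀ x : M, ∃ e : Bundle.Trivialization F p, x ∈ e.baseSet ∧
      ContMDiffOn (𝓡 n) ((𝓡 m).prod (𝓡 k)) ∞ e e.source ∧
      ContMDiffOn ((𝓡 m).prod (𝓡 k)) (𝓡 n) ∞ e.toOpenPartialHomeomorph.symm e.target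

/-!
Horizontal lifts are the solutions of a differential equation controlled by the base curve; their
smooth dependence on the initial point gives the holonomy, and the three parts of the theorem follow
from it.

**The equation of a horizontal lift.** As `B` is over `A`, the symbols satisfy
`Tp ∘ σᴮ ∘ (Tp)* = σᴬ`. In charts, `Eₓ` is thus the image of a map `YM` and `H_u` the image of a map
`YN`, both defined on the covectors of `M` and intertwined by the differential of `p`
(`IsOver.exists_horizontal_fields`). Since `σᴮ` is positive semi-definite, `ker YM ⊆ ker YN`: the
horizontal lift map is well defined. Since `YM` has constant rank, it has a smooth right inverse `C`
on its images (`exists_contDiffOn_rightInverse_range`). A horizontal lift `y` of a curve `z` then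
solves `y' = YN(y) α`, where the control `α = C(z) z'` depends on `z` only. It is merely bounded and
measurable, so that the classical theory of smooth flows does not apply; but the integral equation
is of the form `γ = u + J (Y ∘ γ)` in the Banach space of continuous maps, with `J` a small
continuous linear operator and composition with `Y` a smooth map, and the inverse function theorem
gives solutions depending smoothly on `u` (`exists_implicitFlow`, `exists_controlFlow`).

**Holonomy.** Consequently the end points of horizontal lifts of a short piece of curve are given by
a local diffeomorphism of `N` which covers a local diffeomorphism of `M`
(`IsHorizontalLift.eventually_isLocalHolonomy`), and such local holonomies compose. If the
semi-connection is complete they yield a bijection between the fibres, which is locally the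
restriction of diffeomorphisms between open sets of `N` (`exists_holonomy`). These transport slice
charts (`IsEmbeddedSubmanifold.of_isLocallyDiffeo`), and as they cover local diffeomorphisms of `M`
also the surjectivity of the differential of `p` (`IsRegularValue.of_isHorizontalCurve`).

**Dense reachable sets and proper `p`.** By Sard's theorem there is a regular value. Only existence
is needed: the critical points are covered by countably many sets whose images are closed with empty
interior, since an interior point would give an interval of critical values of a real function
(`exists_isRegularValue`, `volume_image_criticalPoints`). The regular values of a proper map form an
open set, which is thus met by every reachable set, so that all values are regular. Ehresmann's
argument gives a product structure near each fibre (`exists_isProductStructure`): flow along lifts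
of the coordinate fields. All fibres are diffeomorphic to a fixed one, because nearby fibres are,
and holonomy relates it to a dense set of fibres.

**Hörmander's condition.** A section of `E` lifts locally to the horizontal field `YN(y) C(z) V(z)`,
which is related to it by `p`. Brackets of related fields are related, so that the image of the
differential of `p` contains the Lie algebra generated by `E`, which is everything
(`IsOver.surjective_mfderiv`). The fibres of a submersion are embedded submanifolds of the expected
dimension. That they are diffeomorphic to each other follows from a form of Chow's theorem: on a
connected manifold, an equivalence relation which contains accessibility along `E` has only one
class (`HormanderCondition.rel_of_preconnectedSpace`). It is applied to the relation of having
diffeomorphic fibres, which contains accessibility by holonomy.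
-/

/-! ### Local inverses and composition operators -/

section LocalInverse

variable {E F : Type*} [NormedAddCommGroup E] [NormedSpace ℝ E] [CompleteSpace E]
  [NormedAddCommGroup F] [NormedSpace ℝ F]

/-- Inverse function theorem with a whole neighbourhood on which the local inverse is `C^∞`:
`ContDiffAt ℝ ∞` at one point alone does not provide such a neighbourhood. -/
theorem ContDiffOn.exists_openPartialHomeomorph {f : E → F} {U : Set E} (hU : IsOpen U)
    (hf : ContDiffOn ℝ ∞ f U) {x : E} (hx : x ∈ U) (hinv : (fderiv ℝ f x).IsInvertible) :
    ∃ e : OpenPartialHomeomorph E F, x ∈ e.source ∧ e.source ⊆ U ∧ ⇑e = f ∧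
      ContDiffOn ℝ ∞ e.symm e.target ∧ ∀ y ∈ e.source, (fderiv ℝ f y).IsInvertible := by
  obtain ⟨f', hf'⟩ := hinv
  have hat : ∀ y ∈ U, ContDiffAt ℝ ∞ f y := fun y hy => hf.contDiffAt (hU.mem_nhds hy)
  have hd : HasFDerivAt f (f' : E →L[ℝ] F) x := by
    rw [hf']; exact ((hat x hx).differentiableAt (by simp)).hasFDerivAt
  let e₀ := (hat x hx).toOpenPartialHomeomorph f hd (by simp)
  let V : Set E := U ∩ fderiv ℝ f ⁻¹' range ((↑) : (E ≃L[ℝ] F) → E →L[ℝ] F)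
  have hV : IsOpen V :=
    (hf.continuousOn_fderiv_of_isOpen hU (by simp)).isOpen_inter_preimage hU
      ContinuousLinearEquiv.isOpen
  have hxV : x ∈ V := ⟨hx, f', hf'⟩
  have he₀ : ⇑e₀ = f := ContDiffAt.toOpenPartialHomeomorph_coe _ _ _
  have hsrc : (e₀.restrOpen V hV).source = e₀.source ∩ V := e₀.restrOpen_source V hV
  refine ⟨e₀.restrOpen V hV, ?_, ?_, ?_, ?_, ?_⟩
  · rw [hsrc]; exact ⟨ContDiffAt.mem_toOpenPartialHomeomorph_source _ _ _, hxV⟩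
  · rw [hsrc]; exact fun y hy => hy.2.1
  · exact he₀
  · intro y hy
    have hm := (e₀.restrOpen V hV).map_target hy
    rw [hsrc] at hm
    obtain ⟨g', hg'⟩ := hm.2.2
    refine ((e₀.restrOpen V hV).contDiffAt_symm (f₀' := g') hy ?_ ?_).contDiffWithinAt
    · have := ((hat _ hm.2.1).differentiableAt (by simp)).hasFDerivAt
      rw [← hg'] at this
      exact this.congr_of_eventuallyEq (Eventually.of_forall fun z => by
        change e₀ z = f z; rw [he₀])
    · refine (hat _ hm.2.1).congr_of_eventuallyEq (Eventually.of_forall fun z => by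
        change e₀ z = f z; rw [he₀])
  · rw [hsrc]
    rintro y ⟨-, -, g', hg'⟩
    exact ⟨g', hg'⟩

end LocalInverse

section Composition

variable {X : Type*} [TopologicalSpace X] [CompactSpace X]

/-- Composition of continuous maps `X → E` with a continuous map on `E`. -/
noncomputable def postcomp {E F : Type*} [TopologicalSpace E] [TopologicalSpace F] {g : E → F}
    (hg : Continuous g) (γ : C(X, E)) : C(X, F) :=
  ⟨fun x => g (γ x), hg.comp γ.continuous⟩

variable {E F : Type u} [NormedAddCommGroup E] [NormedSpace ℝ E]
  [NormedAddCommGroup F] [NormedSpace ℝ F]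

/-- Pointwise application of a continuous family of operators. -/
noncomputable def pointwiseApply : C(X, E →L[ℝ] F) →L[ℝ] C(X, E) →L[ℝ] C(X, F) :=
  LinearMap.mkContinuous₂
    (LinearMap.mk₂ ℝ (fun (A : C(X, E →L[ℝ] F)) (v : C(X, E)) =>
        (⟨fun x => A x (v x), A.continuous.clm_apply v.continuous⟩ : C(X, F)))
      (fun _ _ _ => by ext; simp) (fun _ _ _ => by ext; simp)
      (fun _ _ _ => by ext; simp) (fun _ _ _ => by ext; simp)) 1 (by
    intro A v
    rw [one_mul]
    refine (ContinuousMap.norm_le _ (by positivity)).2 fun x => ?_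
    exact (A x).le_of_opNorm_le_of_le (A.norm_coe_le_norm x) (v.norm_coe_le_norm x))

@[simp] theorem pointwiseApply_apply (A : C(X, E →L[ℝ] F)) (v : C(X, E)) (x : X) :
    pointwiseApply A v x = A x (v x) := rfl

theorem hasFDerivAt_postcomp {g : E → F} (hg : ContDiff ℝ 1 g) (γ : C(X, E)) :
    HasFDerivAt (postcomp (X := X) hg.continuous)
      (pointwiseApply (postcomp (hg.continuous_fderiv one_ne_zero) γ)) γ := by
  rw [hasFDerivAt_iff_isLittleO_nhds_zero, Asymptotics.isLittleO_iff]
  intro ε hε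
  have hc : Continuous (postcomp (X := X) (hg.continuous_fderiv one_ne_zero)) :=
    ContinuousMap.continuous_postcomp ⟨_, hg.continuous_fderiv one_ne_zero⟩
  obtain ⟨δ, hδ, hδ'⟩ := (Metric.continuousAt_iff (α := C(X, E))
    (β := C(X, E →L[ℝ] F))).1 (hc.continuousAt (x := γ)) ε hε
  filter_upwards [Metric.ball_mem_nhds (0 : C(X, E)) hδ] with h hh
  have hhδ : ‖h‖ < δ := by simpa using hh
  refine (ContinuousMap.norm_le _ (by positivity)).2 fun x => ?_
  have hconv : Convex ℝ (segment ℝ (γ x) (γ x + h x)) := convex_segment _ _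
  have hbound : ∀ y ∈ segment ℝ (γ x) (γ x + h x),
      ‖fderiv ℝ g y - fderiv ℝ g (γ x)‖ ≤ ε := by
    intro y hy
    rw [segment_eq_image'] at hy
    obtain ⟨t, ⟨ht0, ht1⟩, rfl⟩ := hy
    have h1 : dist (γ + t • h) γ < δ := by
      rw [dist_eq_norm, add_sub_cancel_left, norm_smul, Real.norm_of_nonneg ht0]
      exact (mul_le_of_le_one_left (norm_nonneg _) ht1).trans_lt hhδ
    have h2 := (hδ' h1).le
    have h3 := (ContinuousMap.dist_apply_le_dist (f := postcomp (X := X)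
      (hg.continuous_fderiv one_ne_zero) (γ + t • h)) x).trans h2
    rw [dist_eq_norm] at h3
    simpa [postcomp] using h3
  have key := hconv.norm_image_sub_le_of_norm_hasFDerivWithin_le' (f := g)
    (fun y _ => (hg.differentiable one_ne_zero y).hasFDerivAt.hasFDerivWithinAt) hbound
    (left_mem_segment ℝ _ _) (right_mem_segment ℝ _ _)
  rw [add_sub_cancel_left] at key
  exact key.trans (by gcongr; exact h.norm_coe_le_norm x)

/-- Composition with a smooth map is smooth on the Banach space of continuous maps. -/
theorem contDiff_postcomp {g : E → F} (hg : ContDiff ℝ ∞ g) :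
    ContDiff ℝ ∞ (postcomp (X := X) hg.continuous) := by
  refine contDiff_infty.2 fun n => ?_
  induction n generalizing F with
  | zero =>
    exact contDiff_zero.2 (ContinuousMap.continuous_postcomp ⟨_, hg.continuous⟩)
  | succ k ih =>
    have hg1 : ContDiff ℝ 1 g := hg.of_le (by exact_mod_cast le_top)
    have hd := hasFDerivAt_postcomp (X := X) hg1
    have hfd : ContDiff ℝ ∞ (fderiv ℝ g) := hg.fderiv_right (by simp)
    push_cast
    refine contDiff_succ_iff_fderiv.2 ⟨fun γ => (hd γ).differentiableAt, ?_, ?_⟩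
    · intro h; exact absurd h (WithTop.natCast_ne_top k)
    have : fderiv ℝ (postcomp (X := X) hg.continuous) =
        fun γ => pointwiseApply (postcomp hfd.continuous γ) := by
      funext γ; exact (hd γ).fderiv
    rw [this]
    exact pointwiseApply.contDiff.comp (ih hfd)

end Composition

/-! ### The implicit equation of a flow -/

section ImplicitFlow

variable {X : Type*} [TopologicalSpace X] [CompactSpace X]

/-- The constant maps, as a continuous linear map into the space of continuous maps. -/
noncomputable def constCLM (X : Type*) [TopologicalSpace X] [CompactSpace X] (E : Type u)
    [NormedAddCommGroup E] [NormedSpace ℝ E] : E →L[ℝ] C(X, E) :=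
  LinearMap.mkContinuous
    { toFun := fun v => ContinuousMap.const X v
      map_add' := fun _ _ => by ext; simp
      map_smul' := fun _ _ => by ext; simp } 1
    (fun v => by
      rw [one_mul]
      exact (ContinuousMap.norm_le _ (norm_nonneg _)).2 fun x => le_rfl)

@[simp] theorem constCLM_apply {E : Type u} [NormedAddCommGroup E] [NormedSpace ℝ E] (v : E)
    (x : X) : constCLM X E v x = v := rfl

/-- An operator at distance less than one from the identity is invertible. -/
theorem ContinuousLinearMap.isInvertible_of_norm_sub_id_lt_one {E : Type*} [NormedAddCommGroup E]
    [NormedSpace ℝ E] [CompleteSpace E] {A : E →L[ℝ] E}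
    (hA : ‖A - ContinuousLinearMap.id ℝ E‖ < 1) : A.IsInvertible := by
  have h : ‖(1 : E →L[ℝ] E) - A‖ < 1 := by
    rw [norm_sub_rev]; exact hA
  have hu : IsUnit ((1 : E →L[ℝ] E) - (1 - A)) := isUnit_one_sub_of_norm_lt_one h
  rw [sub_sub_cancel] at hu
  obtain ⟨w, hw⟩ := hu
  exact ⟨ContinuousLinearEquiv.unitsEquiv ℝ E w, by rw [← hw]; rfl⟩

/-- Cutting off: a map which is smooth on an open set agrees near a given point with a smooth map
defined everywhere. -/
theorem ContDiffOn.exists_contDiff_eqOn_ball {E F : Type*} [NormedAddCommGroup E]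
    [NormedSpace ℝ E] [FiniteDimensional ℝ E] [NormedAddCommGroup F] [NormedSpace ℝ F]
    {Y : E → F} {Ω : Set E} (hΩ : IsOpen Ω) (hY : ContDiffOn ℝ ∞ Y Ω) {y₀ : E} (hy₀ : y₀ ∈ Ω) :
    ∃ Z : E → F, ContDiff ℝ ∞ Z ∧ ∃ r > 0, Metric.ball y₀ r ⊆ Ω ∧
      EqOn Z Y (Metric.ball y₀ r) := by
  obtain ⟨R, hR, hRΩ⟩ := Metric.isOpen_iff.1 hΩ y₀ hy₀
  let b : ContDiffBump y₀ := ⟨R / 4, R / 2, by positivity, by linarith⟩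
  refine ⟨fun y => b y • Y y, contDiff_iff_contDiffAt.2 fun y => ?_, R / 4, by positivity,
    (Metric.ball_subset_ball (by linarith)).trans hRΩ, fun y hy => ?_⟩
  · by_cases hy : y ∈ Ω
    · exact b.contDiff.contDiffAt.smul (hY.contDiffAt (hΩ.mem_nhds hy))
    · have hy' : y ∉ tsupport b := by
        rw [b.tsupport_eq]
        exact fun h => hy (hRΩ (Metric.closedBall_subset_ball (show R / 2 < R by linarith) h))
      have : (fun y => b y • Y y) =ᶠ[𝓝 y] fun _ => 0 := by
        filter_upwards [(isClosed_tsupport b).isOpen_compl.mem_nhds hy'] with z hz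
        rw [image_eq_zero_of_notMem_tsupport hz, zero_smul]
      exact contDiffAt_const.congr_of_eventuallyEq this
  · have : b y = 1 := b.one_of_mem_closedBall (Metric.ball_subset_closedBall hy)
    simp [this]

/-- The equation `γ = u + J (Y ∘ γ)` for a continuous map `γ : X → E` has a solution depending
smoothly on the point `u` and on the operator `J`, for `u` near `y₀` and `J` small. With Volterra
operators for `J`, this is the smooth dependence of the solutions of the controlled equation
`γ' = Y(γ) α` on the initial point and on the control `α`, even if `α` is merely measurable. -/
theorem exists_implicitFlow [Nonempty X] {E H : Type u} [NormedAddCommGroup E] [NormedSpace ℝ E]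
    [FiniteDimensional ℝ E] [NormedAddCommGroup H] [NormedSpace ℝ H] {Y : E → H}
    {Ω : Set E} (hΩ : IsOpen Ω) (hY : ContDiffOn ℝ ∞ Y Ω) {y₀ : E} (hy₀ : y₀ ∈ Ω) :
    ∃ U : Set E, IsOpen U ∧ y₀ ∈ U ∧ ∃ η > 0,
      ∃ Γ : E × (C(X, H) →L[ℝ] C(X, E)) → C(X, E),
        ContDiffOn ℝ ∞ Γ (U ×ˢ Metric.ball 0 η) ∧
        ∀ u ∈ U, ∀ J ∈ Metric.ball (0 : C(X, H) →L[ℝ] C(X, E)) η,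
          (∀ x, Γ (u, J) x ∈ Ω) ∧
          (∃ A : C(X, H), (∀ x, A x = Y (Γ (u, J) x)) ∧
            Γ (u, J) = ContinuousMap.const X u + J A) ∧
          ∀ x, (fderiv ℝ (fun u' => Γ (u', J) x) u).IsInvertible := by
  obtain ⟨Z, hZ, r, hr, hrΩ, hZY⟩ := hY.exists_contDiff_eqOn_ball hΩ hy₀
  let 𝒥 := C(X, H) →L[ℝ] C(X, E)
  let N : C(X, E) → C(X, H) := postcomp hZ.continuous
  have hN : ContDiff ℝ ∞ N := contDiff_postcomp hZ
  -- the solutions are `Θ (γ, J) = (u, J)`; `Θ` is inverted near the constant solution for `J = 0`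
  let Θ : C(X, E) × 𝒥 → C(X, E) × 𝒥 := fun q => (q.1 - q.2 (N q.1), q.2)
  have hΘ : ContDiff ℝ ∞ Θ :=
    (contDiff_fst.sub (contDiff_snd.clm_apply (hN.comp contDiff_fst))).prodMk contDiff_snd
  let γ₀ : C(X, E) := constCLM X E y₀
  let ev : 𝒥 →L[ℝ] C(X, E) := ContinuousLinearMap.apply ℝ C(X, E) (N γ₀)
  have hΘ' : HasFDerivAt Θ (((ContinuousLinearMap.fst ℝ C(X, E) 𝒥) -
      ev ∘L (ContinuousLinearMap.snd ℝ C(X, E) 𝒥)).prod (ContinuousLinearMap.snd ℝ C(X, E) 𝒥))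
      (γ₀, 0) := by
    have h1 : HasFDerivAt (fun q : C(X, E) × 𝒥 => N q.1)
        (fderiv ℝ N γ₀ ∘L ContinuousLinearMap.fst ℝ C(X, E) 𝒥) (γ₀, (0 : 𝒥)) :=
      HasFDerivAt.comp (γ₀, (0 : 𝒥)) (g := N)
        ((hN.differentiable (by simp)) γ₀).hasFDerivAt hasFDerivAt_fst
    have h2 := (hasFDerivAt_snd (𝕜 := ℝ) (p := (γ₀, (0 : 𝒥)))).clm_apply h1
    refine ((hasFDerivAt_fst.sub (h2.congr_fderiv ?_)).prodMk hasFDerivAt_snd)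
    ext <;> simp [ev] <;> rfl
  have hinv : (fderiv ℝ Θ (γ₀, 0)).IsInvertible := by
    rw [hΘ'.fderiv]
    refine ContinuousLinearMap.IsInvertible.of_inverse
      (g := ((ContinuousLinearMap.fst ℝ C(X, E) 𝒥) +
        ev ∘L (ContinuousLinearMap.snd ℝ C(X, E) 𝒥)).prod (ContinuousLinearMap.snd ℝ C(X, E) 𝒥))
      ?_ ?_ <;> ext <;> simp
  obtain ⟨e, hes, -, heΘ, hesymm, -⟩ :=
    hΘ.contDiffOn.exists_openPartialHomeomorph isOpen_univ (mem_univ (γ₀, (0 : 𝒥))) hinv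
  let ι : E × 𝒥 → C(X, E) × 𝒥 := fun q => (constCLM X E q.1, q.2)
  have hι : ContDiff ℝ ∞ ι := ((constCLM X E).contDiff.comp contDiff_fst).prodMk contDiff_snd
  let Γ : E × 𝒥 → C(X, E) := fun q => (e.symm (ι q)).1
  have hΘ0 : ∀ u : E, Θ (constCLM X E u, 0) = ι (u, 0) := by
    intro u; simp [Θ, ι]
  -- the open set on which the local inverse is available
  let W₀ : Set (E × 𝒥) := ι ⁻¹' e.target
  have hW₀ : IsOpen W₀ := e.open_target.preimage hι.continuous
  have hΓ : ContDiffOn ℝ ∞ Γ W₀ :=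
    contDiff_fst.comp_contDiffOn (hesymm.comp hι.contDiffOn fun q hq => hq)
  have hmem : (y₀, (0 : 𝒥)) ∈ W₀ := by
    change ι (y₀, 0) ∈ e.target
    rw [← hΘ0, ← heΘ]; exact e.map_source hes
  have hΓ0 : ∀ᶠ u in 𝓝 y₀, Γ (u, 0) = constCLM X E u := by
    have hc : ContinuousAt (fun u : E => (constCLM X E u, (0 : 𝒥))) y₀ := by fun_prop
    filter_upwards [hc.preimage_mem_nhds (e.open_source.mem_nhds hes)] with u hu
    change (e.symm (ι (u, 0))).1 = _
    rw [← hΘ0, ← heΘ, e.left_inv hu]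
  have hDΓ0 : fderiv ℝ Γ (y₀, 0) ∘L ContinuousLinearMap.inl ℝ E 𝒥 = constCLM X E := by
    have h1 : HasFDerivAt (fun u : E => Γ (u, (0 : 𝒥)))
        (fderiv ℝ Γ (y₀, 0) ∘L ContinuousLinearMap.inl ℝ E 𝒥) y₀ := by
      have := ((hΓ.contDiffAt (hW₀.mem_nhds hmem)).differentiableAt (by simp)).hasFDerivAt
      exact HasFDerivAt.comp (g := Γ) (f := fun e : E => (e, (0 : 𝒥))) y₀ this
        (hasFDerivAt_prodMk_left (𝕜 := ℝ) y₀ (0 : 𝒥))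
    have h2 : HasFDerivAt (fun u : E => Γ (u, (0 : 𝒥))) (constCLM X E) y₀ :=
      (constCLM X E).hasFDerivAt.congr_of_eventuallyEq hΓ0
    exact h1.unique h2
  -- shrink it so that solutions stay in the ball and the derivative in `u` is almost constant
  let W : Set (E × 𝒥) := (W₀ ∩ Γ ⁻¹' Metric.ball γ₀ r) ∩
    (fun q => fderiv ℝ Γ q ∘L ContinuousLinearMap.inl ℝ E 𝒥) ⁻¹' Metric.ball (constCLM X E) 1
  have hW1 : IsOpen (W₀ ∩ Γ ⁻¹' Metric.ball γ₀ r) :=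
    hΓ.continuousOn.isOpen_inter_preimage hW₀ Metric.isOpen_ball
  have hW : IsOpen W := by
    refine ContinuousOn.isOpen_inter_preimage ?_ hW1 Metric.isOpen_ball
    have := (hΓ.continuousOn_fderiv_of_isOpen hW₀ (by simp)).mono (inter_subset_left
      (s := W₀) (t := Γ ⁻¹' Metric.ball γ₀ r))
    exact this.clm_comp continuousOn_const
  have hmemW : (y₀, (0 : 𝒥)) ∈ W := by
    refine ⟨⟨hmem, ?_⟩, ?_⟩
    · rw [mem_preimage, hΓ0.self_of_nhds]; exact Metric.mem_ball_self hr
    · rw [mem_preimage, hDΓ0]; exact Metric.mem_ball_self one_pos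
  obtain ⟨U', hU', V', hV', hUV⟩ := mem_nhds_prod_iff.1 (hW.mem_nhds hmemW)
  obtain ⟨U, hUU', hU, hyU⟩ := mem_nhds_iff.1 hU'
  obtain ⟨η, hη, hηV⟩ := Metric.mem_nhds_iff.1 hV'
  have hsub : U ×ˢ Metric.ball (0 : 𝒥) η ⊆ W := (prod_mono hUU' hηV).trans hUV
  refine ⟨U, hU, hyU, η, hη, Γ, hΓ.mono fun q hq => (hsub hq).1.1, fun u hu J hJ => ?_⟩
  have hq : (u, J) ∈ W := hsub ⟨hu, hJ⟩
  have hball : ∀ x, Γ (u, J) x ∈ Metric.ball y₀ r := fun x =>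
    (ContinuousMap.dist_apply_le_dist (f := Γ (u, J)) (g := γ₀) x).trans_lt hq.1.2
  refine ⟨fun x => hrΩ (hball x), ⟨N (Γ (u, J)), fun x => hZY (hball x), ?_⟩, fun x => ?_⟩
  · have h1 : Θ (e.symm (ι (u, J))) = ι (u, J) := by
      rw [← heΘ]; exact e.right_inv hq.1.1
    have h2 : (e.symm (ι (u, J))).2 = J := congrArg Prod.snd h1
    have h3 : Γ (u, J) - (e.symm (ι (u, J))).2 (N (Γ (u, J))) = constCLM X E u :=
      congrArg Prod.fst h1
    rw [h2] at h3
    exact sub_eq_iff_eq_add.1 h3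
  · have h1 : HasFDerivAt (fun u' => Γ (u', J) x)
        ((ContinuousMap.evalCLM ℝ x) ∘L (fderiv ℝ Γ (u, J) ∘L ContinuousLinearMap.inl ℝ E 𝒥)) u := by
      have h := ((hΓ.contDiffAt (hW₀.mem_nhds hq.1.1)).differentiableAt (by simp)).hasFDerivAt
      exact (ContinuousMap.evalCLM ℝ x).hasFDerivAt.comp u
        (HasFDerivAt.comp (g := Γ) (f := fun e : E => (e, J)) u h
          (hasFDerivAt_prodMk_left (𝕜 := ℝ) u J))
    rw [h1.fderiv]
    -- at each `x`, the derivative in `u` is close to that of the constant map, the identity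
    refine ContinuousLinearMap.isInvertible_of_norm_sub_id_lt_one (lt_of_le_of_lt ?_
      (mem_ball_iff_norm.1 hq.2))
    refine ContinuousLinearMap.opNorm_le_bound _ (norm_nonneg _) fun v => ?_
    have h2 := (ContinuousMap.norm_coe_le_norm ((fderiv ℝ Γ (u, J) ∘L
      ContinuousLinearMap.inl ℝ E 𝒥 - constCLM X E) v) x)
    refine le_trans ?_ (h2.trans (ContinuousLinearMap.le_opNorm _ v))
    simp

end ImplicitFlow

/-! ### Controlled differential equations -/

section ControlledEquation

/-- Two maps which agree near each point of a preconnected set where they agree, are equal on this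
set as soon as they agree at one point. -/
theorem IsPreconnected.eqOn_of_eventually_eq {T X : Type*} [TopologicalSpace T]
    [TopologicalSpace X] [T2Space X] {I : Set T} (hI : IsPreconnected I) {y₁ y₂ : T → X}
    (h₁ : ContinuousOn y₁ I) (h₂ : ContinuousOn y₂ I)
    (h : ∀ x ∈ I, y₁ x = y₂ x → ∀ᶠ t in 𝓝[I] x, y₁ t = y₂ t) {s : T} (hs : s ∈ I)
    (heq : y₁ s = y₂ s) : EqOn y₁ y₂ I := by
  intro t ht
  refine hI.induction₂' (fun a b => y₁ a = y₂ a → y₁ b = y₂ b) (fun x hx => ?_)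
    (fun _ _ _ _ _ _ h1 h2 h3 => h2 (h1 h3)) hs ht heq
  by_cases hxe : y₁ x = y₂ x
  · filter_upwards [h x hx hxe] with t ht
    exact ⟨fun _ => ht, fun _ => hxe⟩
  · have hopen : {q : X × X | q.1 ≠ q.2} ∈ 𝓝 (y₁ x, y₂ x) :=
      (isOpen_ne_fun continuous_fst continuous_snd).mem_nhds hxe
    filter_upwards [((h₁ x hx).prodMk_nhds (h₂ x hx)).eventually hopen] with t ht
    exact ⟨fun h => absurd h hxe, fun h => absurd h ht⟩

variable {E : Type*} [NormedAddCommGroup E] [NormedSpace ℝ E]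
  {G : Type*} [NormedAddCommGroup G] [NormedSpace ℝ G]

/-- `y` is a Lipschitz solution on `I` of the controlled equation `y' = Y(y) α`. The control `α`
may be discontinuous, so that the equation is required almost everywhere. -/
def IsControlSol (Y : E → G →L[ℝ] E) (α : ℝ → G) (I : Set ℝ) (y : ℝ → E) : Prop :=
  (∃ K, LipschitzOnWith K y I) ∧ ∀ᵐ t, t ∈ I → HasDerivAt y (Y (y t) (α t)) t

theorem IsControlSol.mono {Y : E → G →L[ℝ] E} {α : ℝ → G} {I I' : Set ℝ} {y : ℝ → E}
    (h : IsControlSol Y α I y) (hI : I' ⊆ I) : IsControlSol Y α I' y := by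
  obtain ⟨⟨K, hK⟩, h2⟩ := h
  refine ⟨⟨K, hK.mono hI⟩, ?_⟩
  filter_upwards [h2] with t ht hmem using ht (hI hmem)

theorem IsControlSol.continuousOn {Y : E → G →L[ℝ] E} {α : ℝ → G} {I : Set ℝ} {y : ℝ → E}
    (h : IsControlSol Y α I y) : ContinuousOn y I :=
  h.1.choose_spec.continuousOn

variable [FiniteDimensional ℝ E]

/-- The fundamental theorem of calculus for Lipschitz functions. -/
theorem LipschitzOnWith.integral_eq_sub_of_ae_hasDerivAt {y f : ℝ → E} {K : NNReal} {a b : ℝ}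
    (hy : LipschitzOnWith K y (Icc a b)) (hd : ∀ᵐ t, t ∈ Icc a b → HasDerivAt y (f t) t) {s t : ℝ}
    (hs : s ∈ Icc a b) (ht : t ∈ Icc a b) : ∫ r in s..t, f r = y t - y s := by
  have hab : a ≤ b := hs.1.trans hs.2
  have hae : ∀ c : ℝ, ∀ᵐ t : ℝ, t ≠ c := fun c => by simp [ae_iff, measure_singleton]
  have hfK : ∀ᵐ t, t ∈ Icc a b → ‖f t‖ ≤ K := by
    filter_upwards [hd, hae a, hae b] with t ht hta htb hmem
    rw [← (ht hmem).deriv]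
    refine norm_deriv_le_of_lipschitzOn (s := Icc a b) (Icc_mem_nhds ?_ ?_) hy
    · exact lt_of_le_of_ne hmem.1 (Ne.symm hta)
    · exact lt_of_le_of_ne hmem.2 htb
  have hfm : AEStronglyMeasurable f (volume.restrict (Icc a b)) := by
    refine (stronglyMeasurable_deriv y).aestronglyMeasurable.congr ?_
    rw [EventuallyEq, ae_restrict_iff' measurableSet_Icc]
    filter_upwards [hd] with t ht hmem using (ht hmem).deriv
  have hint : IntegrableOn f (Icc a b) := by
    refine Integrable.of_bound hfm (K : ℝ) ?_
    rwa [ae_restrict_iff' measurableSet_Icc]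
  have hii : ∀ {s t}, s ∈ Icc a b → t ∈ Icc a b → IntervalIntegrable f volume s t :=
    fun hs ht => (hint.mono_set (uIcc_subset_Icc hs ht)).intervalIntegrable
  let Φ : ℝ → E := fun t => ∫ r in a..t, f r
  have ha : a ∈ Icc a b := left_mem_Icc.2 hab
  have hΦ : LipschitzOnWith K Φ (uIcc a b) := by
    rw [uIcc_of_le hab]
    refine LipschitzOnWith.of_dist_le_mul fun p hp q hq => ?_
    rw [dist_eq_norm, dist_eq_norm, Real.norm_eq_abs]
    change ‖(∫ r in a..p, f r) - ∫ r in a..q, f r‖ ≤ _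
    rw [intervalIntegral.integral_interval_sub_left (hii ha hp) (hii ha hq)]
    refine intervalIntegral.norm_integral_le_of_norm_le_const_ae ?_
    filter_upwards [hfK] with r hr hmem
    exact hr (uIcc_subset_Icc hq hp (uIoc_subset_uIcc hmem))
  have hy' : LipschitzOnWith K y (uIcc a b) := by rwa [uIcc_of_le hab]
  have hac := hy'.absolutelyContinuousOnInterval.sub hΦ.absolutelyContinuousOnInterval
  have hder : ∀ᵐ x, x ∈ uIcc a b → HasDerivAt (y - Φ) 0 x := by
    filter_upwards [hd, (hii ha (right_mem_Icc.2 hab)).ae_hasDerivAt_integral] with x h1 h2 hx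
    have := (h1 (by rwa [uIcc_of_le hab] at hx)).sub (h2 hx a left_mem_uIcc)
    rwa [sub_self] at this
  obtain ⟨C, hC⟩ := hac.const_of_ae_hasDerivAt_zero hder
  rw [uIcc_of_le hab] at hC
  have h1 := (hC s hs).trans (hC t ht).symm
  have h2 : Φ t - Φ s = ∫ r in s..t, f r :=
    intervalIntegral.integral_interval_sub_left (hii ha ht) (hii ha hs)
  rw [← h2]
  simp only [Pi.sub_apply] at h1
  rw [sub_eq_sub_iff_add_eq_add] at h1 ⊢
  rw [add_comm, ← h1, add_comm]

/-- Uniqueness on short intervals, by contraction. -/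
theorem IsControlSol.eqOn_of_small {Y : E → G →L[ℝ] E} {α : ℝ → G} {a b K : ℝ} {L : NNReal}
    {S : Set E} {y₁ y₂ : ℝ → E} (h₁ : IsControlSol Y α (Icc a b) y₁)
    (h₂ : IsControlSol Y α (Icc a b) y₂) (hL : LipschitzOnWith L Y S)
    (hm₁ : MapsTo y₁ (Icc a b) S) (hm₂ : MapsTo y₂ (Icc a b) S)
    (hα : ∀ t ∈ Icc a b, ‖α t‖ ≤ K) (hsmall : (b - a) * (L * K) < 1) {s : ℝ}
    (hs : s ∈ Icc a b) (heq : y₁ s = y₂ s) : EqOn y₁ y₂ (Icc a b) := by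
  have hc : ContinuousOn (fun t => ‖y₁ t - y₂ t‖) (Icc a b) :=
    (h₁.continuousOn.sub h₂.continuousOn).norm
  obtain ⟨t₁, ht₁, hmax⟩ := isCompact_Icc.exists_isMaxOn ⟨s, hs⟩ hc
  set μ := ‖y₁ t₁ - y₂ t₁‖ with hμ
  have hmax' : ∀ t ∈ Icc a b, ‖y₁ t - y₂ t‖ ≤ μ := fun t ht => hmax ht
  have hK : 0 ≤ K := (norm_nonneg _).trans (hα s hs)
  have hμ0 : 0 ≤ μ := norm_nonneg _
  have key : ‖y₁ t₁ - y₂ t₁‖ ≤ (L * K * μ) * |t₁ - s| := by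
    obtain ⟨K₁, hK₁⟩ := h₁.1
    obtain ⟨K₂, hK₂⟩ := h₂.1
    have hd : ∀ᵐ t, t ∈ Icc a b →
        HasDerivAt (fun t => y₁ t - y₂ t) (Y (y₁ t) (α t) - Y (y₂ t) (α t)) t := by
      filter_upwards [h₁.2, h₂.2] with t h1 h2 hmem using (h1 hmem).sub (h2 hmem)
    have := (hK₁.sub hK₂).integral_eq_sub_of_ae_hasDerivAt hd hs ht₁
    simp only [heq, sub_self, sub_zero] at this
    rw [← this]
    refine intervalIntegral.norm_integral_le_of_norm_le_const fun r hr => ?_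
    have hr' : r ∈ Icc a b := uIcc_subset_Icc hs ht₁ (uIoc_subset_uIcc hr)
    rw [← sub_apply]
    have h1 : ‖Y (y₁ r) - Y (y₂ r)‖ ≤ L * μ := by
      have := hL.norm_sub_le (hm₁ hr') (hm₂ hr')
      exact this.trans (by gcongr; exact hmax' r hr')
    calc ‖(Y (y₁ r) - Y (y₂ r)) (α r)‖ ≤ (L * μ) * K :=
          ContinuousLinearMap.le_of_opNorm_le_of_le _ h1 (hα r hr')
      _ = L * K * μ := by ring
  have habs : |t₁ - s| ≤ b - a := by
    rw [abs_le]; constructor <;> linarith [ht₁.1, ht₁.2, hs.1, hs.2]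
  -- `key` and `hsmall` say that the maximum `μ` is at most a proper fraction of itself
  have hμz : μ = 0 := by
    by_contra hne
    have hpos : 0 < μ := lt_of_le_of_ne hμ0 (Ne.symm hne)
    have h3 : μ ≤ ((b - a) * (L * K)) * μ := by
      calc μ ≤ (L * K * μ) * |t₁ - s| := key
        _ ≤ (L * K * μ) * (b - a) := by gcongr
        _ = _ := by ring
    nlinarith
  intro t ht
  have := hmax' t ht
  rw [hμz] at this
  exact sub_eq_zero.1 (norm_le_zero_iff.1 this)

/-- Local uniqueness. -/
theorem IsControlSol.eventually_eq {Y : E → G →L[ℝ] E} {α : ℝ → G} {a b K : ℝ} {Ω : Set E}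
    (hΩ : IsOpen Ω) (hY : ContDiffOn ℝ ∞ Y Ω) {y₁ y₂ : ℝ → E}
    (h₁ : IsControlSol Y α (Icc a b) y₁) (h₂ : IsControlSol Y α (Icc a b) y₂)
    (hα : ∀ t ∈ Icc a b, ‖α t‖ ≤ K) {s : ℝ} (hs : s ∈ Icc a b) (heq : y₁ s = y₂ s)
    (hmem : y₁ s ∈ Ω) : ∀ᶠ t in 𝓝[Icc a b] s, y₁ t = y₂ t := by
  obtain ⟨L, S, hS, hL⟩ := ((hY.contDiffAt (hΩ.mem_nhds hmem)).of_le
    (by exact_mod_cast le_top : (1 : WithTop ℕ∞) ≤ ∞)).exists_lipschitzOnWith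
  have e1 : ∀ᶠ t in 𝓝[Icc a b] s, y₁ t ∈ S ∧ y₂ t ∈ S :=
    ((h₁.continuousOn s hs).eventually hS).and
      ((h₂.continuousOn s hs).eventually (by rwa [← heq]))
  obtain ⟨ε, hε, hεS⟩ := Metric.mem_nhdsWithin_iff.1 e1
  have hK : 0 ≤ K := (norm_nonneg _).trans (hα s hs)
  -- an interval around `s`, contained in the ball of radius `ε` and short enough
  obtain ⟨ρ, hρ, hρε, hρs⟩ : ∃ ρ > 0, ρ < ε ∧ 2 * ρ * (L * K) < 1 := by
    refine ⟨min (ε / 2) (1 / (4 * (L * K + 1))), by positivity, ?_, ?_⟩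
    · exact (min_le_left _ _).trans_lt (by linarith)
    · have h0 : 0 ≤ (L : ℝ) * K := by positivity
      have h1 : min (ε / 2) (1 / (4 * ((L : ℝ) * K + 1))) ≤ 1 / (4 * (L * K + 1)) :=
        min_le_right _ _
      calc 2 * min (ε / 2) (1 / (4 * ((L : ℝ) * K + 1))) * (L * K)
          ≤ 2 * (1 / (4 * (L * K + 1))) * (L * K) := by gcongr
        _ < 1 := by rw [mul_one_div, div_mul_eq_mul_div, div_lt_one (by positivity)]; linarith
  have hIcc : Icc (max a (s - ρ)) (min b (s + ρ)) ⊆ Icc a b :=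
    Icc_subset_Icc (le_max_left _ _) (min_le_left _ _)
  have hSub : ∀ t ∈ Icc (max a (s - ρ)) (min b (s + ρ)), y₁ t ∈ S ∧ y₂ t ∈ S := by
    intro t ht
    refine hεS ⟨?_, hIcc ht⟩
    rw [Metric.mem_ball, Real.dist_eq, abs_lt]
    have h1 := (le_max_right a (s - ρ)).trans ht.1
    have h2 := ht.2.trans (min_le_right b (s + ρ))
    constructor <;> linarith
  have hEq := (h₁.mono hIcc).eqOn_of_small (h₂.mono hIcc) hL (fun t ht => (hSub t ht).1)
    (fun t ht => (hSub t ht).2) (fun t ht => hα t (hIcc ht)) (K := K) (by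
      refine lt_of_le_of_lt ?_ hρs
      have h1 := le_max_right a (s - ρ)
      have h2 := min_le_right b (s + ρ)
      gcongr
      linarith) (s := s) ⟨max_le hs.1 (by linarith), le_min hs.2 (by linarith)⟩ heq
  filter_upwards [self_mem_nhdsWithin, mem_nhdsWithin_of_mem_nhds
    (Icc_mem_nhds (show s - ρ < s by linarith) (show s < s + ρ by linarith))] with t ht ht'
  exact hEq ⟨max_le ht.1 ht'.1, le_min ht.2 ht'.2⟩

end ControlledEquation

/-! ### Flows of controlled equations -/

section ControlFlow

variable {E G H : Type u} [NormedAddCommGroup E] [NormedSpace ℝ E]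
  [NormedAddCommGroup G] [NormedSpace ℝ G] [NormedAddCommGroup H] [NormedSpace ℝ H]

/-- The interval `[-1, 1]`, which parametrizes `[t₀ - δ, t₀ + δ]` by `x ↦ t₀ + δ x`. -/
abbrev UnitTime : Type := Icc (-1 : ℝ) 1

instance : Nonempty UnitTime := ⟨⟨0, by norm_num⟩⟩

/-- The point of `[-1, 1]` which corresponds to the time `t`. -/
noncomputable def toUnitTime (t₀ δ t : ℝ) : UnitTime :=
  projIcc (-1 : ℝ) 1 (by norm_num) ((t - t₀) / δ)

theorem continuous_toUnitTime (t₀ δ : ℝ) : Continuous (toUnitTime t₀ δ) :=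
  continuous_projIcc.comp (by fun_prop)

theorem coe_toUnitTime {t₀ δ t : ℝ} (hδ : 0 < δ) (ht : t ∈ Icc (t₀ - δ) (t₀ + δ)) :
    t₀ + δ * (toUnitTime t₀ δ t : ℝ) = t := by
  have h : (t - t₀) / δ ∈ Icc (-1 : ℝ) 1 := by
    constructor
    · rw [le_div_iff₀ hδ]; linarith [ht.1]
    · rw [div_le_iff₀ hδ]; linarith [ht.2]
  rw [toUnitTime, projIcc_of_mem _ h]
  field_simp
  ring

section Volterra

variable (b : H →L[ℝ] G →L[ℝ] E) {α : ℝ → G} {K : ℝ}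

theorem intervalIntegrable_control (hα : AEStronglyMeasurable α volume) (hK : ∀ t, ‖α t‖ ≤ K)
    (t₀ δ : ℝ) (v : C(UnitTime, H)) (s t : ℝ) :
    IntervalIntegrable (fun r => b (v (toUnitTime t₀ δ r)) (α r)) volume s t := by
  have hm : AEStronglyMeasurable (fun r => b (v (toUnitTime t₀ δ r)) (α r)) volume :=
    b.aestronglyMeasurable_comp₂
      (v.continuous.comp (continuous_toUnitTime t₀ δ)).aestronglyMeasurable hα
  refine (intervalIntegrable_const (c := ‖b‖ * ‖v‖ * K)).mono_fun hm.restrict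
    (Eventually.of_forall fun r => ?_)
  have hK0 : 0 ≤ K := (norm_nonneg _).trans (hK 0)
  refine (b.le_opNorm₂ _ _).trans (le_trans ?_ (le_abs_self _))
  gcongr
  · exact v.norm_coe_le_norm _
  · exact hK r

theorem norm_integral_control_le (hK : ∀ t, ‖α t‖ ≤ K) (t₀ δ : ℝ) (v : C(UnitTime, H))
    (s t : ℝ) :
    ‖∫ r in s..t, b (v (toUnitTime t₀ δ r)) (α r)‖ ≤ ‖b‖ * ‖v‖ * K * |t - s| := by
  refine intervalIntegral.norm_integral_le_of_norm_le_const fun r _ => ?_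
  have hK0 : 0 ≤ K := (norm_nonneg _).trans (hK 0)
  refine (b.le_opNorm₂ _ _).trans ?_
  gcongr
  · exact v.norm_coe_le_norm _
  · exact hK r

/-- The Volterra operator `v ↦ ∫_{t₀} v α` on continuous functions of the rescaled time. -/
noncomputable def volterra (hα : AEStronglyMeasurable α volume) (hK : ∀ t, ‖α t‖ ≤ K)
    (t₀ δ : ℝ) : C(UnitTime, H) →L[ℝ] C(UnitTime, E) :=
  LinearMap.mkContinuous
    { toFun := fun v => ⟨fun x => ∫ r in t₀..(t₀ + δ * x), b (v (toUnitTime t₀ δ r)) (α r),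
        (intervalIntegral.continuous_primitive
          (fun s t => intervalIntegrable_control b hα hK t₀ δ v s t) t₀).comp (by fun_prop)⟩
      map_add' := fun v w => by
        ext x
        simp only [ContinuousMap.coe_mk, ContinuousMap.add_apply, map_add, add_apply]
        exact intervalIntegral.integral_add (intervalIntegrable_control b hα hK t₀ δ v _ _)
          (intervalIntegrable_control b hα hK t₀ δ w _ _)
      map_smul' := fun c v => by
        ext x
        simp only [ContinuousMap.coe_mk, ContinuousMap.smul_apply, map_smul, smul_apply,
          RingHom.id_apply]
        exact intervalIntegral.integral_smul c _ } (‖b‖ * K * |δ|) (fun v => by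
    have hK0 : 0 ≤ K := (norm_nonneg _).trans (hK 0)
    refine (ContinuousMap.norm_le _ (by positivity)).2 fun x => ?_
    refine (norm_integral_control_le b hK t₀ δ v _ _).trans ?_
    have hx : |t₀ + δ * (x : ℝ) - t₀| ≤ |δ| := by
      rw [add_sub_cancel_left, abs_mul]
      exact mul_le_of_le_one_right (abs_nonneg _) (abs_le.2 x.2)
    calc ‖b‖ * ‖v‖ * K * |t₀ + δ * (x : ℝ) - t₀| ≤ ‖b‖ * ‖v‖ * K * |δ| := by gcongr
      _ = ‖b‖ * K * |δ| * ‖v‖ := by ring)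

theorem volterra_apply (hα : AEStronglyMeasurable α volume) (hK : ∀ t, ‖α t‖ ≤ K)
    (t₀ δ : ℝ) (v : C(UnitTime, H)) (x : UnitTime) :
    volterra b hα hK t₀ δ v x = ∫ r in t₀..(t₀ + δ * x), b (v (toUnitTime t₀ δ r)) (α r) := rfl

theorem norm_volterra_le (hα : AEStronglyMeasurable α volume) (hK : ∀ t, ‖α t‖ ≤ K)
    (t₀ δ : ℝ) : ‖volterra b hα hK t₀ δ‖ ≤ ‖b‖ * K * |δ| := by
  have hK0 : 0 ≤ K := (norm_nonneg _).trans (hK 0)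
  exact LinearMap.mkContinuous_norm_le _ (by positivity) _

/-- A fixed point of the Volterra operator is a solution of the controlled equation. -/
theorem isControlSol_of_volterra [FiniteDimensional ℝ E]
    (hα : AEStronglyMeasurable α volume) (hK : ∀ t, ‖α t‖ ≤ K)
    {t₀ δ : ℝ} (hδ : 0 < δ) {Y : E → H} {γ : C(UnitTime, E)} {u : E} {A : C(UnitTime, H)}
    (hA : ∀ x, A x = Y (γ x))
    (hγ : γ = ContinuousMap.const UnitTime u + volterra b hα hK t₀ δ A) :
    IsControlSol (fun y => b (Y y)) α (Icc (t₀ - δ) (t₀ + δ)) (fun t => γ (toUnitTime t₀ δ t)) ∧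
      γ (toUnitTime t₀ δ t₀) = u := by
  have hval : ∀ t ∈ Icc (t₀ - δ) (t₀ + δ), γ (toUnitTime t₀ δ t) =
      u + ∫ r in t₀..t, b (A (toUnitTime t₀ δ r)) (α r) := by
    intro t ht
    have := congrArg (fun g : C(UnitTime, E) => g (toUnitTime t₀ δ t)) hγ
    simp only [ContinuousMap.add_apply, ContinuousMap.const_apply, volterra_apply,
      coe_toUnitTime hδ ht] at this
    exact this
  have ht₀ : t₀ ∈ Icc (t₀ - δ) (t₀ + δ) := ⟨by linarith, by linarith⟩
  have hii := intervalIntegrable_control b hα hK t₀ δ A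
  refine ⟨⟨⟨(‖b‖ * ‖A‖ * K).toNNReal, LipschitzOnWith.of_dist_le_mul fun p hp q hq => ?_⟩, ?_⟩, ?_⟩
  · have hK0 : 0 ≤ K := (norm_nonneg _).trans (hK 0)
    rw [dist_eq_norm, hval p hp, hval q hq, add_sub_add_left_eq_sub,
      intervalIntegral.integral_interval_sub_left (hii _ _) (hii _ _), Real.dist_eq,
      Real.coe_toNNReal _ (by positivity)]
    exact norm_integral_control_le b hK t₀ δ A q p
  · have hae : ∀ c : ℝ, ∀ᵐ t : ℝ, t ≠ c := fun c => by simp [ae_iff, measure_singleton]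
    filter_upwards [(hii (t₀ - δ) (t₀ + δ)).ae_hasDerivAt_integral, hae (t₀ - δ),
      hae (t₀ + δ)] with t ht h1 h2 hmem
    rw [uIcc_of_le (by linarith)] at ht
    have hd := (ht hmem t₀ ht₀).const_add u
    rw [hA] at hd
    refine hd.congr_of_eventuallyEq ?_
    filter_upwards [Icc_mem_nhds (lt_of_le_of_ne hmem.1 (Ne.symm h1))
      (lt_of_le_of_ne hmem.2 h2)] with r hr using hval r hr
  · rw [hval t₀ ht₀]; simp

end Volterra

theorem mem_ball_zero_of_opNorm_lt {V W : Type*} [SeminormedAddCommGroup V] [NormedSpace ℝ V]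
    [SeminormedAddCommGroup W] [NormedSpace ℝ W] {J : V →L[ℝ] W} {η : ℝ} (h : ‖J‖ < η) :
    J ∈ Metric.ball (0 : V →L[ℝ] W) η := by
  simpa using h

/-- `exists_controlFlow` for a field which is the composition of `Y` and a linear map: the values of
`Y` are in an abstract normed space. -/
theorem exists_controlFlow_bilin [FiniteDimensional ℝ E] (b : H →L[ℝ] G →L[ℝ] E) {Y : E → H}
    {Ω : Set E} (hΩ : IsOpen Ω)
    (hY : ContDiffOn ℝ ∞ Y Ω) {y₀ : E} (hy₀ : y₀ ∈ Ω) (K : ℝ) :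
    ∃ U : Set E, IsOpen U ∧ y₀ ∈ U ∧ ∃ δ > 0, ∀ (t₀ : ℝ) (α : ℝ → G),
      AEStronglyMeasurable α volume → (∀ t, ‖α t‖ ≤ K) → ∃ Γ : E → ℝ → E,
        (∀ u ∈ U, Γ u t₀ = u ∧ IsControlSol (fun y => b (Y y)) α (Icc (t₀ - δ) (t₀ + δ)) (Γ u) ∧
          ∀ t, Γ u t ∈ Ω) ∧
        ∀ t, ContDiffOn ℝ ∞ (fun u => Γ u t) U ∧
          ∀ u ∈ U, (fderiv ℝ (fun u => Γ u t) u).IsInvertible := by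
  obtain ⟨U, hU, hyU, η, hη, Γ, hΓ, h⟩ := exists_implicitFlow (X := UnitTime) hΩ hY hy₀
  -- the Volterra operator on an interval of radius `δ` has norm at most `‖b‖ K δ < η`
  let δ : ℝ := η / (2 * (‖b‖ * |K| + 1))
  have hδ : 0 < δ := by positivity
  refine ⟨U, hU, hyU, δ, hδ, fun t₀ α hα hK => ?_⟩
  let J := volterra b hα hK t₀ δ
  have hJ : J ∈ Metric.ball (0 : C(UnitTime, H) →L[ℝ] C(UnitTime, E)) η := by
    refine mem_ball_zero_of_opNorm_lt ((norm_volterra_le b hα hK t₀ δ).trans_lt ?_)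
    rw [abs_of_pos hδ]
    have h1 : ‖b‖ * K ≤ ‖b‖ * |K| := by gcongr; exact le_abs_self K
    calc ‖b‖ * K * δ ≤ ‖b‖ * |K| * δ := by gcongr
      _ = η * ((‖b‖ * |K|) / (2 * (‖b‖ * |K| + 1))) := by simp only [δ]; ring
      _ < η * 1 := by
          gcongr
          rw [div_lt_one (by positivity)]
          have : 0 ≤ ‖b‖ * |K| := by positivity
          linarith
      _ = η := mul_one η
  refine ⟨fun u t => Γ (u, J) (toUnitTime t₀ δ t), fun u hu => ?_, fun t => ⟨?_, ?_⟩⟩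
  · obtain ⟨h1, ⟨A, hA, hγ⟩, -⟩ := h u hu J hJ
    obtain ⟨h2, h3⟩ := isControlSol_of_volterra b hα hK hδ hA hγ
    exact ⟨h3, h2, fun t => h1 _⟩
  · have h1 : ContDiffOn ℝ ∞ (fun u => Γ (u, J)) U :=
      hΓ.comp (contDiff_prodMk_left J).contDiffOn fun u hu => ⟨hu, hJ⟩
    exact (ContinuousMap.evalCLM ℝ (toUnitTime t₀ δ t)).contDiff.comp_contDiffOn h1
  · exact fun u hu => (h u hu J hJ).2.2 _

/-- Local solutions of the controlled equation `y' = Y(y) α` exist on a time interval which only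
depends on a bound for the control, and they depend smoothly on the initial point; at each time
the solution map is a local diffeomorphism. -/
theorem exists_controlFlow [FiniteDimensional ℝ E] {Y : E → G →L[ℝ] E} {Ω : Set E} (hΩ : IsOpen Ω)
    (hY : ContDiffOn ℝ ∞ Y Ω) {y₀ : E} (hy₀ : y₀ ∈ Ω) (K : ℝ) :
    ∃ U : Set E, IsOpen U ∧ y₀ ∈ U ∧ ∃ δ > 0, ∀ (t₀ : ℝ) (α : ℝ → G),
      AEStronglyMeasurable α volume → (∀ t, ‖α t‖ ≤ K) → ∃ Γ : E → ℝ → E,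
        (∀ u ∈ U, Γ u t₀ = u ∧ IsControlSol Y α (Icc (t₀ - δ) (t₀ + δ)) (Γ u) ∧
          ∀ t, Γ u t ∈ Ω) ∧
        ∀ t, ContDiffOn ℝ ∞ (fun u => Γ u t) U ∧
          ∀ u ∈ U, (fderiv ℝ (fun u => Γ u t) u).IsInvertible :=
  exists_controlFlow_bilin (ContinuousLinearMap.id ℝ (G →L[ℝ] E)) hΩ hY hy₀ K

section ConstantControl

variable (b : H →L[ℝ] G →L[ℝ] E)

/-- The Volterra operator on `[-1, 1]` of a constant control. -/
noncomputable def volterraConst (w : G) : C(UnitTime, H) →L[ℝ] C(UnitTime, E) :=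
  volterra b (α := fun _ => w) aestronglyMeasurable_const (fun _ => le_refl ‖w‖) 0 1

theorem volterraConst_apply (w : G) (v : C(UnitTime, H)) (x : UnitTime) :
    volterraConst b w v x = ∫ r in (0 : ℝ)..(0 + 1 * x), b (v (toUnitTime 0 1 r)) w := rfl

theorem norm_volterraConst_le (w : G) : ‖volterraConst b w‖ ≤ ‖b‖ * ‖w‖ := by
  have := norm_volterra_le b (α := fun _ => w) aestronglyMeasurable_const
    (fun _ => le_refl ‖w‖) 0 1
  rwa [abs_one, mul_one] at this

theorem contDiff_volterraConst :
    ContDiff ℝ ∞ (volterraConst b : G → C(UnitTime, H) →L[ℝ] C(UnitTime, E)) := by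
  refine (IsLinearMap.with_bound ⟨fun w w' => ?_, fun c w => ?_⟩ ‖b‖
    (norm_volterraConst_le b)).contDiff
  · ext v x
    simp only [volterraConst_apply, add_apply, map_add, ContinuousMap.add_apply]
    exact intervalIntegral.integral_add
      (intervalIntegrable_control b (α := fun _ => w) aestronglyMeasurable_const
        (fun _ => le_refl ‖w‖) 0 1 v _ _)
      (intervalIntegrable_control b (α := fun _ => w') aestronglyMeasurable_const
        (fun _ => le_refl ‖w'‖) 0 1 v _ _)
  · ext v x
    simp only [volterraConst_apply, smul_apply, map_smul, ContinuousMap.smul_apply]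
    exact intervalIntegral.integral_smul c _

end ConstantControl

/-- `exists_controlFlow_const` for a field which is the composition of `Y` and a linear map. -/
theorem exists_controlFlow_const_bilin [FiniteDimensional ℝ E] (b : H →L[ℝ] G →L[ℝ] E) {Y : E → H}
    {Ω : Set E} (hΩ : IsOpen Ω)
    (hY : ContDiffOn ℝ ∞ Y Ω) {y₀ : E} (hy₀ : y₀ ∈ Ω) :
    ∃ U : Set E, IsOpen U ∧ y₀ ∈ U ∧ ∃ η > 0, ∃ Γ : G → E → ℝ → E,
      (∀ w ∈ Metric.ball (0 : G) η, ∀ u ∈ U, Γ w u 0 = u ∧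
        IsControlSol (fun y => b (Y y)) (fun _ => w) (Icc (-1) 1) (Γ w u) ∧ ∀ t, Γ w u t ∈ Ω) ∧
      (∀ t, ContDiffOn ℝ ∞ (fun q : G × E => Γ q.1 q.2 t) (Metric.ball 0 η ×ˢ U)) ∧
      (∀ w ∈ Metric.ball (0 : G) η, ∀ u ∈ U, ∀ t, (fderiv ℝ (fun u => Γ w u t) u).IsInvertible) ∧
      ∀ u ∈ U, ∀ t ∈ Icc (-1 : ℝ) 1, HasFDerivAt (fun w => Γ w u t) (t • b (Y u)) 0 := by
  obtain ⟨U, hU, hyU, η', hη', Γ, hΓ, h⟩ := exists_implicitFlow (X := UnitTime) hΩ hY hy₀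
  let J := volterraConst b
  let η : ℝ := η' / (‖b‖ + 1)
  have hη : 0 < η := by positivity
  have hJ : ∀ w ∈ Metric.ball (0 : G) η,
      J w ∈ Metric.ball (0 : C(UnitTime, H) →L[ℝ] C(UnitTime, E)) η' := by
    intro w hw
    rw [mem_ball_zero_iff] at hw
    refine mem_ball_zero_of_opNorm_lt ?_
    calc ‖J w‖ ≤ ‖b‖ * ‖w‖ := norm_volterraConst_le b w
      _ ≤ (‖b‖ + 1) * ‖w‖ := by gcongr; linarith
      _ < (‖b‖ + 1) * η := by gcongr
      _ = η' := by simp only [η]; field_simp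
  have hsm : ContDiffOn ℝ ∞ (fun q : G × E => Γ (q.2, J q.1)) (Metric.ball 0 η ×ˢ U) :=
    hΓ.comp (contDiff_snd.prodMk ((contDiff_volterraConst b).comp contDiff_fst)).contDiffOn
      fun q hq => ⟨hq.2, hJ _ hq.1⟩
  refine ⟨U, hU, hyU, η, hη, fun w u t => Γ (u, J w) (toUnitTime 0 1 t), fun w hw u hu => ?_,
    fun t => ?_, fun w hw u hu t => (h u hu _ (hJ w hw)).2.2 _, fun u hu t ht => ?_⟩
  · obtain ⟨h1, ⟨A, hA, hγ⟩, -⟩ := h u hu (J w) (hJ w hw)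
    obtain ⟨h2, h3⟩ := isControlSol_of_volterra b (α := fun _ => w) aestronglyMeasurable_const
      (fun _ => le_refl ‖w‖) one_pos hA hγ
    rw [zero_sub, zero_add] at h2
    exact ⟨h3, h2, fun t => h1 _⟩
  · exact (ContinuousMap.evalCLM ℝ (toUnitTime 0 1 t)).contDiff.comp_contDiffOn hsm
  · set x := toUnitTime 0 1 t with hx
    have hxt : (x : ℝ) = t := by
      have := coe_toUnitTime (t₀ := 0) one_pos (by simpa using ht)
      simpa using this
    have h0 : (0 : G) ∈ Metric.ball (0 : G) η := Metric.mem_ball_self hη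
    have hcont : ContinuousAt (fun w => Γ (u, J w)) 0 := by
      have h1 := (hsm.continuousOn.continuousAt
        ((Metric.isOpen_ball.prod hU).mem_nhds (show ((0 : G), u) ∈ _ from ⟨h0, hu⟩)))
      exact ContinuousAt.comp (f := fun w : G => (w, u)) h1 (by fun_prop)
    have hΓ0 : Γ (u, J 0) = ContinuousMap.const UnitTime u := by
      obtain ⟨-, ⟨A, hA, hγ⟩, -⟩ := h u hu (J 0) (hJ 0 h0)
      rw [hγ]
      ext y
      simp [J, volterraConst_apply]
    have huΩ : u ∈ Ω := by
      have := (h u hu (J 0) (hJ 0 h0)).1 x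
      rwa [hΓ0] at this
    -- the solution at time `t` is `u + ∫ Y(γ) w`, where `Y(γ)` is uniformly close to `Y u` as the
    -- solution for `w = 0` is constant
    rw [hasFDerivAt_iff_isLittleO_nhds_zero, Asymptotics.isLittleO_iff]
    intro c' hc'
    obtain ⟨c, hc, hcb⟩ : ∃ c > 0, ‖b‖ * c ≤ c' :=
      ⟨c' / (‖b‖ + 1), by positivity, by
        rw [mul_div_assoc', div_le_iff₀ (by positivity)]; nlinarith [norm_nonneg b]⟩
    have hYc : ∀ᶠ z in 𝓝 u, ‖Y z - Y u‖ < c := by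
      have := (hY.continuousOn.continuousAt (hΩ.mem_nhds huΩ)).eventually
        (Metric.ball_mem_nhds (Y u) hc)
      simpa only [Metric.mem_ball, dist_eq_norm] using this
    obtain ⟨ε, hε, hεc⟩ := Metric.eventually_nhds_iff.1 hYc
    have hev := hcont.eventually (Metric.ball_mem_nhds _ hε)
    filter_upwards [hev, Metric.ball_mem_nhds (0 : G) hη] with w hw1 hw2
    obtain ⟨-, ⟨A, hA, hγ⟩, -⟩ := h u hu (J w) (hJ w hw2)
    have hAc : ∀ y, ‖A y - Y u‖ ≤ c := fun y => by
      rw [hA]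
      refine (hεc ((ContinuousMap.dist_apply_le_dist (f := Γ (u, J w))
        (g := ContinuousMap.const UnitTime u) y).trans_lt ?_)).le
      rwa [← hΓ0]
    have e1 : Γ (u, J w) x - u = ∫ r in (0 : ℝ)..t, b (A (toUnitTime 0 1 r)) w := by
      have := congrArg (fun g : C(UnitTime, E) => g x) hγ
      simp only [ContinuousMap.add_apply, ContinuousMap.const_apply, J, volterraConst_apply, hxt,
        zero_add, one_mul] at this
      rw [sub_eq_iff_eq_add, add_comm]; exact this
    have e2 : (t • b (Y u)) w = ∫ r in (0 : ℝ)..t, b (Y u) w := by simp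
    have hii := intervalIntegrable_control b (α := fun _ => w) aestronglyMeasurable_const
      (fun _ => le_refl ‖w‖) 0 1 A 0 t
    rw [zero_add, hΓ0, ContinuousMap.const_apply, e1, e2,
      ← intervalIntegral.integral_sub hii intervalIntegrable_const]
    refine (intervalIntegral.norm_integral_le_of_norm_le_const (C := ‖b‖ * c * ‖w‖) fun r _ => ?_).trans ?_
    · rw [← sub_apply, ← map_sub]
      exact (b.le_opNorm₂ _ _).trans (by gcongr; exact hAc _)
    · rw [sub_zero]
      calc ‖b‖ * c * ‖w‖ * |t| ≤ ‖b‖ * c * ‖w‖ :=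
            mul_le_of_le_one_right (by positivity) (abs_le.2 ht)
        _ ≤ c' * ‖w‖ := by gcongr

/-- Solutions on `[-1, 1]` of the equation `y' = Y(y) w` with a small constant control `w`: they
depend smoothly on the initial point and on `w`, and to first order they move with velocity
`Y(u) w`. -/
theorem exists_controlFlow_const [FiniteDimensional ℝ E] {Y : E → G →L[ℝ] E} {Ω : Set E}
    (hΩ : IsOpen Ω)
    (hY : ContDiffOn ℝ ∞ Y Ω) {y₀ : E} (hy₀ : y₀ ∈ Ω) :
    ∃ U : Set E, IsOpen U ∧ y₀ ∈ U ∧ ∃ η > 0, ∃ Γ : G → E → ℝ → E,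
      (∀ w ∈ Metric.ball (0 : G) η, ∀ u ∈ U, Γ w u 0 = u ∧
        IsControlSol Y (fun _ => w) (Icc (-1) 1) (Γ w u) ∧ ∀ t, Γ w u t ∈ Ω) ∧
      (∀ t, ContDiffOn ℝ ∞ (fun q : G × E => Γ q.1 q.2 t) (Metric.ball 0 η ×ˢ U)) ∧
      (∀ w ∈ Metric.ball (0 : G) η, ∀ u ∈ U, ∀ t, (fderiv ℝ (fun u => Γ w u t) u).IsInvertible) ∧
      ∀ u ∈ U, ∀ t ∈ Icc (-1 : ℝ) 1, HasFDerivAt (fun w => Γ w u t) (t • Y u) 0 :=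
  exists_controlFlow_const_bilin (ContinuousLinearMap.id ℝ (G →L[ℝ] E)) hΩ hY hy₀

end ControlFlow

/-! ### Maps and curves in charts -/

section Charts

variable {m n : ℕ} {M N : Type*}
  [TopologicalSpace M] [ChartedSpace (EuclideanSpace ℝ (Fin m)) M]
  [TopologicalSpace N] [ChartedSpace (EuclideanSpace ℝ (Fin n)) N]

/-- The differential at `x` of the chart centered at `c`, with values in the model space. -/
noncomputable def chartDeriv (m : ℕ) {M : Type*} [TopologicalSpace M]
    [ChartedSpace (EuclideanSpace ℝ (Fin m)) M] (c x : M) : TangentSpace (𝓡 m) x →L[ℝ] EuclideanSpace ℝ (Fin m) :=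
  mfderiv (𝓡 m) 𝓘(ℝ, EuclideanSpace ℝ (Fin m)) (extChartAt (𝓡 m) c) x

/-- The representation of `f` in the charts centered at `c` and `c'`. -/
noncomputable def chartRep (m n : ℕ) {M N : Type*}
    [TopologicalSpace M] [ChartedSpace (EuclideanSpace ℝ (Fin m)) M]
    [TopologicalSpace N] [ChartedSpace (EuclideanSpace ℝ (Fin n)) N]
    (f : N → M) (c : N) (c' : M) (y : EuclideanSpace ℝ (Fin n)) :
    EuclideanSpace ℝ (Fin m) :=
  extChartAt (𝓡 m) c' (f ((extChartAt (𝓡 n) c).symm y))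

/-- The set on which `chartRep f c c'` is meaningful. -/
def chartRepDomain (m n : ℕ) {M N : Type*}
    [TopologicalSpace M] [ChartedSpace (EuclideanSpace ℝ (Fin m)) M]
    [TopologicalSpace N] [ChartedSpace (EuclideanSpace ℝ (Fin n)) N]
    (f : N → M) (c : N) (c' : M) : Set (EuclideanSpace ℝ (Fin n)) :=
  (extChartAt (𝓡 n) c).target ∩
    (extChartAt (𝓡 n) c).symm ⁻¹' (f ⁻¹' (extChartAt (𝓡 m) c').source)

theorem isOpen_chartRepDomain {f : N → M} (hf : Continuous f) (c : N) (c' : M) :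
    IsOpen (chartRepDomain m n f c c') :=
  (continuousOn_extChartAt_symm c).isOpen_inter_preimage (isOpen_extChartAt_target c)
    ((isOpen_extChartAt_source c').preimage hf)

theorem extChartAt_mem_chartRepDomain {f : N → M} {c : N} {c' : M} {u : N}
    (hu : u ∈ (extChartAt (𝓡 n) c).source) (hfu : f u ∈ (extChartAt (𝓡 m) c').source) :
    extChartAt (𝓡 n) c u ∈ chartRepDomain m n f c c' :=
  ⟨(extChartAt (𝓡 n) c).map_source hu, by
    rw [mem_preimage, (extChartAt (𝓡 n) c).left_inv hu]; exact hfu⟩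

theorem chartRep_extChartAt (f : N → M) {c : N} {c' : M} {u : N}
    (hu : u ∈ (extChartAt (𝓡 n) c).source) :
    chartRep m n f c c' (extChartAt (𝓡 n) c u) = extChartAt (𝓡 m) c' (f u) := by
  rw [chartRep, (extChartAt (𝓡 n) c).left_inv hu]

theorem isInvertible_chartDeriv [IsManifold (𝓡 m) ∞ M] {c x : M}
    (hx : x ∈ (extChartAt (𝓡 m) c).source) : (chartDeriv m c x).IsInvertible :=
  haveI : IsManifold (𝓡 m) 1 M := .of_le (n := ∞) (by exact_mod_cast le_top)
  isInvertible_mfderiv_extChartAt hx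

theorem contDiffOn_chartRep [IsManifold (𝓡 m) ∞ M] [IsManifold (𝓡 n) ∞ N] {f : N → M}
    (hf : ContMDiff (𝓡 n) (𝓡 m) ∞ f) (c : N) (c' : M) :
    ContDiffOn ℝ ∞ (chartRep m n f c c') (chartRepDomain m n f c c') := by
  rw [← contMDiffOn_iff_contDiffOn]
  have h1 : ContMDiffOn 𝓘(ℝ, EuclideanSpace ℝ (Fin n)) (𝓡 m) ∞
      (f ∘ (extChartAt (𝓡 n) c).symm) (extChartAt (𝓡 n) c).target :=
    hf.comp_contMDiffOn (contMDiffOn_extChartAt_symm c)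
  refine ContMDiffOn.comp (t := (chartAt (EuclideanSpace ℝ (Fin m)) c').source)
    contMDiffOn_extChartAt (h1.mono inter_subset_left) fun y hy => ?_
  have := hy.2
  rwa [mem_preimage, mem_preimage, extChartAt_source] at this

theorem mdifferentiableAt_extChartAt_of_mem [IsManifold (𝓡 m) ∞ M] {c x : M}
    (hx : x ∈ (extChartAt (𝓡 m) c).source) :
    MDifferentiableAt (𝓡 m) 𝓘(ℝ, EuclideanSpace ℝ (Fin m)) (extChartAt (𝓡 m) c) x :=
  haveI : IsManifold (𝓡 m) 1 M := .of_le (n := ∞) (by exact_mod_cast le_top)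
  mdifferentiableAt_extChartAt (by rwa [extChartAt_source] at hx)

theorem fderiv_chartRep_comp_chartDeriv [IsManifold (𝓡 m) ∞ M] [IsManifold (𝓡 n) ∞ N]
    {f : N → M} (hf : ContMDiff (𝓡 n) (𝓡 m) ∞ f) {c : N} {c' : M} {u : N}
    (hu : u ∈ (extChartAt (𝓡 n) c).source) (hfu : f u ∈ (extChartAt (𝓡 m) c').source)
    (v : TangentSpace (𝓡 n) u) :
    fderiv ℝ (chartRep m n f c c') (extChartAt (𝓡 n) c u) (chartDeriv n c u v) =
      chartDeriv m c' (f u) (mfderiv (𝓡 n) (𝓡 m) f u v) := by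
  have hP : MDifferentiableAt 𝓘(ℝ, EuclideanSpace ℝ (Fin n)) 𝓘(ℝ, EuclideanSpace ℝ (Fin m))
      (chartRep m n f c c') (extChartAt (𝓡 n) c u) :=
    (((contDiffOn_chartRep hf c c').contDiffAt ((isOpen_chartRepDomain hf.continuous c c').mem_nhds
      (extChartAt_mem_chartRepDomain hu hfu))).differentiableAt (by simp)).mdifferentiableAt
  have h1 := mfderiv_comp (I := 𝓡 n) u hP (mdifferentiableAt_extChartAt_of_mem hu)
  have h2 := mfderiv_comp (I := 𝓡 n) u (mdifferentiableAt_extChartAt_of_mem hfu)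
    ((hf u).mdifferentiableAt (by simp))
  have hev : (chartRep m n f c c') ∘ (extChartAt (𝓡 n) c) =ᶠ[𝓝 u] extChartAt (𝓡 m) c' ∘ f := by
    filter_upwards [(isOpen_extChartAt_source c).mem_nhds hu] with w hw
    exact chartRep_extChartAt f hw
  have h3 := h1.symm.trans (hev.mfderiv_eq.trans h2)
  rw [mfderiv_eq_fderiv] at h3
  exact congrArg (fun A : TangentSpace (𝓡 n) u →L[ℝ] EuclideanSpace ℝ (Fin m) => A v) h3

theorem surjective_fderiv_chartRep [IsManifold (𝓡 m) ∞ M]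
    [IsManifold (𝓡 n) ∞ N] {p : N → M} (hp : ContMDiff (𝓡 n) (𝓡 m) ∞ p) {c : N} {c' : M} {u : N}
    (hu : u ∈ (extChartAt (𝓡 n) c).source) (hpu : p u ∈ (extChartAt (𝓡 m) c').source) :
    Function.Surjective (fderiv ℝ (chartRep m n p c c') (extChartAt (𝓡 n) c u)) ↔
      Function.Surjective (mfderiv (𝓡 n) (𝓡 m) p u) := by
  obtain ⟨D, hD⟩ := isInvertible_chartDeriv hpu
  obtain ⟨D', hD'⟩ := isInvertible_chartDeriv hu
  have h1 := fun v => fderiv_chartRep_comp_chartDeriv hp hu hpu v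
  rw [← hD, ← hD'] at h1
  constructor
  · intro hs v
    obtain ⟨y, hy⟩ := hs (D v)
    refine ⟨D'.symm y, D.injective ?_⟩
    rw [← hy]
    refine (h1 _).symm.trans ?_
    exact congrArg _ (D'.apply_symm_apply y)
  · intro hs v
    obtain ⟨y, hy⟩ := hs (D.symm v)
    refine ⟨D' y, (h1 y).trans ?_⟩
    rw [hy]
    exact D.apply_symm_apply v

theorem fderiv_comp_extChartAt_symm_comp_chartDeriv [IsManifold (𝓡 n) ∞ N] {f : N → ℝ}
    (hf : ContMDiff (𝓡 n) 𝓘(ℝ, ℝ) ∞ f) {c u : N} (hu : u ∈ (extChartAt (𝓡 n) c).source)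
    (v : TangentSpace (𝓡 n) u) :
    fderiv ℝ (f ∘ (extChartAt (𝓡 n) c).symm) (extChartAt (𝓡 n) c u) (chartDeriv n c u v) =
      differentialAt f u v := by
  have hP : MDifferentiableAt 𝓘(ℝ, EuclideanSpace ℝ (Fin n)) 𝓘(ℝ, ℝ)
      (f ∘ (extChartAt (𝓡 n) c).symm) (extChartAt (𝓡 n) c u) :=
    (((contMDiffOn_iff_contDiffOn.1 (hf.comp_contMDiffOn (contMDiffOn_extChartAt_symm c))).contDiffAt
      ((isOpen_extChartAt_target c).mem_nhds ((extChartAt (𝓡 n) c).map_source hu))).differentiableAt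
      (by simp)).mdifferentiableAt
  have h1 := mfderiv_comp (I := 𝓡 n) u hP (mdifferentiableAt_extChartAt_of_mem hu)
  have hev : (f ∘ (extChartAt (𝓡 n) c).symm) ∘ (extChartAt (𝓡 n) c) =ᶠ[𝓝 u] f := by
    filter_upwards [(isOpen_extChartAt_source c).mem_nhds hu] with w hw
    exact congrArg f ((extChartAt (𝓡 n) c).left_inv hw)
  have h3 := h1.symm.trans hev.mfderiv_eq
  rw [mfderiv_eq_fderiv] at h3
  exact congrArg (fun A : TangentSpace (𝓡 n) u →L[ℝ] ℝ => A v) h3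

/-- The velocity of a curve in a chart. -/
theorem hasDerivAt_extChartAt_comp [IsManifold (𝓡 m) ∞ M] {σ : ℝ → M} {t : ℝ} {c : M}
    (hσ : MDifferentiableAt 𝓘(ℝ, ℝ) (𝓡 m) σ t) (hc : σ t ∈ (extChartAt (𝓡 m) c).source) :
    HasDerivAt (fun r => extChartAt (𝓡 m) c (σ r))
      (chartDeriv m c (σ t) (mfderiv 𝓘(ℝ, ℝ) (𝓡 m) σ t (1 : ℝ))) t := by
  have h1 := (mdifferentiableAt_extChartAt_of_mem hc).hasMFDerivAt.comp t hσ.hasMFDerivAt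
  have h2 : HasFDerivAt (fun r => extChartAt (𝓡 m) c (σ r))
    (((chartDeriv m c (σ t)).comp (mfderiv 𝓘(ℝ, ℝ) (𝓡 m) σ t) : TangentSpace 𝓘(ℝ, ℝ) t →L[ℝ] _) :
      ℝ →L[ℝ] EuclideanSpace ℝ (Fin m)) t := hasMFDerivAt_iff_hasFDerivAt.1 h1
  exact h2.hasDerivAt

theorem mdifferentiableAt_of_hasDerivAt_extChartAt [IsManifold (𝓡 m) ∞ M] {σ : ℝ → M} {t : ℝ}
    {c : M} {v : EuclideanSpace ℝ (Fin m)} (hσ : ContinuousAt σ t)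
    (hc : σ t ∈ (extChartAt (𝓡 m) c).source)
    (hv : HasDerivAt (fun r => extChartAt (𝓡 m) c (σ r)) v t) :
    MDifferentiableAt 𝓘(ℝ, ℝ) (𝓡 m) σ t ∧
      chartDeriv m c (σ t) (mfderiv 𝓘(ℝ, ℝ) (𝓡 m) σ t (1 : ℝ)) = v := by
  have hsm : MDifferentiableAt 𝓘(ℝ, EuclideanSpace ℝ (Fin m)) (𝓡 m) (extChartAt (𝓡 m) c).symm
      (extChartAt (𝓡 m) c (σ t)) :=
    ((contMDiffOn_extChartAt_symm (n := ∞) c).contMDiffAt ((isOpen_extChartAt_target c).mem_nhds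
      ((extChartAt (𝓡 m) c).map_source hc))).mdifferentiableAt (by simp)
  have h1 := hsm.comp t hv.differentiableAt.mdifferentiableAt
  have hev : σ =ᶠ[𝓝 t] (extChartAt (𝓡 m) c).symm ∘ fun r => extChartAt (𝓡 m) c (σ r) := by
    filter_upwards [hσ.preimage_mem_nhds ((isOpen_extChartAt_source c).mem_nhds hc)] with r hr
    exact ((extChartAt (𝓡 m) c).left_inv hr).symm
  have h2 : MDifferentiableAt 𝓘(ℝ, ℝ) (𝓡 m) σ t := h1.congr_of_eventuallyEq hev
  exact ⟨h2, (hasDerivAt_extChartAt_comp h2 hc).unique hv⟩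

/-- The Lipschitz condition at a point can be checked in any chart around it. -/
theorem exists_lipschitzOnWith_extChartAt [IsManifold (𝓡 m) ∞ M] {σ : ℝ → M} {t : ℝ} {c c' : M}
    {I : Set ℝ} (hσ : ContinuousWithinAt σ I t)
    (hc : σ t ∈ (extChartAt (𝓡 m) c).source) (hc' : σ t ∈ (extChartAt (𝓡 m) c').source)
    (h : ∃ K, ∃ s ∈ 𝓝[I] t, LipschitzOnWith K (fun r => extChartAt (𝓡 m) c (σ r)) s) :
    ∃ K, ∃ s ∈ 𝓝[I] t, LipschitzOnWith K (fun r => extChartAt (𝓡 m) c' (σ r)) s := by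
  obtain ⟨K, s, hs, hK⟩ := h
  have hid : ContMDiff (𝓡 m) (𝓡 m) ∞ (id : M → M) := contMDiff_id
  have hmem : extChartAt (𝓡 m) c (σ t) ∈ chartRepDomain m m (id : M → M) c c' :=
    extChartAt_mem_chartRepDomain hc hc'
  obtain ⟨L, S, hS, hL⟩ := (((contDiffOn_chartRep hid c c').contDiffAt
    ((isOpen_chartRepDomain continuous_id c c').mem_nhds hmem)).of_le
    (by exact_mod_cast le_top : (1 : WithTop ℕ∞) ≤ ∞)).exists_lipschitzOnWith
  have h1 : ∀ᶠ r in 𝓝[I] t, σ r ∈ (extChartAt (𝓡 m) c).source :=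
    hσ.eventually ((isOpen_extChartAt_source c).mem_nhds hc)
  have h2 : ∀ᶠ r in 𝓝[I] t, extChartAt (𝓡 m) c (σ r) ∈ S :=
    ((continuousAt_extChartAt' hc).comp_continuousWithinAt hσ).eventually hS
  refine ⟨L * K, s ∩ {r | σ r ∈ (extChartAt (𝓡 m) c).source ∧ extChartAt (𝓡 m) c (σ r) ∈ S},
    inter_mem hs (h1.and h2), ?_⟩
  have h3 := hL.comp (hK.mono (inter_subset_left (t := {r | σ r ∈ (extChartAt (𝓡 m) c).source ∧
    extChartAt (𝓡 m) c (σ r) ∈ S}))) fun r hr => hr.2.2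
  intro r hr q hq
  have h4 := h3 hr hq
  simp only [Function.comp_apply] at h4
  rwa [chartRep_extChartAt id hr.2.1, chartRep_extChartAt id hq.2.1] at h4

end Charts

section Conjugation

variable {m : ℕ} {M : Type*} [TopologicalSpace M] [ChartedSpace (EuclideanSpace ℝ (Fin m)) M]

/-- A partial homeomorphism of `M` with smooth restrictions in both directions: an element of the
pseudogroup of local diffeomorphisms. -/
structure IsLocalDiffeoOn (n m : ℕ) {N M : Type*} [TopologicalSpace N]
    [ChartedSpace (EuclideanSpace ℝ (Fin n)) N] [TopologicalSpace M]
    [ChartedSpace (EuclideanSpace ℝ (Fin m)) M] (φ : OpenPartialHomeomorph N M) : Prop where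
  contMDiffOn : ContMDiffOn (𝓡 n) (𝓡 m) ∞ φ φ.source
  contMDiffOn_symm : ContMDiffOn (𝓡 m) (𝓡 n) ∞ φ.symm φ.target

theorem IsLocalDiffeoOn.symm {n : ℕ} {N : Type*} [TopologicalSpace N]
    [ChartedSpace (EuclideanSpace ℝ (Fin n)) N] {φ : OpenPartialHomeomorph N M}
    (h : IsLocalDiffeoOn n m φ) : IsLocalDiffeoOn m n φ.symm :=
  ⟨h.2, by simpa using h.1⟩

theorem IsLocalDiffeoOn.trans {n k : ℕ} {N P : Type*} [TopologicalSpace N]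
    [ChartedSpace (EuclideanSpace ℝ (Fin n)) N] [TopologicalSpace P]
    [ChartedSpace (EuclideanSpace ℝ (Fin k)) P] {φ : OpenPartialHomeomorph N M}
    {ψ : OpenPartialHomeomorph M P} (h : IsLocalDiffeoOn n m φ)
    (h' : IsLocalDiffeoOn m k ψ) :
    IsLocalDiffeoOn n k (φ.trans ψ) := by
  refine ⟨?_, ?_⟩
  · rw [φ.coe_trans, φ.trans_source]
    exact h'.1.comp (h.1.mono inter_subset_left) fun x hx => hx.2
  · rw [φ.coe_trans_symm, φ.trans_target]
    exact h.2.comp (h'.2.mono inter_subset_left) fun x hx => hx.2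

theorem isLocalDiffeoOn_chartAt [IsManifold (𝓡 m) ∞ M] (c : M) :
    IsLocalDiffeoOn m m (chartAt (EuclideanSpace ℝ (Fin m)) c) :=
  ⟨contMDiffOn_chart, contMDiffOn_chart_symm⟩

/-- A local diffeomorphism of the model space, seen in a chart. -/
noncomputable def chartConj (c : M)
    (e : OpenPartialHomeomorph (EuclideanSpace ℝ (Fin m)) (EuclideanSpace ℝ (Fin m))) :
    OpenPartialHomeomorph M M :=
  (chartAt (EuclideanSpace ℝ (Fin m)) c).trans
    (e.trans (chartAt (EuclideanSpace ℝ (Fin m)) c).symm)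

variable {c : M} {e : OpenPartialHomeomorph (EuclideanSpace ℝ (Fin m)) (EuclideanSpace ℝ (Fin m))}

theorem isLocalDiffeoOn_chartConj [IsManifold (𝓡 m) ∞ M] (h : ContDiffOn ℝ ∞ e e.source)
    (h' : ContDiffOn ℝ ∞ e.symm e.target) :
    IsLocalDiffeoOn m m (chartConj c e) :=
  (isLocalDiffeoOn_chartAt c).trans
    (IsLocalDiffeoOn.trans (m := m) ⟨contMDiffOn_iff_contDiffOn.2 h, contMDiffOn_iff_contDiffOn.2 h'⟩
      (isLocalDiffeoOn_chartAt c).symm)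

theorem mem_chartConj_source (ht : e.target ⊆ (extChartAt (𝓡 m) c).target) {x : M} :
    x ∈ (chartConj c e).source ↔
      x ∈ (extChartAt (𝓡 m) c).source ∧ extChartAt (𝓡 m) c x ∈ e.source := by
  have h0 : (extChartAt (𝓡 m) c).target = (chartAt (EuclideanSpace ℝ (Fin m)) c).target := by
    simp [mfld_simps]
  rw [h0] at ht
  simp only [chartConj, mfld_simps]
  constructor
  · rintro ⟨h1, h2, h3⟩; exact ⟨h1, h2⟩
  · rintro ⟨h1, h2⟩; exact ⟨h1, h2, ht (e.map_source h2)⟩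

theorem chartConj_apply (x : M) :
    chartConj c e x = (extChartAt (𝓡 m) c).symm (e (extChartAt (𝓡 m) c x)) := by
  simp [chartConj, mfld_simps]

end Conjugation

/-! ### The symbol of a diffusion operator in a chart -/

section Symbols

variable {m n : ℕ} {M N : Type*}
  [TopologicalSpace M] [ChartedSpace (EuclideanSpace ℝ (Fin m)) M]
  [TopologicalSpace N] [ChartedSpace (EuclideanSpace ℝ (Fin n)) N]

theorem contDiffOn_comp_extChartAt_symm [IsManifold (𝓡 m) ∞ M] (f : C^∞⟮𝓡 m, M; ℝ⟯) (c : M) :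
    ContDiffOn ℝ ∞ (f ∘ (extChartAt (𝓡 m) c).symm) (extChartAt (𝓡 m) c).target :=
  contMDiffOn_iff_contDiffOn.1 (f.contMDiff.comp_contMDiffOn (contMDiffOn_extChartAt_symm c))

/-- The second derivative of a product. -/
theorem fderiv_fderiv_mul {E : Type*} [NormedAddCommGroup E] [NormedSpace ℝ E] {F G : E → ℝ}
    {y : E} (hF : ContDiffAt ℝ ∞ F y) (hG : ContDiffAt ℝ ∞ G y) (v w : E) :
    fderiv ℝ (fderiv ℝ (F * G)) y v w =
      F y * fderiv ℝ (fderiv ℝ G) y v w + fderiv ℝ F y v * fderiv ℝ G y w +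
      (G y * fderiv ℝ (fderiv ℝ F) y v w + fderiv ℝ G y v * fderiv ℝ F y w) := by
  have hev : fderiv ℝ (F * G) =ᶠ[𝓝 y] fun y => F y • fderiv ℝ G y + G y • fderiv ℝ F y := by
    have hF1 : ContDiffAt ℝ 1 F y := hF.of_le (by exact_mod_cast le_top)
    have hG1 : ContDiffAt ℝ 1 G y := hG.of_le (by exact_mod_cast le_top)
    filter_upwards [hF1.eventually (by simp), hG1.eventually (by simp)] with y h1 h2
    exact fderiv_mul (h1.differentiableAt (by simp)) (h2.differentiableAt (by simp))
  have hFd : DifferentiableAt ℝ F y := hF.differentiableAt (by simp)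
  have hGd : DifferentiableAt ℝ G y := hG.differentiableAt (by simp)
  have hFd2 : DifferentiableAt ℝ (fderiv ℝ F) y :=
    (hF.fderiv_right (m := ∞) (by simp)).differentiableAt (by simp)
  have hGd2 : DifferentiableAt ℝ (fderiv ℝ G) y :=
    (hG.fderiv_right (m := ∞) (by simp)).differentiableAt (by simp)
  rw [hev.fderiv_eq, fderiv_fun_add (hFd.fun_smul hGd2) (hGd.fun_smul hFd2),
    fderiv_fun_smul hFd hGd2, fderiv_fun_smul hGd hFd2]
  simp

/-- The symmetric operator `β ↦ ½ ∑ aⁱʲ βⱼ ∂ᵢ` associated with a matrix. -/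
noncomputable def matrixSymbol (a : Matrix (Fin m) (Fin m) ℝ) :
    (EuclideanSpace ℝ (Fin m) →L[ℝ] ℝ) →L[ℝ] EuclideanSpace ℝ (Fin m) :=
  ∑ i, ∑ j, (1 / 2 * a i j) • (ContinuousLinearMap.apply ℝ ℝ
    (EuclideanSpace.single j (1 : ℝ))).smulRight (EuclideanSpace.single i (1 : ℝ))

theorem apply_matrixSymbol (a : Matrix (Fin m) (Fin m) ℝ)
    (β γ : EuclideanSpace ℝ (Fin m) →L[ℝ] ℝ) :
    γ (matrixSymbol a β) = 1 / 2 * ∑ i, ∑ j, a i j * (γ (EuclideanSpace.single i 1) *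
      β (EuclideanSpace.single j 1)) := by
  simp only [matrixSymbol, sum_apply, smul_apply,
    ContinuousLinearMap.smulRight_apply, ContinuousLinearMap.apply_apply, map_sum, map_smul,
    smul_eq_mul, Finset.mul_sum]
  exact Finset.sum_congr rfl fun i _ => Finset.sum_congr rfl fun j _ => by ring

theorem contDiffOn_sum_sum_smul {E V ι : Type*} [NormedAddCommGroup E] [NormedSpace ℝ E]
    [NormedAddCommGroup V] [NormedSpace ℝ V] [Fintype ι] {f : E → ι → ι → ℝ} {s : Set E}
    (hf : ∀ i j, ContDiffOn ℝ ∞ (fun y => f y i j) s) (w : ι → ι → V) :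
    ContDiffOn ℝ ∞ (fun y => ∑ i, ∑ j, f y i j • w i j) s :=
  ContDiffOn.sum fun i _ => ContDiffOn.sum fun j _ => (hf i j).smul contDiffOn_const

/-- In a chart, a diffusion operator satisfies `Γ(f, g) = ½ ∑ aⁱʲ ∂ᵢf ∂ⱼg`. -/
theorem carreDuChamp_eq_apply_matrixSymbol [IsManifold (𝓡 m) ∞ M]
    {L : C^∞⟮𝓡 m, M; ℝ⟯ →ₗ[ℝ] C^∞⟮𝓡 m, M; ℝ⟯} {c : M} {y : EuclideanSpace ℝ (Fin m)}
    (hy : y ∈ (extChartAt (𝓡 m) c).target) {a : Matrix (Fin m) (Fin m) ℝ} {b : Fin m → ℝ}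
    (ha : a.PosSemidef)
    (hL : ∀ (f : C^∞⟮𝓡 m, M; ℝ⟯), L f ((extChartAt (𝓡 m) c).symm y) =
        (1 / 2) * ∑ i, ∑ j, a i j *
          fderiv ℝ (fderiv ℝ (f ∘ (extChartAt (𝓡 m) c).symm)) y
            (EuclideanSpace.single i 1) (EuclideanSpace.single j 1) +
        ∑ i, b i * fderiv ℝ (f ∘ (extChartAt (𝓡 m) c).symm) y (EuclideanSpace.single i 1))
    (f g : C^∞⟮𝓡 m, M; ℝ⟯) :
    carreDuChamp L f g ((extChartAt (𝓡 m) c).symm y) =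
      fderiv ℝ (f ∘ (extChartAt (𝓡 m) c).symm) y
        (matrixSymbol a (fderiv ℝ (g ∘ (extChartAt (𝓡 m) c).symm) y)) := by
  have hnhds := (isOpen_extChartAt_target (I := 𝓡 m) c).mem_nhds hy
  have hF := (contDiffOn_comp_extChartAt_symm f c).contDiffAt hnhds
  have hG := (contDiffOn_comp_extChartAt_symm g c).contDiffAt hnhds
  have hfg : ((f * g : C^∞⟮𝓡 m, M; ℝ⟯) : M → ℝ) ∘ (extChartAt (𝓡 m) c).symm =
      (f ∘ (extChartAt (𝓡 m) c).symm) * (g ∘ (extChartAt (𝓡 m) c).symm) := rfl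
  have hfx : f ((extChartAt (𝓡 m) c).symm y) = (f ∘ (extChartAt (𝓡 m) c).symm) y := rfl
  have hgx : g ((extChartAt (𝓡 m) c).symm y) = (g ∘ (extChartAt (𝓡 m) c).symm) y := rfl
  rw [carreDuChamp, hL f, hL g, hL (f * g), hfg, hfx, hgx, apply_matrixSymbol]
  set F := f ∘ (extChartAt (𝓡 m) c).symm
  set G := g ∘ (extChartAt (𝓡 m) c).symm
  have h1 : ∀ v, fderiv ℝ (F * G) y v = F y * fderiv ℝ G y v + G y * fderiv ℝ F y v := by
    intro v
    rw [fderiv_mul (hF.differentiableAt (by simp)) (hG.differentiableAt (by simp))]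
    simp
  have hsymm : ∀ i j, a i j = a j i := fun i j => by
    simpa using (ha.isHermitian.apply i j).symm
  have hswap : ∑ i, ∑ j, a i j * (fderiv ℝ G y (EuclideanSpace.single i 1) *
        fderiv ℝ F y (EuclideanSpace.single j 1)) =
      ∑ i, ∑ j, a i j * (fderiv ℝ F y (EuclideanSpace.single i 1) *
        fderiv ℝ G y (EuclideanSpace.single j 1)) := by
    rw [Finset.sum_comm]
    refine Finset.sum_congr rfl fun i _ => Finset.sum_congr rfl fun j _ => ?_
    rw [hsymm j i]; ring
  simp only [h1, fderiv_fderiv_mul hF hG, mul_add, Finset.sum_add_distrib, hswap,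
    mul_left_comm _ (F y), mul_left_comm _ (G y), ← Finset.mul_sum]
  ring

/-- The symbol of a diffusion operator in a chart: a smooth family of symmetric positive
semi-definite operators. -/
theorem IsDiffusionOperator.exists_symbol_chart [IsManifold (𝓡 m) ∞ M] [T2Space M]
    {L : C^∞⟮𝓡 m, M; ℝ⟯ →ₗ[ℝ] C^∞⟮𝓡 m, M; ℝ⟯} (hL : IsDiffusionOperator L) (c : M) :
    ∃ S : EuclideanSpace ℝ (Fin m) →
        (EuclideanSpace ℝ (Fin m) →L[ℝ] ℝ) →L[ℝ] EuclideanSpace ℝ (Fin m),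
      ContDiffOn ℝ ∞ S (extChartAt (𝓡 m) c).target ∧
      (∀ y ∈ (extChartAt (𝓡 m) c).target, ∀ β γ : EuclideanSpace ℝ (Fin m) →L[ℝ] ℝ, γ (S y β) = β (S y γ)) ∧
      (∀ y ∈ (extChartAt (𝓡 m) c).target, ∀ β : EuclideanSpace ℝ (Fin m) →L[ℝ] ℝ, 0 ≤ β (S y β)) ∧
      ∀ x ∈ (extChartAt (𝓡 m) c).source, ∀ β : EuclideanSpace ℝ (Fin m) →L[ℝ] ℝ,
        chartDeriv m c x (symbol L x (β.comp (chartDeriv m c x))) = S (extChartAt (𝓡 m) c x) β := by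
  obtain ⟨a, b, ha, -, hpos, hloc⟩ := hL c
  refine ⟨fun y => matrixSymbol (a y), ?_, fun y hy β γ => ?_, fun y hy β => ?_, fun x hx β => ?_⟩
  · exact contDiffOn_sum_sum_smul (fun i j => contDiffOn_const.mul (ha i j)) _
  · rw [apply_matrixSymbol, apply_matrixSymbol, Finset.sum_comm]
    congr 1
    refine Finset.sum_congr rfl fun i _ => Finset.sum_congr rfl fun j _ => ?_
    have : a y j i = a y i j := by simpa using ((hpos y hy).isHermitian.apply i j)
    rw [this]; ring
  · have h := (hpos y hy).dotProduct_mulVec_nonneg fun i => β (EuclideanSpace.single i 1)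
    rw [apply_matrixSymbol]
    refine mul_nonneg (by norm_num) (h.trans_eq ?_)
    simp only [dotProduct, Matrix.mulVec, Finset.mul_sum]
    refine Finset.sum_congr rfl fun i _ => Finset.sum_congr rfl fun j _ => ?_
    simp; ring
  · obtain ⟨D, hD⟩ := isInvertible_chartDeriv hx
    have hy : extChartAt (𝓡 m) c x ∈ (extChartAt (𝓡 m) c).target :=
      (extChartAt (𝓡 m) c).map_source hx
    set y := extChartAt (𝓡 m) c x with hyx
    have hxy : (extChartAt (𝓡 m) c).symm y = x := (extChartAt (𝓡 m) c).left_inv hx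
    let s : (TangentSpace (𝓡 m) x →L[ℝ] ℝ) →ₗ[ℝ] TangentSpace (𝓡 m) x :=
      D.symm.toLinearMap ∘ₗ (matrixSymbol (a y)).toLinearMap ∘ₗ
        (ContinuousLinearMap.precomp ℝ (D.symm : EuclideanSpace ℝ (Fin m) →L[ℝ] TangentSpace (𝓡 m) x)).toLinearMap
    have hsv : ∀ β, s β = D.symm (matrixSymbol (a y) (β.comp
      (D.symm : EuclideanSpace ℝ (Fin m) →L[ℝ] TangentSpace (𝓡 m) x))) := fun β => rfl
    have hdf : ∀ f : C^∞⟮𝓡 m, M; ℝ⟯, ∀ v, differentialAt f x (D.symm v) =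
        fderiv ℝ (f ∘ (extChartAt (𝓡 m) c).symm) y v := by
      intro f v
      have hDv : chartDeriv m c x (D.symm v) = v := by
        rw [← hD]; exact D.apply_symm_apply v
      rw [← fderiv_comp_extChartAt_symm_comp_chartDeriv f.contMDiff hx, hDv]
    have hs : IsSymbolAt L x s := by
      intro f g
      have hg : (differentialAt g x).comp (D.symm : EuclideanSpace ℝ (Fin m) →L[ℝ] TangentSpace (𝓡 m) x) =
          fderiv ℝ (g ∘ (extChartAt (𝓡 m) c).symm) y := by
        ext1 v; exact hdf g v
      rw [hsv, hdf, hg]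
      have := carreDuChamp_eq_apply_matrixSymbol hy (hpos y hy) (fun f => hloc f y hy) f g
      rw [hxy] at this
      exact this.symm
    rw [(isSymbolAt_symbol hL x).unique hs, hsv, ← hD]
    simp only [ContinuousLinearEquiv.coe_coe, ContinuousLinearEquiv.apply_symm_apply]
    congr 1
    ext v
    simp

/-- An operator over `A` has a symbol over the symbol of `A`: `Tp ∘ σᴮ ∘ (Tp)^* = σᴬ`. -/
theorem IsOver.mfderiv_symbol [IsManifold (𝓡 m) ∞ M] [T2Space M] [IsManifold (𝓡 n) ∞ N]
    {p : C^∞⟮𝓡 n, N; 𝓡 m, M⟯} {B : C^∞⟮𝓡 n, N; ℝ⟯ →ₗ[ℝ] C^∞⟮𝓡 n, N; ℝ⟯}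
    {A : C^∞⟮𝓡 m, M; ℝ⟯ →ₗ[ℝ] C^∞⟮𝓡 m, M; ℝ⟯} (h : IsOver p B A)
    (hA : IsDiffusionOperator A) (hB : IsDiffusionOperator B) (u : N)
    (β : TangentSpace (𝓡 m) (p u) →L[ℝ] ℝ) :
    mfderiv (𝓡 n) (𝓡 m) p u (symbol B u (β.comp (mfderiv (𝓡 n) (𝓡 m) p u))) =
      symbol A (p u) β := by
  let s : (TangentSpace (𝓡 m) (p u) →L[ℝ] ℝ) →ₗ[ℝ] TangentSpace (𝓡 m) (p u) :=
    (mfderiv (𝓡 n) (𝓡 m) p u).toLinearMap ∘ₗ symbol B u ∘ₗ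
      (ContinuousLinearMap.precomp ℝ (mfderiv (𝓡 n) (𝓡 m) p u)).toLinearMap
  have hd : ∀ f : C^∞⟮𝓡 m, M; ℝ⟯, (differentialAt f (p u)).comp (mfderiv (𝓡 n) (𝓡 m) p u) =
      differentialAt (f.comp p) u := fun f =>
    (mfderiv_comp u (f.contMDiff.mdifferentiable (by simp) _)
      (p.contMDiff.mdifferentiable (by simp) _)).symm
  have hs : IsSymbolAt A (p u) s := by
    intro f g
    have h1 := isSymbolAt_symbol hB u (f.comp p) (g.comp p)
    rw [← hd, ← hd] at h1
    refine h1.trans ?_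
    have h2 : (f.comp p) * (g.comp p) = (f * g).comp p := rfl
    simp only [carreDuChamp, h2, h f, h g, h (f * g)]
    rfl
  rw [(isSymbolAt_symbol hA (p u)).unique hs]
  rfl

end Symbols

/-! ### Horizontal fields in charts -/

section ConstantRank

/-- A smooth family of linear maps of constant rank has, locally, a smooth family of
right inverses on the ranges. -/
theorem exists_contDiffOn_rightInverse_range {X G F : Type*} [NormedAddCommGroup X]
    [NormedSpace ℝ X]
    [NormedAddCommGroup G] [NormedSpace ℝ G] [FiniteDimensional ℝ G]
    [NormedAddCommGroup F] [NormedSpace ℝ F] [FiniteDimensional ℝ F]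
    {S : X → G →L[ℝ] F} {U : Set X} (hU : IsOpen U) (hS : ContDiffOn ℝ ∞ S U) {z₀ : X}
    (hz₀ : z₀ ∈ U) {r : ℕ}
    (hr : ∀ z ∈ U, Module.finrank ℝ (LinearMap.range (S z).toLinearMap) = r) :
    ∃ V ⊆ U, IsOpen V ∧ z₀ ∈ V ∧ ∃ C : X → F →L[ℝ] G, ContDiffOn ℝ ∞ C V ∧
      ∀ z ∈ V, ∀ g, S z (C z (S z g)) = S z g := by
  -- on a complement `G₀` of the kernel, `S z₀` has a left inverse `Q`; for `z` near `z₀` the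
  -- operator `Q ∘ S z` of `G₀` is still invertible, and `S z` maps `G₀` onto the range of `S z`, as
  -- the rank is constant
  obtain ⟨G₀, hG₀⟩ := (LinearMap.ker (S z₀).toLinearMap).exists_isCompl
  let ι : G₀ →L[ℝ] G := G₀.subtypeL
  have hinj : LinearMap.ker ((S z₀).comp ι).toLinearMap = ⊥ := by
    rw [LinearMap.ker_eq_bot']
    intro g hg
    have h1 : (g : G) ∈ LinearMap.ker (S z₀).toLinearMap ⊓ G₀ := ⟨hg, g.2⟩
    rw [hG₀.inf_eq_bot] at h1
    exact Subtype.ext (by simpa using h1)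
  obtain ⟨Q', hQ'⟩ := LinearMap.exists_leftInverse_of_injective _ hinj
  let Q : F →L[ℝ] G₀ := LinearMap.toContinuousLinearMap Q'
  let A : X → G₀ →L[ℝ] G₀ := fun z => Q ∘L (S z ∘L ι)
  have hA : ContDiffOn ℝ ∞ A U := contDiffOn_const.clm_comp (hS.clm_comp contDiffOn_const)
  have hA₀ : A z₀ = 1 := by
    ext1 g
    exact congrArg (fun B : G₀ →ₗ[ℝ] G₀ => B g) hQ'
  have hfin : Module.finrank ℝ G₀ = r := by
    have h1 := Submodule.finrank_add_eq_of_isCompl hG₀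
    have h2 := LinearMap.finrank_range_add_finrank_ker (S z₀).toLinearMap
    rw [hr z₀ hz₀] at h2
    omega
  refine ⟨U ∩ A ⁻¹' {B | IsUnit B}, inter_subset_left,
    hA.continuousOn.isOpen_inter_preimage hU (Units.isOpen (R := G₀ →L[ℝ] G₀)),
    ⟨hz₀, by rw [mem_preimage, hA₀]; exact isUnit_one⟩,
    fun z => ι ∘L (Ring.inverse (A z) ∘L Q), ?_, ?_⟩
  · refine contDiffOn_const.clm_comp (ContDiffOn.clm_comp ?_ contDiffOn_const)
    intro z hz
    obtain ⟨B, hB⟩ := hz.2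
    have h1 : ContDiffAt ℝ ∞ (Ring.inverse : (G₀ →L[ℝ] G₀) → (G₀ →L[ℝ] G₀)) (A z) := by
      rw [← hB]; exact contDiffAt_ringInverse (R := G₀ →L[ℝ] G₀) ℝ B
    exact h1.comp_contDiffWithinAt z ((hA z hz.1).mono inter_subset_left)
  · intro z hz g
    have hinvA : ∀ g₀, Ring.inverse (A z) (A z g₀) = g₀ := fun g₀ =>
      congrArg (fun B : G₀ →L[ℝ] G₀ => B g₀) (Ring.inverse_mul_cancel (A z) hz.2)
    have hinj' : Function.Injective ((S z).comp ι).toLinearMap := fun g₁ g₂ h => by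
      rw [← hinvA g₁, ← hinvA g₂]
      exact congrArg (fun v => Ring.inverse (A z) (Q v)) h
    have hle : LinearMap.range ((S z).comp ι).toLinearMap ≤ LinearMap.range (S z).toLinearMap := by
      rintro _ ⟨g₀, rfl⟩; exact ⟨ι g₀, rfl⟩
    have heq := Submodule.eq_of_le_of_finrank_eq hle (by
      rw [LinearMap.finrank_range_of_inj hinj', hfin, hr z hz.1])
    obtain ⟨g₀, hg₀⟩ : S z g ∈ LinearMap.range ((S z).comp ι).toLinearMap := by
      rw [heq]; exact ⟨g, rfl⟩
    have hg₀' : S z (ι g₀) = S z g := hg₀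
    rw [← hg₀']
    exact congrArg (fun v => S z (ι v)) (hinvA g₀)

end ConstantRank

section HorizontalFields

theorem contDiff_precomp {E F : Type*} [NormedAddCommGroup E] [NormedSpace ℝ E]
    [NormedAddCommGroup F] [NormedSpace ℝ F] :
    ContDiff ℝ ∞ (fun A : E →L[ℝ] F =>
      (ContinuousLinearMap.precomp ℝ A : (F →L[ℝ] ℝ) →L[ℝ] E →L[ℝ] ℝ)) := by
  refine (IsLinearMap.with_bound ⟨fun A A' => ?_, fun c A => ?_⟩ 1 fun A => ?_).contDiff
  · ext; simp
  · ext; simp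
  · refine ContinuousLinearMap.opNorm_le_bound _ (by positivity) fun β => ?_
    rw [one_mul, mul_comm]
    exact β.opNorm_comp_le A

variable {m n : ℕ} {M N : Type*}
  [TopologicalSpace M] [ChartedSpace (EuclideanSpace ℝ (Fin m)) M] [IsManifold (𝓡 m) ∞ M]
  [T2Space M]
  [TopologicalSpace N] [ChartedSpace (EuclideanSpace ℝ (Fin n)) N] [IsManifold (𝓡 n) ∞ N]
  [T2Space N]

/-- A positive semi-definite operator vanishes on the null vectors of its quadratic form. -/
theorem eq_zero_of_apply_self_eq_zero {n : ℕ}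
    {S : (EuclideanSpace ℝ (Fin n) →L[ℝ] ℝ) →L[ℝ] EuclideanSpace ℝ (Fin n)}
    (hsymm : ∀ β γ : EuclideanSpace ℝ (Fin n) →L[ℝ] ℝ, γ (S β) = β (S γ))
    (hpos : ∀ β : EuclideanSpace ℝ (Fin n) →L[ℝ] ℝ, 0 ≤ β (S β))
    {β : EuclideanSpace ℝ (Fin n) →L[ℝ] ℝ} (h : β (S β) = 0) : S β = 0 := by
  have key : ∀ γ : EuclideanSpace ℝ (Fin n) →L[ℝ] ℝ, γ (S β) = 0 := by
    intro γ
    have h1 : ∀ t : ℝ, 0 ≤ 2 * t * γ (S β) + γ (S γ) := by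
      intro t
      have h2 := hpos (t • β + γ)
      simp only [map_add, map_smul, add_apply, smul_apply, smul_eq_mul, h] at h2
      rw [← hsymm β γ] at h2
      linarith
    -- a nonconstant affine function of `t` is not bounded below
    by_contra hne
    have h2 := h1 (-(γ (S γ) + 1) / (2 * γ (S β)))
    have h3 : 2 * (-(γ (S γ) + 1) / (2 * γ (S β))) * γ (S β) = -(γ (S γ) + 1) := by
      field_simp
    linarith
  ext i
  exact key (EuclideanSpace.proj i)

variable {p : C^∞⟮𝓡 n, N; 𝓡 m, M⟯} {B : C^∞⟮𝓡 n, N; ℝ⟯ →ₗ[ℝ] C^∞⟮𝓡 n, N; ℝ⟯}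
    {A : C^∞⟮𝓡 m, M; ℝ⟯ →ₗ[ℝ] C^∞⟮𝓡 m, M; ℝ⟯}

omit [T2Space M] in
/-- If the symbol of `A` has constant rank, then so has a family of linear maps which represents its
image in a chart. -/
theorem finrank_range_of_map_symbolImage {k : ℕ}
    (hk : ∀ x, Module.finrank ℝ (symbolImage A x) = k) {c' : M}
    {G : Type*} [NormedAddCommGroup G] [NormedSpace ℝ G]
    {Y : EuclideanSpace ℝ (Fin m) → G →L[ℝ] EuclideanSpace ℝ (Fin m)}
    (hY : ∀ x ∈ (extChartAt (𝓡 m) c').source,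
      LinearMap.range (Y (extChartAt (𝓡 m) c' x)).toLinearMap =
        (symbolImage A x).map (chartDeriv m c' x).toLinearMap) :
    ∀ y ∈ (extChartAt (𝓡 m) c').target,
      Module.finrank ℝ (LinearMap.range (Y y).toLinearMap) = k := by
  intro y hy
  have hx := (extChartAt (𝓡 m) c').map_target hy
  have h1 := hY _ hx
  obtain ⟨D, hD⟩ := isInvertible_chartDeriv hx
  rw [(extChartAt (𝓡 m) c').right_inv hy, ← hD] at h1
  rw [h1, ← hk ((extChartAt (𝓡 m) c').symm y)]
  exact LinearEquiv.finrank_map_eq D.toLinearEquiv _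

/-- In charts, the image of `σᴬ` and the horizontal spaces are the images of smooth families `YM`
and `YN` of linear maps, defined on the same space of covectors and intertwined by the differential
of `p`; by positivity, the kernel of `YM` is in the kernel of `YN`. -/
theorem IsOver.exists_horizontal_fields (h : IsOver p B A)
    (hA : IsDiffusionOperator A) (hB : IsDiffusionOperator B) (c : N) (c' : M) :
    ∃ (YM : EuclideanSpace ℝ (Fin m) →
        (EuclideanSpace ℝ (Fin m) →L[ℝ] ℝ) →L[ℝ] EuclideanSpace ℝ (Fin m))
      (YN : EuclideanSpace ℝ (Fin n) →
        (EuclideanSpace ℝ (Fin m) →L[ℝ] ℝ) →L[ℝ] EuclideanSpace ℝ (Fin n)),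
      ContDiffOn ℝ ∞ YM (extChartAt (𝓡 m) c').target ∧
      ContDiffOn ℝ ∞ YN (chartRepDomain m n p c c') ∧
      (∀ y ∈ chartRepDomain m n p c c', ∀ β,
        fderiv ℝ (chartRep m n p c c') y (YN y β) = YM (chartRep m n p c c' y) β) ∧
      (∀ y ∈ chartRepDomain m n p c c', ∀ β, YM (chartRep m n p c c' y) β = 0 → YN y β = 0) ∧
      (∀ x ∈ (extChartAt (𝓡 m) c').source,
        LinearMap.range (YM (extChartAt (𝓡 m) c' x)).toLinearMap =
          (symbolImage A x).map (chartDeriv m c' x).toLinearMap) ∧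
      ∀ u ∈ (extChartAt (𝓡 n) c).source, p u ∈ (extChartAt (𝓡 m) c').source →
        LinearMap.range (YN (extChartAt (𝓡 n) c u)).toLinearMap =
          (horizontalSpace p B u).map (chartDeriv n c u).toLinearMap := by
  obtain ⟨SA, hSA, -, -, hSAx⟩ := hA.exists_symbol_chart c'
  obtain ⟨SB, hSB, hsymm, hpos, hSBx⟩ := hB.exists_symbol_chart c
  have hO := isOpen_chartRepDomain (m := m) (n := n) p.contMDiff.continuous c c'
  have hP := contDiffOn_chartRep p.contMDiff c c'
  have hP' : ContDiffOn ℝ ∞ (fderiv ℝ (chartRep m n p c c')) (chartRepDomain m n p c c') :=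
    hP.fderiv_of_isOpen hO (by simp)
  -- `YN β = σᴮ (β ∘ Tp)`, and `YM` is the symbol of `A`
  let YN : EuclideanSpace ℝ (Fin n) →
        (EuclideanSpace ℝ (Fin m) →L[ℝ] ℝ) →L[ℝ] EuclideanSpace ℝ (Fin n) := fun y =>
    SB y ∘L ContinuousLinearMap.precomp ℝ (fderiv ℝ (chartRep m n p c c') y)
  have hYN : ∀ y β, YN y β = SB y (β.comp (fderiv ℝ (chartRep m n p c c') y)) := fun _ _ => rfl
  have hβ : ∀ u ∈ (extChartAt (𝓡 n) c).source, p u ∈ (extChartAt (𝓡 m) c').source →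
      ∀ β : EuclideanSpace ℝ (Fin m) →L[ℝ] ℝ,
      YN (extChartAt (𝓡 n) c u) β = chartDeriv n c u (symbol B u
        ((β.comp (chartDeriv m c' (p u))).comp (mfderiv (𝓡 n) (𝓡 m) p u))) := by
    intro u hu hpu β
    rw [hYN, ← hSBx u hu]
    congr 2
    ext v
    exact congrArg β (fderiv_chartRep_comp_chartDeriv p.contMDiff hu hpu v)
  have hrel : ∀ y ∈ chartRepDomain m n p c c', ∀ β,
      fderiv ℝ (chartRep m n p c c') y (YN y β) = SA (chartRep m n p c c' y) β := by
    intro y hy β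
    obtain ⟨u, hu, rfl⟩ : ∃ u ∈ (extChartAt (𝓡 n) c).source, extChartAt (𝓡 n) c u = y :=
      ⟨_, (extChartAt (𝓡 n) c).map_target hy.1, (extChartAt (𝓡 n) c).right_inv hy.1⟩
    have hpu : p u ∈ (extChartAt (𝓡 m) c').source := by
      have := hy.2
      rwa [mem_preimage, (extChartAt (𝓡 n) c).left_inv hu] at this
    rw [hβ u hu hpu, fderiv_chartRep_comp_chartDeriv p.contMDiff hu hpu,
      h.mfderiv_symbol hA hB, hSAx _ hpu, chartRep_extChartAt _ hu]
  refine ⟨SA, YN, hSA, ?_, hrel, fun y hy β h0 => ?_, fun x hx => ?_, fun u hu hpu => ?_⟩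
  · refine (hSB.mono inter_subset_left).clm_comp ?_
    exact contDiff_precomp.comp_contDiffOn hP'
  · -- if `YM β = 0`, then `β ∘ Tp` is a null vector of the quadratic form of `σᴮ`
    rw [hYN]
    refine eq_zero_of_apply_self_eq_zero (hsymm y hy.1) (hpos y hy.1) ?_
    have := hrel y hy β
    rw [h0, hYN] at this
    rw [ContinuousLinearMap.comp_apply, this, map_zero]
  · obtain ⟨D, hD⟩ := isInvertible_chartDeriv hx
    ext v
    constructor
    · rintro ⟨β, rfl⟩
      exact ⟨symbol A x (β.comp (chartDeriv m c' x)), ⟨_, rfl⟩, hSAx x hx β⟩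
    · rintro ⟨_, ⟨α, rfl⟩, rfl⟩
      refine ⟨α.comp (D.symm : EuclideanSpace ℝ (Fin m) →L[ℝ] TangentSpace (𝓡 m) x), ?_⟩
      have h1 : (α.comp (D.symm : EuclideanSpace ℝ (Fin m) →L[ℝ] TangentSpace (𝓡 m) x)).comp
          (chartDeriv m c' x) = α := by
        rw [← hD]; ext w; simp
      change SA _ _ = _
      rw [← hSAx x hx, h1]
      rfl
  · obtain ⟨D, hD⟩ := isInvertible_chartDeriv hpu
    ext v
    constructor
    · rintro ⟨β, rfl⟩
      exact ⟨_, ⟨β.comp (chartDeriv m c' (p u)), rfl⟩, (hβ u hu hpu β).symm⟩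
    · rintro ⟨_, ⟨α, rfl⟩, rfl⟩
      refine ⟨α.comp (D.symm : EuclideanSpace ℝ (Fin m) →L[ℝ] TangentSpace (𝓡 m) (p u)), ?_⟩
      have h1 : (α.comp (D.symm : EuclideanSpace ℝ (Fin m) →L[ℝ] TangentSpace (𝓡 m) (p u))).comp
          (chartDeriv m c' (p u)) = α := by
        rw [← hD]; ext w; simp
      change YN _ _ = _
      rw [hβ u hu hpu, h1]
      rfl

end HorizontalFields

/-! ### Local holonomy -/

section CoupledFlow

variable {E F G : Type u} [NormedAddCommGroup E] [NormedSpace ℝ E] [FiniteDimensional ℝ E]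
  [NormedAddCommGroup F] [NormedSpace ℝ F] [FiniteDimensional ℝ F]
  [NormedAddCommGroup G] [NormedSpace ℝ G]
  {YN : E → G →L[ℝ] E} {YM : F → G →L[ℝ] F} {ΩN : Set E} {ΩM : Set F} {P : E → F}

omit [FiniteDimensional ℝ E] [FiniteDimensional ℝ F] in
/-- A map which intertwines two controlled equations maps solutions to solutions. -/
theorem IsControlSol.map {α : ℝ → G} {I : Set ℝ} {y : ℝ → E} (h : IsControlSol YN α I y)
    (hΩN : IsOpen ΩN) (hP : ContDiffOn ℝ ∞ P ΩN)
    (hrel : ∀ y ∈ ΩN, ∀ β, fderiv ℝ P y (YN y β) = YM (P y) β) (hy : ∀ t ∈ I, y t ∈ ΩN)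
    (hL : ∃ K, LipschitzOnWith K P ΩN) : IsControlSol YM α I (fun t => P (y t)) := by
  obtain ⟨L, hL⟩ := hL
  obtain ⟨⟨K, hK⟩, hd⟩ := h
  refine ⟨⟨L * K, hL.comp hK hy⟩, ?_⟩
  filter_upwards [hd] with t ht htI
  rw [← hrel _ (hy t htI)]
  exact (((hP.contDiffAt (hΩN.mem_nhds (hy t htI))).differentiableAt
    (by simp)).hasFDerivAt).comp_hasDerivAt t (ht htI)

/-- Solutions of two controlled equations which are intertwined by `P` define local
diffeomorphisms which are intertwined by `P`. -/
theorem exists_coupled_controlFlow (hΩN : IsOpen ΩN) (hΩM : IsOpen ΩM)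
    (hYN : ContDiffOn ℝ ∞ YN ΩN) (hYM : ContDiffOn ℝ ∞ YM ΩM) (hP : ContDiffOn ℝ ∞ P ΩN)
    (hPΩ : MapsTo P ΩN ΩM) (hrel : ∀ y ∈ ΩN, ∀ β, fderiv ℝ P y (YN y β) = YM (P y) β)
    {y₀ : E} (hy₀ : y₀ ∈ ΩN) (K : ℝ) :
    ∃ δ > 0, ∀ (t₀ : ℝ) (α : ℝ → G), AEStronglyMeasurable α volume → (∀ t, ‖α t‖ ≤ K) →
      ∀ t ∈ Icc (t₀ - δ) (t₀ + δ), ∃ (e : OpenPartialHomeomorph E E)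
        (e' : OpenPartialHomeomorph F F), y₀ ∈ e.source ∧ e.source ⊆ ΩN ∧ e.target ⊆ ΩN ∧
        e'.source ⊆ ΩM ∧ e'.target ⊆ ΩM ∧
        ContDiffOn ℝ ∞ e e.source ∧ ContDiffOn ℝ ∞ e.symm e.target ∧
        ContDiffOn ℝ ∞ e' e'.source ∧ ContDiffOn ℝ ∞ e'.symm e'.target ∧
        MapsTo P e.source e'.source ∧ (∀ u ∈ e.source, P (e u) = e' (P u)) ∧
        ∀ u ∈ e.source, ∃ γ : ℝ → E, IsControlSol YN α (Icc (t₀ - δ) (t₀ + δ)) γ ∧ γ t₀ = u ∧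
          γ t = e u ∧ ∀ r, γ r ∈ ΩN := by
  -- on `Ω` the map `P` is Lipschitz, so that it maps solutions to solutions
  obtain ⟨L, S, hS, hL⟩ := ((hP.contDiffAt (hΩN.mem_nhds hy₀)).of_le
    (by exact_mod_cast le_top : (1 : WithTop ℕ∞) ≤ ∞)).exists_lipschitzOnWith
  obtain ⟨Ω, hΩS, hΩ, hy₀Ω⟩ := mem_nhds_iff.1 (inter_mem hS (hΩN.mem_nhds hy₀))
  have hΩΩN : Ω ⊆ ΩN := hΩS.trans inter_subset_right
  have hLΩ : LipschitzOnWith L P Ω := hL.mono (hΩS.trans inter_subset_left)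
  obtain ⟨U, hU, hyU, δ₁, hδ₁, hflow⟩ := exists_controlFlow hΩ (hYN.mono hΩΩN) hy₀Ω K
  obtain ⟨V, hV, hyV, δ₂, hδ₂, hflow'⟩ := exists_controlFlow hΩM hYM (hPΩ hy₀) K
  refine ⟨min δ₁ δ₂, lt_min hδ₁ hδ₂, fun t₀ α hα hK t ht => ?_⟩
  obtain ⟨Γ, hΓ, hΓt⟩ := hflow t₀ α hα hK
  obtain ⟨Ψ, hΨ, hΨt⟩ := hflow' t₀ α hα hK
  have hI₁ : Icc (t₀ - min δ₁ δ₂) (t₀ + min δ₁ δ₂) ⊆ Icc (t₀ - δ₁) (t₀ + δ₁) :=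
    Icc_subset_Icc (by linarith [min_le_left δ₁ δ₂]) (by linarith [min_le_left δ₁ δ₂])
  have hI₂ : Icc (t₀ - min δ₁ δ₂) (t₀ + min δ₁ δ₂) ⊆ Icc (t₀ - δ₂) (t₀ + δ₂) :=
    Icc_subset_Icc (by linarith [min_le_right δ₁ δ₂]) (by linarith [min_le_right δ₁ δ₂])
  have ht₀ : t₀ ∈ Icc (t₀ - min δ₁ δ₂) (t₀ + min δ₁ δ₂) :=
    ⟨by linarith [lt_min hδ₁ hδ₂], by linarith [lt_min hδ₁ hδ₂]⟩
  have hUΩ : U ⊆ Ω := fun u hu => by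
    rw [← (hΓ u hu).1]; exact (hΓ u hu).2.2 t₀
  have hVΩ : V ⊆ ΩM := fun u hu => by
    rw [← (hΨ u hu).1]; exact (hΨ u hu).2.2 t₀
  -- by uniqueness, `P` maps the flow upstairs to the flow downstairs
  have hPΓ : ∀ u ∈ U, P u ∈ V → P (Γ u t) = Ψ (P u) t := by
    intro u hu hPu
    have h1 := ((hΓ u hu).2.1.mono hI₁).map hΩ (hP.mono hΩΩN)
      (fun y hy => hrel y (hΩΩN hy)) (fun r _ => (hΓ u hu).2.2 r) ⟨L, hLΩ⟩
    have h2 := (hΨ (P u) hPu).2.1.mono hI₂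
    refine (isPreconnected_Icc.eqOn_of_eventually_eq h1.continuousOn h2.continuousOn
      (fun r hr heq => h1.eventually_eq hΩM hYM h2 (fun r _ => hK r) hr heq
        (hPΩ (hΩΩN ((hΓ u hu).2.2 r)))) ht₀ ?_) ht
    rw [(hΓ u hu).1, (hΨ _ hPu).1]
  obtain ⟨e', he's, he'V, he', he'symm, -⟩ :=
    (hΨt t).1.exists_openPartialHomeomorph hV hyV ((hΨt t).2 _ hyV)
  have hPU : ContinuousOn P U := hLΩ.continuousOn.mono hUΩ
  have hU' : IsOpen (U ∩ P ⁻¹' e'.source) := hPU.isOpen_inter_preimage hU e'.open_source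
  obtain ⟨e, hes, heU, he, hesymm, -⟩ :=
    ((hΓt t).1.mono inter_subset_left).exists_openPartialHomeomorph hU' ⟨hyU, he's⟩
      ((hΓt t).2 _ hyU)
  have hPe : MapsTo P e.source e'.source := fun u hu => (heU hu).2
  refine ⟨e, e', hes, fun u hu => hΩΩN (hUΩ (heU hu).1), fun w hw => ?_,
    fun u hu => hVΩ (he'V hu), fun w hw => ?_, ?_, hesymm, ?_, he'symm, hPe, fun u hu => ?_,
    fun u hu => ⟨Γ u, (hΓ u (heU hu).1).2.1.mono hI₁, (hΓ u (heU hu).1).1, by rw [he],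
      fun r => hΩΩN ((hΓ u (heU hu).1).2.2 r)⟩⟩
  · have h1 := e.map_target hw
    rw [← e.right_inv hw, he]
    exact hΩΩN ((hΓ _ (heU h1).1).2.2 t)
  · have h1 := e'.map_target hw
    rw [← e'.right_inv hw, he']
    exact (hΨ _ (he'V h1)).2.2 t
  · rw [he]; exact (hΓt t).1.mono fun u hu => (heU hu).1
  · rw [he']; exact (hΨt t).1.mono he'V
  · rw [he, he']
    exact hPΓ u (heU hu).1 (he'V (hPe hu))

end CoupledFlow

section LocalHolonomy

variable {m n : ℕ} {M N : Type*}
  [TopologicalSpace M] [ChartedSpace (EuclideanSpace ℝ (Fin m)) M]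
  [TopologicalSpace N] [ChartedSpace (EuclideanSpace ℝ (Fin n)) N]

/-- `φ` is a local diffeomorphism of `N` which covers a local diffeomorphism of `M` and which maps
the point at time `s` of each horizontal lift of `σ` to its point at time `t`. -/
structure IsLocalHolonomy (m n : ℕ) {M N : Type*}
    [TopologicalSpace M] [ChartedSpace (EuclideanSpace ℝ (Fin m)) M]
    [TopologicalSpace N] [ChartedSpace (EuclideanSpace ℝ (Fin n)) N]
    (p : N → M) (H : ∀ u : N, Submodule ℝ (TangentSpace (𝓡 n) u)) (σ : ℝ → M) (T s t : ℝ)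
    (φ : OpenPartialHomeomorph N N) : Prop where
  isLocalDiffeoOn : IsLocalDiffeoOn n n φ
  covers : ∃ ψ : OpenPartialHomeomorph M M, IsLocalDiffeoOn m m ψ ∧
    MapsTo p φ.source ψ.source ∧ ∀ w ∈ φ.source, p (φ w) = ψ (p w)
  lift : ∀ τ, IsHorizontalLift p H σ τ T → (τ s ∈ φ.source ∨ τ t ∈ φ.target) →
    τ s ∈ φ.source ∧ φ (τ s) = τ t

variable {p : N → M} {H : ∀ u : N, Submodule ℝ (TangentSpace (𝓡 n) u)} {σ : ℝ → M} {T s t r : ℝ}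
  {φ φ' : OpenPartialHomeomorph N N}

theorem IsLocalHolonomy.symm (h : IsLocalHolonomy m n p H σ T s t φ) :
    IsLocalHolonomy m n p H σ T t s φ.symm := by
  obtain ⟨ψ, hψ, h1, h2⟩ := h.covers
  refine ⟨h.isLocalDiffeoOn.symm, ⟨ψ.symm, hψ.symm, fun w hw => ?_, fun w hw => ?_⟩,
    fun τ hτ hor => ?_⟩
  · have h3 := φ.map_target hw
    have h4 := h2 _ h3
    rw [φ.right_inv hw] at h4
    rw [h4]; exact ψ.map_source (h1 h3)
  · have h3 := φ.map_target hw
    have h4 := h2 _ h3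
    rw [φ.right_inv hw] at h4
    rw [h4, ψ.left_inv (h1 h3)]
  · obtain ⟨h3, h4⟩ := h.lift τ hτ (by simpa [or_comm] using hor)
    rw [← h4]
    exact ⟨φ.map_source h3, φ.left_inv h3⟩

theorem IsLocalHolonomy.trans (h : IsLocalHolonomy m n p H σ T s t φ)
    (h' : IsLocalHolonomy m n p H σ T t r φ') :
    IsLocalHolonomy m n p H σ T s r (φ.trans φ') := by
  obtain ⟨ψ, hψ, h1, h2⟩ := h.covers
  obtain ⟨ψ', hψ', h1', h2'⟩ := h'.covers
  refine ⟨h.isLocalDiffeoOn.trans h'.isLocalDiffeoOn,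
    ⟨ψ.trans ψ', hψ.trans hψ', fun w hw => ?_, fun w hw => ?_⟩, fun τ hτ hor => ?_⟩
  · rw [φ.trans_source] at hw
    rw [ψ.trans_source]
    refine ⟨h1 hw.1, ?_⟩
    rw [mem_preimage, ← h2 w hw.1]
    exact h1' hw.2
  · rw [φ.trans_source] at hw
    rw [OpenPartialHomeomorph.coe_trans, OpenPartialHomeomorph.coe_trans, Function.comp_apply,
      Function.comp_apply, h2' _ hw.2, h2 w hw.1]
  · rw [φ.trans_source, φ.trans_target] at *
    have key : τ s ∈ φ.source ∧ φ (τ s) = τ t ∧ τ t ∈ φ'.source ∧ φ' (τ t) = τ r := by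
      rcases hor with hs | hr
      · obtain ⟨h3, h4⟩ := h.lift τ hτ (Or.inl hs.1)
        have h5 : τ t ∈ φ'.source := by rw [← h4]; exact hs.2
        exact ⟨h3, h4, h'.lift τ hτ (Or.inl h5)⟩
      · obtain ⟨h3, h4⟩ := h'.lift τ hτ (Or.inr hr.1)
        have h5 : τ t ∈ φ.target := by
          rw [← φ'.left_inv h3, h4]; exact hr.2
        obtain ⟨h6, h7⟩ := h.lift τ hτ (Or.inr h5)
        exact ⟨h6, h7, h3, h4⟩
    obtain ⟨h3, h4, h5, h6⟩ := key
    refine ⟨⟨h3, ?_⟩, ?_⟩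
    · rw [mem_preimage, h4]; exact h5
    · rw [OpenPartialHomeomorph.coe_trans, Function.comp_apply, h4, h6]

end LocalHolonomy

section ExistsHolonomy

variable {m n : ℕ} {M N : Type*}
  [TopologicalSpace M] [ChartedSpace (EuclideanSpace ℝ (Fin m)) M] [IsManifold (𝓡 m) ∞ M]
  [T2Space M]
  [TopologicalSpace N] [ChartedSpace (EuclideanSpace ℝ (Fin n)) N] [IsManifold (𝓡 n) ∞ N]
  [T2Space N]

/-- A small interval around a point of `[0, T]`, relatively to `[0, T]`. -/
theorem exists_Icc_subset_of_mem_nhdsWithin {a b t₀ δ : ℝ} (ht₀ : t₀ ∈ Icc a b) {S : Set ℝ}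
    (hS : S ∈ 𝓝[Icc a b] t₀) (hδ : 0 < δ) :
    ∃ a' b', t₀ ∈ Icc a' b' ∧ Icc a' b' ⊆ S ∧ Icc a' b' ⊆ Icc a b ∧
      Icc a' b' ⊆ Icc (t₀ - δ) (t₀ + δ) ∧ Icc a' b' ∈ 𝓝[Icc a b] t₀ := by
  obtain ⟨ε, hε, hεS⟩ := Metric.mem_nhdsWithin_iff.1 hS
  obtain ⟨ρ, hρ, hρε, hρδ⟩ : ∃ ρ > 0, ρ < ε ∧ ρ ≤ δ :=
    ⟨min (ε / 2) δ, by positivity, (min_le_left _ _).trans_lt (by linarith), min_le_right _ _⟩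
  have hsub : Icc (max a (t₀ - ρ)) (min b (t₀ + ρ)) ⊆ Icc a b :=
    Icc_subset_Icc (le_max_left _ _) (min_le_left _ _)
  refine ⟨max a (t₀ - ρ), min b (t₀ + ρ), ⟨max_le ht₀.1 (by linarith), le_min ht₀.2 (by linarith)⟩,
    fun t ht => hεS ⟨?_, hsub ht⟩, hsub, fun t ht => ?_, ?_⟩
  · rw [Metric.mem_ball, Real.dist_eq, abs_lt]
    have h1 := (le_max_right a (t₀ - ρ)).trans ht.1
    have h2 := ht.2.trans (min_le_right b (t₀ + ρ))
    constructor <;> linarith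
  · have h1 := (le_max_right a (t₀ - ρ)).trans ht.1
    have h2 := ht.2.trans (min_le_right b (t₀ + ρ))
    constructor <;> linarith
  · filter_upwards [self_mem_nhdsWithin, mem_nhdsWithin_of_mem_nhds
      (Icc_mem_nhds (show t₀ - ρ < t₀ by linarith) (show t₀ < t₀ + ρ by linarith))] with t ht ht'
    exact ⟨max_le ht.1 ht'.1, le_min ht.2 ht'.2⟩

theorem ae_ne_real (c : ℝ) : ∀ᵐ t : ℝ, t ≠ c := by
  simp [ae_iff, measure_singleton]

/-- A curve whose representation in a chart solves a controlled equation, and a solution of this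
equation in the chart, agree on an interval as soon as they agree at one point. -/
theorem eqOn_extChartAt_symm_of_isControlSol {G : Type*} [NormedAddCommGroup G] [NormedSpace ℝ G]
    {c : N} {Y : EuclideanSpace ℝ (Fin n) → G →L[ℝ] EuclideanSpace ℝ (Fin n)}
    {Ω : Set (EuclideanSpace ℝ (Fin n))} (hΩ : IsOpen Ω) (hY : ContDiffOn ℝ ∞ Y Ω)
    (hΩc : Ω ⊆ (extChartAt (𝓡 n) c).target) {α : ℝ → G} {K a b T : ℝ} (hα : ∀ t, ‖α t‖ ≤ K)
    (hab : Icc a b ⊆ Icc 0 T) {τ : ℝ → N} (hτ : IsLipschitzCurve n τ T)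
    (hτ' : ∀ᵐ t, t ∈ Ioo a b → τ t ∈ (extChartAt (𝓡 n) c).source →
      HasDerivAt (fun r => extChartAt (𝓡 n) c (τ r)) (Y (extChartAt (𝓡 n) c (τ t)) (α t)) t)
    {γ : ℝ → EuclideanSpace ℝ (Fin n)} (hγ : IsControlSol Y α (Icc a b) γ) (hγΩ : ∀ t, γ t ∈ Ω)
    {s : ℝ} (hs : s ∈ Icc a b) (heq : τ s = (extChartAt (𝓡 n) c).symm (γ s)) :
    EqOn τ (fun t => (extChartAt (𝓡 n) c).symm (γ t)) (Icc a b) := by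
  have hτc : ContinuousOn τ (Icc a b) := hτ.1.mono hab
  refine isPreconnected_Icc.eqOn_of_eventually_eq hτc
    ((continuousOn_extChartAt_symm c).comp hγ.continuousOn fun t _ => hΩc (hγΩ t))
    (fun r hr hreq => ?_) hs heq
  have hrc : τ r ∈ (extChartAt (𝓡 n) c).source := by
    rw [hreq]; exact (extChartAt (𝓡 n) c).map_target (hΩc (hγΩ r))
  obtain ⟨K', S, hS, hK'⟩ := exists_lipschitzOnWith_extChartAt (hτ.1 r (hab hr))
    (mem_extChartAt_source (I := 𝓡 n) (τ r)) hrc (hτ.2 r (hab hr))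
  have hev : S ∩ {t | τ t ∈ (extChartAt (𝓡 n) c).source} ∈ 𝓝[Icc a b] r :=
    inter_mem (nhdsWithin_mono r hab hS)
      ((hτc r hr).eventually ((isOpen_extChartAt_source c).mem_nhds hrc))
  obtain ⟨a', b', hr', hsub, hsub', -, hnhds⟩ :=
    exists_Icc_subset_of_mem_nhdsWithin hr hev one_pos
  have hsol : IsControlSol Y α (Icc a' b') fun t => extChartAt (𝓡 n) c (τ t) := by
    refine ⟨⟨K', hK'.mono fun t ht => (hsub ht).1⟩, ?_⟩
    filter_upwards [hτ', ae_ne_real a, ae_ne_real b] with t ht h1 h2 hmem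
    exact ht ⟨lt_of_le_of_ne (hsub' hmem).1 (Ne.symm h1), lt_of_le_of_ne (hsub' hmem).2 h2⟩
      (hsub hmem).2
  have heq' : γ r = extChartAt (𝓡 n) c (τ r) := by
    rw [hreq, (extChartAt (𝓡 n) c).right_inv (hΩc (hγΩ r))]
  have h1 := (hγ.mono hsub').eventually_eq hΩ hY hsol (fun t _ => hα t) hr' heq' (hγΩ r)
  have h2 : 𝓝[Icc a b] r ≤ 𝓝[Icc a' b'] r := by
    rw [nhdsWithin, nhdsWithin]
    exact le_inf inf_le_left (le_principal_iff.2 hnhds)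
  filter_upwards [h2 h1, hnhds] with t ht htmem
  rw [show γ t = _ from ht, (extChartAt (𝓡 n) c).left_inv (hsub htmem).2]

variable {p : C^∞⟮𝓡 n, N; 𝓡 m, M⟯} {B : C^∞⟮𝓡 n, N; ℝ⟯ →ₗ[ℝ] C^∞⟮𝓡 n, N; ℝ⟯}
    {A : C^∞⟮𝓡 m, M; ℝ⟯ →ₗ[ℝ] C^∞⟮𝓡 m, M; ℝ⟯}

/-- The local holonomy of a horizontal curve, for short times. In charts, the horizontal lifts are
the solutions of an equation `y' = YN(y) α` with a control `α` which only depends on the curve: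
`α = C(z) z'` for a local right inverse `C` of the symbol of `A`, where `z` is the curve in a
chart. -/
theorem IsHorizontalLift.eventually_isLocalHolonomy (hA : IsDiffusionOperator A)
    (hB : IsDiffusionOperator B) (hBA : IsOver p B A) {k : ℕ}
    (hk : ∀ x, Module.finrank ℝ (symbolImage A x) = k) {σ : ℝ → M} {T : ℝ}
    (hσ : IsLipschitzCurve m σ T) {τ : ℝ → N}
    (hτ : IsHorizontalLift p (horizontalSpace p B) σ τ T) {t₀ : ℝ} (ht₀ : t₀ ∈ Icc 0 T) :
    ∀ᶠ t in 𝓝[Icc 0 T] t₀, ∃ φ, IsLocalHolonomy m n p (horizontalSpace p B) σ T t₀ t φ ∧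
      τ t₀ ∈ φ.source := by
  obtain ⟨YM, YN, hYM, hYN, hrel, hker, hrangeM, hrangeN⟩ :=
    hBA.exists_horizontal_fields hA hB (τ t₀) (σ t₀)
  set c := τ t₀ with hc
  set c' := σ t₀ with hc'
  have hpc : p c = c' := hτ.2 t₀ ht₀
  set P := chartRep m n p c c' with hPdef
  set O := chartRepDomain m n p c c' with hOdef
  have hO : IsOpen O := isOpen_chartRepDomain p.contMDiff.continuous c c'
  have hOt : O ⊆ (extChartAt (𝓡 n) c).target := inter_subset_left
  have hP : ContDiffOn ℝ ∞ P O := contDiffOn_chartRep p.contMDiff c c'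
  have hPO : ∀ y ∈ O, p ((extChartAt (𝓡 n) c).symm y) ∈ (extChartAt (𝓡 m) c').source :=
    fun y hy => hy.2
  have hPt : MapsTo P O (extChartAt (𝓡 m) c').target := fun y hy =>
    (extChartAt (𝓡 m) c').map_source (hPO y hy)
  have hcs : c ∈ (extChartAt (𝓡 n) c).source := mem_extChartAt_source c
  have hcs' : c' ∈ (extChartAt (𝓡 m) c').source := mem_extChartAt_source c'
  have hy₀ : extChartAt (𝓡 n) c c ∈ O :=
    extChartAt_mem_chartRepDomain hcs (by rw [hpc]; exact hcs')
  let z : ℝ → EuclideanSpace ℝ (Fin m) := fun t => extChartAt (𝓡 m) c' (σ t)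
  have hz₀ : z t₀ ∈ (extChartAt (𝓡 m) c').target := (extChartAt (𝓡 m) c').map_source hcs'
  -- a local right inverse of the symbol
  have hfin := finrank_range_of_map_symbolImage hk hrangeM
  obtain ⟨V, hVt, hV, hz₀V, C, hC', hCinv⟩ := exists_contDiffOn_rightInverse_range
    (isOpen_extChartAt_target c') hYM hz₀ hfin
  have hC := hC'.continuousOn
  obtain ⟨Kz, S, hS, hKz⟩ := hσ.2 t₀ ht₀
  have hzc : ContinuousWithinAt z (Icc 0 T) t₀ :=
    (continuousAt_extChartAt' hcs').comp_continuousWithinAt (hσ.1 t₀ ht₀)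
  have hCb : ∀ᶠ y in 𝓝 (z t₀), ‖C y‖ < ‖C (z t₀)‖ + 1 :=
    (hC.continuousAt (hV.mem_nhds hz₀V)).norm.eventually_lt_const (by linarith)
  have hev : {t | t ∈ S ∧ σ t ∈ (extChartAt (𝓡 m) c').source ∧ z t ∈ V ∧
      ‖C (z t)‖ < ‖C (z t₀)‖ + 1} ∈ 𝓝[Icc 0 T] t₀ := by
    filter_upwards [hS, (hσ.1 t₀ ht₀).eventually ((isOpen_extChartAt_source c').mem_nhds hcs'),
      hzc.eventually (hV.mem_nhds hz₀V), hzc.eventually hCb] with t h1 h2 h3 h4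
    exact ⟨h1, h2, h3, h4⟩
  let K : ℝ := (‖C (z t₀)‖ + 1) * Kz
  obtain ⟨δ, hδ, hflow⟩ := exists_coupled_controlFlow hO (isOpen_extChartAt_target c') hYN hYM hP
    hPt hrel hy₀ K
  obtain ⟨a, b, ht₀ab, habS, hab, habδ, hnhds⟩ :=
    exists_Icc_subset_of_mem_nhdsWithin ht₀ hev hδ
  -- the control
  let α : ℝ → (EuclideanSpace ℝ (Fin m) →L[ℝ] ℝ) :=
    (Ioo a b).indicator fun t => C (z t) (deriv z t)
  have hIoo : Ioo a b ⊆ Icc a b := Ioo_subset_Icc_self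
  have hzcont : ContinuousOn z (Ioo a b) := fun t ht =>
    (hKz.continuousOn.mono fun r hr => (habS (hIoo hr)).1) t ht
  have hαm : AEStronglyMeasurable α volume := by
    rw [aestronglyMeasurable_indicator_iff measurableSet_Ioo]
    have h1 : AEStronglyMeasurable (fun t => C (z t)) (volume.restrict (Ioo a b)) :=
      (hC.comp hzcont fun t ht => (habS (hIoo ht)).2.2.1).aestronglyMeasurable measurableSet_Ioo
    exact isBoundedBilinearMap_apply.continuous.comp_aestronglyMeasurable
      (h1.prodMk (stronglyMeasurable_deriv z).aestronglyMeasurable)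
  have hαK : ∀ t, ‖α t‖ ≤ K := by
    intro t
    have hK0 : 0 ≤ K := by positivity
    by_cases ht : t ∈ Ioo a b
    · rw [show α t = C (z t) (deriv z t) from indicator_of_mem ht _]
      have h1 : ‖deriv z t‖ ≤ Kz := norm_deriv_le_of_lipschitzOn (Ioo_mem_nhds ht.1 ht.2)
        (hKz.mono fun r hr => (habS (hIoo hr)).1)
      exact ContinuousLinearMap.le_of_opNorm_le_of_le _ (habS (hIoo ht)).2.2.2.le h1
    · rw [show α t = 0 from indicator_of_notMem ht _, norm_zero]
      exact hK0
  -- the equation satisfied by the horizontal lifts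
  have heqn : ∀ τ', IsHorizontalLift p (horizontalSpace p B) σ τ' T →
      ∀ᵐ t, t ∈ Ioo a b → τ' t ∈ (extChartAt (𝓡 n) c).source →
        HasDerivAt (fun r => extChartAt (𝓡 n) c (τ' r))
          (YN (extChartAt (𝓡 n) c (τ' t)) (α t)) t := by
    intro τ' hτ'
    have hae := hτ'.1.2
    rw [ae_restrict_iff' measurableSet_Ioo] at hae
    filter_upwards [hae] with t ht htab htc
    have ht0T : t ∈ Ioo 0 T := by
      have h1 := hab ⟨le_refl a, ht₀ab.1.trans ht₀ab.2⟩
      have h2 := hab ⟨ht₀ab.1.trans ht₀ab.2, le_refl b⟩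
      exact ⟨h1.1.trans_lt htab.1, htab.2.trans_le h2.2⟩
    obtain ⟨hmd, hmem⟩ := ht ht0T
    have hpt : p (τ' t) = σ t := hτ'.2 t (Ioo_subset_Icc_self ht0T)
    have hps : p (τ' t) ∈ (extChartAt (𝓡 m) c').source := by
      rw [hpt]; exact (habS (hIoo htab)).2.1
    have hy := hasDerivAt_extChartAt_comp hmd htc
    obtain ⟨β, hβ⟩ : ∃ β, YN (extChartAt (𝓡 n) c (τ' t)) β =
        chartDeriv n c (τ' t) (mfderiv 𝓘(ℝ, ℝ) (𝓡 n) τ' t (1 : ℝ)) := by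
      have h1 : chartDeriv n c (τ' t) (mfderiv 𝓘(ℝ, ℝ) (𝓡 n) τ' t (1 : ℝ)) ∈
        (horizontalSpace p B (τ' t)).map (chartDeriv n c (τ' t)).toLinearMap := ⟨_, hmem, rfl⟩
      rw [← hrangeN _ htc hps] at h1
      exact h1
    rw [← hβ] at hy
    have hyO : extChartAt (𝓡 n) c (τ' t) ∈ O := extChartAt_mem_chartRepDomain htc hps
    have hPy : P (extChartAt (𝓡 n) c (τ' t)) = z t := by
      rw [hPdef, chartRep_extChartAt p htc, hpt]
    have hz' : HasDerivAt z (YM (z t) β) t := by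
      have h1 := (((hP.contDiffAt (hO.mem_nhds hyO)).differentiableAt
        (by simp)).hasFDerivAt).comp_hasDerivAt t hy
      rw [hrel _ hyO, hPy] at h1
      refine h1.congr_of_eventuallyEq ?_
      filter_upwards [Ioo_mem_nhds ht0T.1 ht0T.2, hmd.continuousAt.preimage_mem_nhds
        ((isOpen_extChartAt_source c).mem_nhds htc)] with r hr hrc
      rw [Function.comp_apply, hPdef, chartRep_extChartAt p hrc, hτ'.2 r (Ioo_subset_Icc_self hr)]
    have hα' : α t = C (z t) (YM (z t) β) := by
      rw [← hz'.deriv]; exact indicator_of_mem htab _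
    -- `β` and `α t` have the same image under `YM`, hence also under `YN`
    have h0 : YM (P (extChartAt (𝓡 n) c (τ' t))) (β - α t) = 0 := by
      rw [hPy, map_sub, hα', hCinv _ (habS (hIoo htab)).2.2.1, sub_self]
    have h1 := hker _ hyO _ h0
    rw [map_sub, sub_eq_zero] at h1
    rwa [h1] at hy
  filter_upwards [hnhds] with t ht
  obtain ⟨e, e', hes, heO, heO', heM, heM', he, hesymm, he', hesymm', hPe, hPee, hγ⟩ :=
    hflow t₀ α hαm hαK t (habδ ht)
  have htgt : e.target ⊆ (extChartAt (𝓡 n) c).target := heO'.trans hOt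
  have hφs := fun x => mem_chartConj_source (c := c) (x := x) htgt
  -- a lift which agrees with a solution at time `t₀` or `t` agrees with it at both times
  have huniq : ∀ τ', IsHorizontalLift p (horizontalSpace p B) σ τ' T →
      ∀ w ∈ (chartConj c e).source, (τ' t₀ = w ∨ τ' t = chartConj c e w) →
        τ' t₀ = w ∧ τ' t = chartConj c e w := by
    intro τ' hτ' w hw hor
    obtain ⟨hw1, hw2⟩ := (hφs w).1 hw
    obtain ⟨γ, hγ1, hγ2, hγ3, hγ4⟩ := hγ _ hw2
    have e1 : (extChartAt (𝓡 n) c).symm (γ t₀) = w := by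
      rw [hγ2, (extChartAt (𝓡 n) c).left_inv hw1]
    have e2 : (extChartAt (𝓡 n) c).symm (γ t) = chartConj c e w := by
      rw [hγ3, chartConj_apply]
    have h1 : EqOn τ' (fun t => (extChartAt (𝓡 n) c).symm (γ t)) (Icc a b) := by
      rcases hor with h | h
      · exact eqOn_extChartAt_symm_of_isControlSol hO hYN hOt hαK hab hτ'.1.1 (heqn τ' hτ')
          (hγ1.mono habδ) hγ4 ht₀ab (h.trans e1.symm)
      · exact eqOn_extChartAt_symm_of_isControlSol hO hYN hOt hαK hab hτ'.1.1 (heqn τ' hτ')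
          (hγ1.mono habδ) hγ4 ht (h.trans e2.symm)
    exact ⟨(h1 ht₀ab).trans e1, (h1 ht).trans e2⟩
  refine ⟨chartConj c e, ⟨isLocalDiffeoOn_chartConj he hesymm, ⟨chartConj c' e',
    isLocalDiffeoOn_chartConj he' hesymm', fun w hw => ?_, fun w hw => ?_⟩, fun τ' hτ' hor => ?_⟩,
    (hφs c).2 ⟨hcs, hes⟩⟩
  · obtain ⟨hw1, hw2⟩ := (hφs w).1 hw
    have hps := hPO _ (heO hw2)
    rw [(extChartAt (𝓡 n) c).left_inv hw1] at hps
    refine (mem_chartConj_source heM').2 ⟨hps, ?_⟩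
    rw [← chartRep_extChartAt p hw1]
    exact hPe hw2
  · obtain ⟨hw1, hw2⟩ := (hφs w).1 hw
    rw [chartConj_apply, chartConj_apply, ← chartRep_extChartAt p hw1]
    change _ = (extChartAt (𝓡 m) c').symm (e' (P _))
    rw [← hPee _ hw2]
    exact ((extChartAt (𝓡 m) c').left_inv (hPO _ (heO' (e.map_source hw2)))).symm
  · rcases hor with h | h
    · exact ⟨h, ((huniq τ' hτ' _ h (Or.inl rfl)).2).symm⟩
    · have h1 := (chartConj c e).map_target h
      have h2 := huniq τ' hτ' _ h1 (Or.inr ((chartConj c e).right_inv h).symm)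
      rw [h2.1]
      exact ⟨h1, (chartConj c e).right_inv h⟩

/-- The local holonomy along a horizontal lift. -/
theorem IsHorizontalLift.exists_isLocalHolonomy (hA : IsDiffusionOperator A)
    (hB : IsDiffusionOperator B) (hBA : IsOver p B A) {k : ℕ}
    (hk : ∀ x, Module.finrank ℝ (symbolImage A x) = k) {σ : ℝ → M} {T : ℝ}
    (hσ : IsLipschitzCurve m σ T) {τ : ℝ → N}
    (hτ : IsHorizontalLift p (horizontalSpace p B) σ τ T) {s t : ℝ} (hs : s ∈ Icc 0 T)
    (ht : t ∈ Icc 0 T) :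
    ∃ φ, IsLocalHolonomy m n p (horizontalSpace p B) σ T s t φ ∧ τ s ∈ φ.source := by
  refine isPreconnected_Icc.induction₂' (fun s t => ∃ φ,
    IsLocalHolonomy m n p (horizontalSpace p B) σ T s t φ ∧ τ s ∈ φ.source) (fun x hx => ?_)
    (fun x y z _ _ _ ⟨φ, hφ, h1⟩ ⟨φ', hφ', h2⟩ => ?_) hs ht
  · filter_upwards [hτ.eventually_isLocalHolonomy hA hB hBA hk hσ hx] with t ⟨φ, hφ, h1⟩
    refine ⟨⟨φ, hφ, h1⟩, φ.symm, hφ.symm, ?_⟩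
    rw [← (hφ.lift τ hτ (Or.inl h1)).2]
    exact φ.map_source h1
  · refine ⟨φ.trans φ', hφ.trans hφ', ?_⟩
    rw [φ.trans_source]
    refine ⟨h1, ?_⟩
    rw [mem_preimage, (hφ.lift τ hτ (Or.inl h1)).2]
    exact h2

end ExistsHolonomy

/-! ### The holonomy between fibres -/

section Reverse

variable {m : ℕ} {M : Type*} [TopologicalSpace M] [ChartedSpace (EuclideanSpace ℝ (Fin m)) M]

theorem IsLipschitzCurve.reverse {σ : ℝ → M} {T : ℝ} (h : IsLipschitzCurve m σ T) :
    IsLipschitzCurve m (fun t => σ (T - t)) T := by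
  have hmaps : MapsTo (fun t => T - t) (Icc 0 T) (Icc 0 T) := fun t ht =>
    ⟨by linarith [ht.2], by linarith [ht.1]⟩
  refine ⟨h.1.comp (by fun_prop) hmaps, fun t ht => ?_⟩
  obtain ⟨K, s, hs, hK⟩ := h.2 (T - t) (hmaps ht)
  have hc : ContinuousWithinAt (fun t => T - t) (Icc 0 T) t := by fun_prop
  refine ⟨K * 1, (fun t => T - t) ⁻¹' s, hc.tendsto_nhdsWithin hmaps hs, ?_⟩
  refine hK.comp (f := fun t => T - t) (LipschitzOnWith.of_dist_le_mul fun x _ y _ => ?_)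
    fun r hr => hr
  rw [NNReal.coe_one, one_mul, Real.dist_eq, Real.dist_eq, ← abs_neg]
  exact (congrArg abs (by ring)).le

theorem IsHorizontalCurve.reverse {D : ∀ x : M, Submodule ℝ (TangentSpace (𝓡 m) x)} {σ : ℝ → M}
    {T : ℝ} (h : IsHorizontalCurve D σ T) : IsHorizontalCurve D (fun t => σ (T - t)) T := by
  refine ⟨h.1.reverse, ?_⟩
  have h1 := h.2
  rw [ae_restrict_iff' measurableSet_Ioo] at h1 ⊢
  have h2 := (Measure.measurePreserving_sub_left volume T).quasiMeasurePreserving.ae h1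
  filter_upwards [h2] with t ht hmem
  obtain ⟨hmd, hD⟩ := ht ⟨by linarith [hmem.2], by linarith [hmem.1]⟩
  have hd : HasMFDerivAt 𝓘(ℝ, ℝ) 𝓘(ℝ, ℝ) (fun t : ℝ => T - t) t
      (ContinuousLinearMap.toSpanSingleton ℝ (-1 : ℝ)) :=
    ((hasDerivAt_id t).const_sub T).hasFDerivAt.hasMFDerivAt
  have h3 := hmd.hasMFDerivAt.comp t hd
  refine ⟨h3.mdifferentiableAt, ?_⟩
  have h4 := h3.mfderiv
  have h5 : mfderiv 𝓘(ℝ, ℝ) (𝓡 m) (fun t => σ (T - t)) t (1 : ℝ) =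
      -(mfderiv 𝓘(ℝ, ℝ) (𝓡 m) σ (T - t) (1 : ℝ)) := by
    refine (congrArg (fun A : ℝ →L[ℝ] EuclideanSpace ℝ (Fin m) => A 1) h4).trans ?_
    change (mfderiv 𝓘(ℝ, ℝ) (𝓡 m) σ (T - t) : ℝ →L[ℝ] EuclideanSpace ℝ (Fin m))
      ((1 : ℝ) • (-1 : ℝ)) = _
    rw [one_smul]
    exact map_neg (mfderiv 𝓘(ℝ, ℝ) (𝓡 m) σ (T - t) : ℝ →L[ℝ] EuclideanSpace ℝ (Fin m)) 1
  rw [h5]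
  exact (D (σ (T - t))).neg_mem hD

variable {n : ℕ} {N : Type*} [TopologicalSpace N] [ChartedSpace (EuclideanSpace ℝ (Fin n)) N]

theorem IsHorizontalLift.reverse {M : Type*} {p : N → M}
    {H : ∀ u : N, Submodule ℝ (TangentSpace (𝓡 n) u)}
    {σ : ℝ → M} {τ : ℝ → N} {T : ℝ} (h : IsHorizontalLift p H σ τ T) :
    IsHorizontalLift p H (fun t => σ (T - t)) (fun t => τ (T - t)) T :=
  ⟨h.1.reverse, fun t ht => h.2 (T - t) ⟨by linarith [ht.2], by linarith [ht.1]⟩⟩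

end Reverse

section SubsetDiffeo

variable {n : ℕ} {N : Type v} [TopologicalSpace N] [ChartedSpace (EuclideanSpace ℝ (Fin n)) N]
  {S S' S'' : Set N}

/-- A bijection between subsets of `N` which near each point is the restriction of a local
diffeomorphism of `N`. -/
def IsLocallyDiffeo (n : ℕ) {N : Type v} [TopologicalSpace N]
    [ChartedSpace (EuclideanSpace ℝ (Fin n)) N] {S S' : Set N} (f : S ≃ S') : Prop :=
  ∀ u : S, ∃ φ : OpenPartialHomeomorph N N, IsLocalDiffeoOn n n φ ∧ (u : N) ∈ φ.source ∧
    (∀ w : S, (w : N) ∈ φ.source → (f w : N) = φ w) ∧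
    ∀ w : S', (w : N) ∈ φ.target → (f.symm w : N) = φ.symm w

theorem IsLocallyDiffeo.symm {f : S ≃ S'} (h : IsLocallyDiffeo n f) :
    IsLocallyDiffeo n f.symm := by
  intro u
  obtain ⟨φ, hφ, hu, h1, h2⟩ := h (f.symm u)
  refine ⟨φ.symm, hφ.symm, ?_, h2, by simpa using h1⟩
  have := φ.map_source hu
  rwa [← h1 _ hu, f.apply_symm_apply] at this

theorem IsLocallyDiffeo.isSmoothBetween {f : S ≃ S'} (h : IsLocallyDiffeo n f) :
    IsSmoothBetween n f := by
  intro u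
  obtain ⟨φ, hφ, hu, h1, -⟩ := h u
  exact ⟨φ.source, φ, φ.open_source, hu, hφ.contMDiffOn, fun w hw => (h1 w hw).symm⟩

theorem IsLocallyDiffeo.isDiffeoBetween {f : S ≃ S'} (h : IsLocallyDiffeo n f) :
    IsDiffeoBetween n f :=
  ⟨h.isSmoothBetween, h.symm.isSmoothBetween⟩

theorem IsSmoothBetween.continuous {f : S → S'} (h : IsSmoothBetween n f) : Continuous f := by
  rw [continuous_induced_rng, continuous_iff_continuousAt]
  intro u
  obtain ⟨U, g, hU, hu, hg, hgf⟩ := h u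
  have h1 : ContinuousAt g u := hg.continuousOn.continuousAt (hU.mem_nhds hu)
  have h2 : ContinuousAt (fun w : S => g w) u := ContinuousAt.comp h1 continuous_subtype_val.continuousAt
  refine h2.congr ?_
  filter_upwards [(hU.preimage continuous_subtype_val).mem_nhds hu] with w hw using hgf w hw

theorem IsSmoothBetween.comp {f : S → S'} {g : S' → S''} (hg : IsSmoothBetween n g)
    (hf : IsSmoothBetween n f) : IsSmoothBetween n (g ∘ f) := by
  intro u
  obtain ⟨U, f', hU, hu, hf', hff'⟩ := hf u
  obtain ⟨V, g', hV, hv, hg', hgg'⟩ := hg (f u)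
  refine ⟨U ∩ f' ⁻¹' V, g' ∘ f', hf'.continuousOn.isOpen_inter_preimage hU hV, ⟨hu, ?_⟩,
    hg'.comp (hf'.mono inter_subset_left) fun x hx => hx.2, fun w hw => ?_⟩
  · rw [mem_preimage, hff' u hu]; exact hv
  · have h1 := hff' w hw.1
    have h2 : (f w : N) ∈ V := by rw [← h1]; exact hw.2
    rw [Function.comp_apply, h1]
    exact hgg' (f w) h2

theorem isSmoothBetween_id : IsSmoothBetween n (id : S → S) := fun _ =>
  ⟨univ, id, isOpen_univ, mem_univ _, contMDiffOn_id, fun _ _ => rfl⟩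

theorem IsDiffeoBetween.refl : IsDiffeoBetween n (Equiv.refl S) :=
  ⟨isSmoothBetween_id, isSmoothBetween_id⟩

theorem IsDiffeoBetween.symm {f : S ≃ S'} (h : IsDiffeoBetween n f) : IsDiffeoBetween n f.symm :=
  ⟨h.2, h.1⟩

theorem IsDiffeoBetween.trans {f : S ≃ S'} {g : S' ≃ S''} (h : IsDiffeoBetween n f)
    (h' : IsDiffeoBetween n g) : IsDiffeoBetween n (f.trans g) :=
  ⟨h'.1.comp h.1, h.2.comp h'.2⟩

/-- A local diffeomorphism maps immersions to immersions: composition with it turns a slice chart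
into a slice chart. -/
theorem IsLocalDiffeoOn.comp_isImmersionAtOfComplement [IsManifold (𝓡 n) ∞ N] {k : ℕ} {P : Type*}
    [TopologicalSpace P] [ChartedSpace (EuclideanSpace ℝ (Fin k)) P] [IsManifold (𝓡 k) ∞ P]
    {F : Type*} [NormedAddCommGroup F] [NormedSpace ℝ F] {i : P → N} {q : P}
    (hi : Manifold.IsImmersionAtOfComplement F (𝓡 k) (𝓡 n) ∞ i q)
    {φ : OpenPartialHomeomorph N N} (hφ : IsLocalDiffeoOn n n φ) (hq : i q ∈ φ.source) :
    Manifold.IsImmersionAtOfComplement F (𝓡 k) (𝓡 n) ∞ (fun x => φ (i x)) q := by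
  have hci := hi.continuousAt
  -- shrink the chart of the domain so that the image is in the source of `φ`
  obtain ⟨W, hWsub, hW, hqW⟩ := mem_nhds_iff.1 (hci.preimage_mem_nhds (φ.open_source.mem_nhds hq))
  let d := hi.domChart.restr W
  have hd : d ∈ IsManifold.maximalAtlas (𝓡 k) ∞ P :=
    restr_mem_maximalAtlas _ hi.domChart_mem_maximalAtlas hW
  have hcod : IsLocalDiffeoOn n n hi.codChart :=
    ⟨contMDiffOn_of_mem_maximalAtlas hi.codChart_mem_maximalAtlas,
      contMDiffOn_symm_of_mem_maximalAtlas hi.codChart_mem_maximalAtlas⟩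
  have hcod' := hφ.symm.trans hcod
  refine Manifold.IsImmersionAtOfComplement.mk_of_continuousAt
    (ContinuousAt.comp (g := φ) (φ.continuousAt hq) hci) hi.equiv d (φ.symm.trans hi.codChart)
    ?_ ?_ hd (OpenPartialHomeomorph.mem_maximalAtlas_of_contMDiffOn _ hcod'.1 hcod'.2) ?_
  · rw [hi.domChart.restr_source, hW.interior_eq]
    exact ⟨hi.mem_domChart_source, hqW⟩
  · rw [OpenPartialHomeomorph.trans_source]
    refine ⟨φ.map_source hq, ?_⟩
    rw [mem_preimage, φ.left_inv hq]
    exact hi.mem_codChart_source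
  · intro y hy
    have hy1 : y ∈ hi.domChart.target ∩ hi.domChart.symm ⁻¹' W := by
      simpa [d, mfld_simps, hW.interior_eq] using hy
    have hy2 : y ∈ (hi.domChart.extend (𝓡 k)).target := by
      simpa [mfld_simps] using hy1.1
    rw [← hi.writtenInCharts hy2]
    have hs : i (hi.domChart.symm y) ∈ φ.source := hWsub hy1.2
    simp [d, mfld_simps, φ.left_inv hs]

/-- A bijection which locally extends to diffeomorphisms of the ambient manifold maps submanifolds
to submanifolds: compose the embedding with it. -/
theorem IsEmbeddedSubmanifold.of_isLocallyDiffeo [IsManifold (𝓡 n) ∞ N] {k : ℕ}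
    (h : IsEmbeddedSubmanifold n k S) {f : S ≃ S'} (hf : IsLocallyDiffeo n f) :
    IsEmbeddedSubmanifold n k S' := by
  obtain ⟨P, tP, cP, _, i, ⟨⟨F, nF, sF, himm⟩, hemb⟩, hrange⟩ := h
  have hmem : ∀ x, i x ∈ S := fun x => by rw [← hrange]; exact mem_range_self x
  let i' : P → S := fun x => ⟨i x, hmem x⟩
  have hi' : IsEmbedding i' := hemb.codRestrict S hmem
  let fh : S ≃ₜ S' := ⟨f, hf.isSmoothBetween.continuous, hf.symm.isSmoothBetween.continuous⟩
  refine ⟨P, tP, cP, inferInstance, fun x => (f (i' x) : N), ⟨⟨F, nF, sF, fun q => ?_⟩,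
    IsEmbedding.subtypeVal.comp (fh.isEmbedding.comp hi')⟩, ?_⟩
  · obtain ⟨φ, hφ, hq, h1, -⟩ := hf (i' q)
    refine (hφ.comp_isImmersionAtOfComplement (himm q) hq).congr_of_eventuallyEq ?_
    filter_upwards [hemb.continuous.continuousAt.preimage_mem_nhds
      (φ.open_source.mem_nhds (show i q ∈ φ.source from hq))] with x hx
    exact (h1 (i' x) hx).symm
  · ext w
    constructor
    · rintro ⟨x, rfl⟩
      exact (f (i' x)).2
    · intro hw
      obtain ⟨x, hx⟩ : ((f.symm ⟨w, hw⟩ : S) : N) ∈ range i := by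
        rw [hrange]; exact (f.symm ⟨w, hw⟩).2
      refine ⟨x, ?_⟩
      have : i' x = f.symm ⟨w, hw⟩ := Subtype.ext hx
      simp only [this, f.apply_symm_apply]

end SubsetDiffeo

theorem IsLocalDiffeoOn.surjective_mfderiv {n : ℕ} {N : Type*} [TopologicalSpace N]
    [ChartedSpace (EuclideanSpace ℝ (Fin n)) N] {φ : OpenPartialHomeomorph N N}
    (hφ : IsLocalDiffeoOn n n φ) {u : N} (hu : u ∈ φ.source) :
    Function.Surjective (mfderiv (𝓡 n) (𝓡 n) φ u) :=
  OpenPartialHomeomorph.MDifferentiable.mfderiv_surjective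
    ⟨hφ.1.mdifferentiableOn (by simp), hφ.2.mdifferentiableOn (by simp)⟩ hu

section Holonomy

variable {m n : ℕ} {M : Type u} {N : Type v}
  [TopologicalSpace M] [ChartedSpace (EuclideanSpace ℝ (Fin m)) M] [IsManifold (𝓡 m) ∞ M]
  [T2Space M]
  [TopologicalSpace N] [ChartedSpace (EuclideanSpace ℝ (Fin n)) N] [IsManifold (𝓡 n) ∞ N]
  [T2Space N] {p : C^∞⟮𝓡 n, N; 𝓡 m, M⟯} {B : C^∞⟮𝓡 n, N; ℝ⟯ →ₗ[ℝ] C^∞⟮𝓡 n, N; ℝ⟯}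
    {A : C^∞⟮𝓡 m, M; ℝ⟯ →ₗ[ℝ] C^∞⟮𝓡 m, M; ℝ⟯}

/-- The holonomy of a horizontal curve. By uniqueness, the end point of a horizontal lift depends
only on its starting point, and conversely; each point of the last fibre is an end point, as the
reversed curve can be lifted; and near each point the local holonomies represent the map. -/
theorem exists_holonomy (hA : IsDiffusionOperator A)
    (hB : IsDiffusionOperator B) (hBA : IsOver p B A) {k : ℕ}
    (hk : ∀ x, Module.finrank ℝ (symbolImage A x) = k)
    (hcomplete : IsCompleteSemiConnection p (symbolImage A) (horizontalSpace p B))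
    {σ : ℝ → M} {T : ℝ} (hT : 0 ≤ T) (hσ : IsHorizontalCurve (symbolImage A) σ T) :
    ∃ hol : (p ⁻¹' {σ 0} : Set N) ≃ (p ⁻¹' {σ T} : Set N),
      (∀ (u : (p ⁻¹' {σ 0} : Set N)) (τ : ℝ → N),
        IsHorizontalLift p (horizontalSpace p B) σ τ T → τ 0 = u → τ T = hol u) ∧
      IsLocallyDiffeo n hol := by
  have h0 : (0 : ℝ) ∈ Icc 0 T := ⟨le_refl 0, hT⟩
  have h1 : T ∈ Icc 0 T := ⟨hT, le_refl T⟩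
  have hφ : ∀ τ, IsHorizontalLift p (horizontalSpace p B) σ τ T → ∃ φ,
      IsLocalHolonomy m n p (horizontalSpace p B) σ T 0 T φ ∧ τ 0 ∈ φ.source := fun τ hτ =>
    hτ.exists_isLocalHolonomy hA hB hBA hk hσ.1 h0 h1
  choose! τ hτ hτ0 using fun u : (p ⁻¹' {σ 0} : Set N) => hcomplete T σ hT hσ u u.2
  have hend : ∀ τ', IsHorizontalLift p (horizontalSpace p B) σ τ' T → p (τ' T) = σ T :=
    fun τ' h => h.2 T h1
  let f : (p ⁻¹' {σ 0} : Set N) → (p ⁻¹' {σ T} : Set N) := fun u => ⟨τ u T, hend _ (hτ u)⟩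
  have hf : ∀ (u : (p ⁻¹' {σ 0} : Set N)) τ', IsHorizontalLift p (horizontalSpace p B) σ τ' T →
      τ' 0 = u → τ' T = f u := by
    intro u τ' hτ' hu
    obtain ⟨φ, hφ1, hφ2⟩ := hφ τ' hτ'
    have e1 := (hφ1.lift τ' hτ' (Or.inl hφ2)).2
    rw [hu, ← hτ0 u] at hφ2
    have e2 := (hφ1.lift _ (hτ u) (Or.inl hφ2)).2
    rw [← e1, hu, ← hτ0 u, e2]
  -- local holonomies also determine the starting point from the end point
  have hinj : Function.Injective f := by
    intro u u' huu'
    obtain ⟨φ, hφ1, hφ2⟩ := hφ _ (hτ u)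
    obtain ⟨-, e1⟩ := hφ1.lift _ (hτ u) (Or.inl hφ2)
    have e2 : τ u T = τ u' T := congrArg Subtype.val huu'
    have e3 : τ u' T ∈ φ.target := by rw [← e2, ← e1]; exact φ.map_source hφ2
    obtain ⟨e4, e5⟩ := hφ1.lift _ (hτ u') (Or.inr e3)
    have e6 := φ.injOn hφ2 e4 (by rw [e1, e5, e2])
    rw [hτ0, hτ0] at e6
    exact Subtype.ext e6
  -- lift the reversed curve from `w`, and reverse the lift
  have hsurj : Function.Surjective f := by
    intro w
    have hrev := hσ.reverse
    obtain ⟨ρ, hρ, hρ0⟩ := hcomplete T _ hT hrev w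
      ((show p w = σ T from w.2).trans (by rw [sub_zero]))
    have hρr := hρ.reverse
    simp only [sub_sub_cancel] at hρr
    have hpu : p (ρ (T - 0)) = σ 0 := hρr.2 0 h0
    refine ⟨⟨ρ (T - 0), hpu⟩, ?_⟩
    have := hf ⟨ρ (T - 0), hpu⟩ _ hρr rfl
    apply Subtype.ext
    rw [← this, sub_self, hρ0]
  let hol := Equiv.ofBijective f ⟨hinj, hsurj⟩
  refine ⟨hol, hf, fun u => ?_⟩
  obtain ⟨φ, hφ1, hφ2⟩ := hφ _ (hτ u)
  refine ⟨φ, hφ1.isLocalDiffeoOn, by rw [← hτ0 u]; exact hφ2, fun w hw => ?_, fun w hw => ?_⟩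
  · rw [← hτ0 w] at hw
    have e1 := (hφ1.lift _ (hτ w) (Or.inl hw)).2
    rw [hτ0 w] at e1
    exact e1.symm
  · obtain ⟨w', rfl⟩ := hol.surjective w
    rw [hol.symm_apply_apply]
    obtain ⟨e1, e2⟩ := hφ1.lift _ (hτ w') (Or.inr hw)
    change (w' : N) = φ.symm (τ w' T)
    rw [← e2, φ.left_inv e1, hτ0 w']

/-- Regularity of a value is invariant under holonomy. -/
theorem IsRegularValue.of_isHorizontalCurve (hA : IsDiffusionOperator A)
    (hB : IsDiffusionOperator B) (hBA : IsOver p B A) {k : ℕ}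
    (hk : ∀ x, Module.finrank ℝ (symbolImage A x) = k)
    (hcomplete : IsCompleteSemiConnection p (symbolImage A) (horizontalSpace p B))
    {σ : ℝ → M} {T : ℝ} (hT : 0 ≤ T) (hσ : IsHorizontalCurve (symbolImage A) σ T)
    (h : IsRegularValue m n p (σ T)) : IsRegularValue m n p (σ 0) := by
  intro u hu
  obtain ⟨τ, hτ, rfl⟩ := hcomplete T σ hT hσ u hu
  obtain ⟨φ, hφ, h0⟩ := hτ.exists_isLocalHolonomy hA hB hBA hk hσ.1
    (⟨le_refl 0, hT⟩ : (0 : ℝ) ∈ Icc 0 T) (⟨hT, le_refl T⟩ : T ∈ Icc 0 T)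
  obtain ⟨-, e1⟩ := hφ.lift τ hτ (Or.inl h0)
  obtain ⟨ψ, hψ, hps, hcov⟩ := hφ.covers
  have hreg := h (τ T) (hτ.2 T ⟨hT, le_refl T⟩)
  -- near `τ 0`, the map `p` is `ψ⁻¹ ∘ p ∘ φ`
  have hev : (p : N → M) =ᶠ[𝓝 (τ 0)] (ψ.symm ∘ (p ∘ φ)) := by
    filter_upwards [φ.open_source.mem_nhds h0] with w hw
    rw [Function.comp_apply, Function.comp_apply, hcov w hw, ψ.left_inv (hps hw)]
  have hψt : p (φ (τ 0)) ∈ ψ.target := by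
    rw [hcov _ h0]; exact ψ.map_source (hps h0)
  have d1 : MDifferentiableAt (𝓡 n) (𝓡 n) φ (τ 0) :=
    (hφ.isLocalDiffeoOn.1.contMDiffAt (φ.open_source.mem_nhds h0)).mdifferentiableAt (by simp)
  have d2 : MDifferentiableAt (𝓡 n) (𝓡 m) p (φ (τ 0)) :=
    p.contMDiff.mdifferentiable (by simp) _
  have d3 : MDifferentiableAt (𝓡 m) (𝓡 m) ψ.symm (p (φ (τ 0))) :=
    (hψ.2.contMDiffAt (ψ.open_target.mem_nhds hψt)).mdifferentiableAt (by simp)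
  have hd : mfderiv (𝓡 n) (𝓡 m) p (τ 0) = ((mfderiv (𝓡 m) (𝓡 m) ψ.symm (p (φ (τ 0)))).comp
      ((mfderiv (𝓡 n) (𝓡 m) p (φ (τ 0))).comp (mfderiv (𝓡 n) (𝓡 n) φ (τ 0))) :
      TangentSpace (𝓡 n) (τ 0) →L[ℝ] EuclideanSpace ℝ (Fin m)) := by
    refine hev.mfderiv_eq.trans ?_
    rw [mfderiv_comp (τ 0) (I' := 𝓡 m) (g := ψ.symm) (f := p ∘ φ) d3 (d2.comp (τ 0) d1),
      mfderiv_comp (τ 0) (I' := 𝓡 n) (g := p) (f := φ) d2 d1]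
    rfl
  have s1 := hφ.isLocalDiffeoOn.surjective_mfderiv h0
  have s3 : Function.Surjective (mfderiv (𝓡 m) (𝓡 m) ψ.symm (p (φ (τ 0)))) :=
    hψ.symm.surjective_mfderiv hψt
  rw [← e1] at hreg
  have hs := s3.comp (hreg.comp s1)
  rw [hd]
  exact hs

end Holonomy

/-! ### Vector fields in charts and the Lie algebra generated by a distribution -/

section ChartField

variable {m : ℕ} {M : Type*} [TopologicalSpace M] [ChartedSpace (EuclideanSpace ℝ (Fin m)) M]

/-- The vector field `V` in the chart centered at `c`. -/
noncomputable def chartField (c : M) (V : ∀ x : M, TangentSpace (𝓡 m) x)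
    (y : EuclideanSpace ℝ (Fin m)) : EuclideanSpace ℝ (Fin m) :=
  VectorField.mpullback 𝓘(ℝ, EuclideanSpace ℝ (Fin m)) (𝓡 m) (extChartAt (𝓡 m) c).symm V y

variable [IsManifold (𝓡 m) ∞ M]

theorem isInvertible_mfderiv_extChartAt_symm' {c : M} {y : EuclideanSpace ℝ (Fin m)}
    (hy : y ∈ (extChartAt (𝓡 m) c).target) :
    (mfderiv 𝓘(ℝ, EuclideanSpace ℝ (Fin m)) (𝓡 m) (extChartAt (𝓡 m) c).symm y).IsInvertible := by
  have : IsManifold (𝓡 m) 1 M := .of_le (n := ∞) (by exact_mod_cast le_top)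
  have := isInvertible_mfderivWithin_extChartAt_symm (I := 𝓡 m) hy
  rwa [modelWithCornersSelf_coe, range_id, mfderivWithin_univ] at this

theorem chartField_eq {c : M} {V : ∀ x : M, TangentSpace (𝓡 m) x} {y : EuclideanSpace ℝ (Fin m)}
    (hy : y ∈ (extChartAt (𝓡 m) c).target) :
    chartField c V y = chartDeriv m c ((extChartAt (𝓡 m) c).symm y)
      (V ((extChartAt (𝓡 m) c).symm y)) := by
  have : IsManifold (𝓡 m) 1 M := .of_le (n := ∞) (by exact_mod_cast le_top)
  obtain ⟨D, hD⟩ := isInvertible_mfderiv_extChartAt_symm' hy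
  have h2 := mfderiv_extChartAt_comp_mfderivWithin_extChartAt_symm (I := 𝓡 m) hy
  rw [modelWithCornersSelf_coe, range_id, mfderivWithin_univ, ← hD] at h2
  rw [chartField, VectorField.mpullback_apply, ← hD, ContinuousLinearMap.inverse_equiv]
  have h3 := congrArg (fun A : EuclideanSpace ℝ (Fin m) →L[ℝ] EuclideanSpace ℝ (Fin m) =>
    A (D.symm (V ((extChartAt (𝓡 m) c).symm y)))) h2
  refine h3.symm.trans ?_
  change mfderiv _ _ _ _ (D (D.symm _)) = _
  rw [D.apply_symm_apply]
  rfl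

theorem contDiffOn_chartField (c : M) {V : ∀ x : M, TangentSpace (𝓡 m) x}
    (hV : ContMDiff (𝓡 m) (𝓡 m).tangent ∞ (fun x => (⟨x, V x⟩ : TangentBundle (𝓡 m) M))) :
    ContDiffOn ℝ ∞ (chartField c V) (extChartAt (𝓡 m) c).target := by
  intro y hy
  have h1 : ContMDiffAt 𝓘(ℝ, EuclideanSpace ℝ (Fin m)) (𝓡 m) ∞ (extChartAt (𝓡 m) c).symm y :=
    (contMDiffOn_extChartAt_symm c).contMDiffAt ((isOpen_extChartAt_target c).mem_nhds hy)
  have h2 := ContMDiffAt.mpullback_vectorField_preimage (m := ∞) (hV _) h1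
    (isInvertible_mfderiv_extChartAt_symm' hy) (by simp)
  exact (contMDiffAt_vectorSpace_iff_contDiffAt.1 h2).contDiffWithinAt

theorem chartField_mlieBracket {c : M} {V W : ∀ x : M, TangentSpace (𝓡 m) x}
    (hV : ContMDiff (𝓡 m) (𝓡 m).tangent ∞ (fun x => (⟨x, V x⟩ : TangentBundle (𝓡 m) M)))
    (hW : ContMDiff (𝓡 m) (𝓡 m).tangent ∞ (fun x => (⟨x, W x⟩ : TangentBundle (𝓡 m) M)))
    {y : EuclideanSpace ℝ (Fin m)} (hy : y ∈ (extChartAt (𝓡 m) c).target) :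
    chartField c (VectorField.mlieBracket (𝓡 m) V W) y =
      VectorField.lieBracket ℝ (chartField c V) (chartField c W) y := by
  have : IsManifold (𝓡 m) (minSmoothness ℝ 3) M := .of_le (n := ∞) (by
    rw [minSmoothness_of_isRCLikeNormedField]; exact ENat.LEInfty.out)
  have h1 : ContMDiffAt 𝓘(ℝ, EuclideanSpace ℝ (Fin m)) (𝓡 m) ∞ (extChartAt (𝓡 m) c).symm y :=
    (contMDiffOn_extChartAt_symm c).contMDiffAt ((isOpen_extChartAt_target c).mem_nhds hy)
  have := VectorField.mpullback_mlieBracket (n := ∞) (hV.mdifferentiable (by simp) _)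
    (hW.mdifferentiable (by simp) _) h1
    (by rw [minSmoothness_of_isRCLikeNormedField]; exact ENat.LEInfty.out)
  rw [chartField, this, ← VectorField.mlieBracketWithin_univ,
    VectorField.mlieBracketWithin_eq_lieBracketWithin]
  exact congrFun VectorField.lieBracketWithin_univ y

theorem InGeneratedLieAlgebra.contMDiff {E : ∀ x : M, Submodule ℝ (TangentSpace (𝓡 m) x)}
    {V : ∀ x : M, TangentSpace (𝓡 m) x} (h : InGeneratedLieAlgebra E V) :
    ContMDiff (𝓡 m) (𝓡 m).tangent ∞ (fun x => (⟨x, V x⟩ : TangentBundle (𝓡 m) M)) := by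
  induction h with
  | section_mem V hV _ => exact hV
  | add V W _ _ h1 h2 => exact h1.add_section h2
  | smul c V _ h1 => exact h1.const_smul_section
  | bracket V W _ _ h1 h2 =>
    have : IsManifold (𝓡 m) (minSmoothness ℝ 3) M := .of_le (n := ∞) (by
      rw [minSmoothness_of_isRCLikeNormedField]; exact ENat.LEInfty.out)
    have : IsManifold (𝓡 m) (((⊤ : ℕ∞) : ℕ∞ω) + 1) M := .of_le (n := ∞) (by simp)
    exact ContDiff.mlieBracket_vectorField (m := ⊤) (n := ⊤) h1 h2
      (by rw [minSmoothness_of_isRCLikeNormedField]; simp)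

/-- If each smooth section of `E` is, in a chart, related by `f` to a smooth vector field, then so
is each member of the Lie algebra generated by the sections of `E`. -/
theorem InGeneratedLieAlgebra.exists_related {E : ∀ x : M, Submodule ℝ (TangentSpace (𝓡 m) x)}
    (c : M) {P : Type*} [NormedAddCommGroup P] [NormedSpace ℝ P]
    {f : P → EuclideanSpace ℝ (Fin m)} {O : Set P} (hO : IsOpen O) (hf : ContDiffOn ℝ ∞ f O)
    (hfO : MapsTo f O (extChartAt (𝓡 m) c).target)
    (hE : ∀ V : ∀ x : M, TangentSpace (𝓡 m) x,
      ContMDiff (𝓡 m) (𝓡 m).tangent ∞ (fun x => (⟨x, V x⟩ : TangentBundle (𝓡 m) M)) →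
      (∀ x, V x ∈ E x) →
      ∃ w : P → P, ContDiffOn ℝ ∞ w O ∧ ∀ y ∈ O, fderiv ℝ f y (w y) = chartField c V (f y))
    {V : ∀ x : M, TangentSpace (𝓡 m) x} (hV : InGeneratedLieAlgebra E V) :
    ∃ w : P → P, ContDiffOn ℝ ∞ w O ∧ ∀ y ∈ O, fderiv ℝ f y (w y) = chartField c V (f y) := by
  induction hV with
  | section_mem V hV hVE => exact hE V hV hVE
  | add V W _ _ h1 h2 =>
    obtain ⟨v, hv, hvV⟩ := h1
    obtain ⟨w, hw, hwW⟩ := h2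
    refine ⟨fun y => v y + w y, hv.add hw, fun y hy => ?_⟩
    rw [map_add, hvV y hy, hwW y hy, chartField_eq (hfO hy), chartField_eq (hfO hy),
      chartField_eq (hfO hy), ← map_add]
  | smul a V _ h1 =>
    obtain ⟨v, hv, hvV⟩ := h1
    refine ⟨fun y => a • v y, hv.const_smul a, fun y hy => ?_⟩
    rw [map_smul, hvV y hy, chartField_eq (hfO hy), chartField_eq (hfO hy), ← map_smul]
  | bracket V W hV hW h1 h2 =>
    obtain ⟨v, hv, hvV⟩ := h1
    obtain ⟨w, hw, hwW⟩ := h2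
    refine ⟨VectorField.lieBracket ℝ v w, ?_, fun y hy => ?_⟩
    · exact ((hw.fderiv_of_isOpen hO (by simp)).clm_apply hv).sub
        ((hv.fderiv_of_isOpen hO (by simp)).clm_apply hw)
    · have hOy := hO.mem_nhds hy
      have hty := (isOpen_extChartAt_target (I := 𝓡 m) c).mem_nhds (hfO hy)
      have hfd : DifferentiableAt ℝ f y := (hf.contDiffAt hOy).differentiableAt (by simp)
      have key : ∀ {V : ∀ x : M, TangentSpace (𝓡 m) x} {v : P → P},
          InGeneratedLieAlgebra E V → (∀ y ∈ O, fderiv ℝ f y (v y) = chartField c V (f y)) →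
          ∀ z, fderiv ℝ (fun x => fderiv ℝ f x (v x)) y z =
            fderiv ℝ (chartField c V) (f y) (fderiv ℝ f y z) := by
        intro V v hV hvV z
        have hev : (fun x => fderiv ℝ f x (v x)) =ᶠ[𝓝 y] chartField c V ∘ f := by
          filter_upwards [hOy] with x hx using hvV x hx
        rw [hev.fderiv_eq, fderiv_comp y
          (((contDiffOn_chartField c hV.contMDiff).contDiffAt hty).differentiableAt (by simp)) hfd]
        rfl
      rw [VectorField.fderiv_apply_lieBracket (n := ∞) (hf.contDiffAt hOy)
        (by rw [minSmoothness_of_isRCLikeNormedField]; exact ENat.LEInfty.out)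
        ((hw.contDiffAt hOy).differentiableAt (by simp))
        ((hv.contDiffAt hOy).differentiableAt (by simp)), key hW hwW, key hV hvV, hvV y hy,
        hwW y hy, chartField_mlieBracket hV.contMDiff hW.contMDiff (hfO hy)]
      rfl

/-- Under Hörmander's condition, a map to which all sections of `E` lift is a submersion. -/
theorem HormanderCondition.surjective_fderiv {E : ∀ x : M, Submodule ℝ (TangentSpace (𝓡 m) x)}
    (h : HormanderCondition E) (c : M) {P : Type*} [NormedAddCommGroup P] [NormedSpace ℝ P]
    {f : P → EuclideanSpace ℝ (Fin m)} {O : Set P} (hO : IsOpen O) (hf : ContDiffOn ℝ ∞ f O)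
    (hfO : MapsTo f O (extChartAt (𝓡 m) c).target)
    (hE : ∀ V : ∀ x : M, TangentSpace (𝓡 m) x,
      ContMDiff (𝓡 m) (𝓡 m).tangent ∞ (fun x => (⟨x, V x⟩ : TangentBundle (𝓡 m) M)) →
      (∀ x, V x ∈ E x) →
      ∃ w : P → P, ContDiffOn ℝ ∞ w O ∧ ∀ y ∈ O, fderiv ℝ f y (w y) = chartField c V (f y))
    {y : P} (hy : y ∈ O) : Function.Surjective (fderiv ℝ f y) := by
  intro v
  obtain ⟨D, hD⟩ := isInvertible_chartDeriv ((extChartAt (𝓡 m) c).map_target (hfO hy))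
  obtain ⟨V, hV, hVy⟩ := h ((extChartAt (𝓡 m) c).symm (f y)) (D.symm v)
  obtain ⟨w, -, hw⟩ := hV.exists_related c hO hf hfO hE
  refine ⟨w y, ?_⟩
  rw [hw y hy, chartField_eq (hfO hy), hVy, ← hD]
  exact D.apply_symm_apply v

end ChartField

section HormanderSubmersion

variable {m n : ℕ} {M N : Type*}
  [TopologicalSpace M] [ChartedSpace (EuclideanSpace ℝ (Fin m)) M] [IsManifold (𝓡 m) ∞ M]
  [T2Space M]
  [TopologicalSpace N] [ChartedSpace (EuclideanSpace ℝ (Fin n)) N] [IsManifold (𝓡 n) ∞ N]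
  [T2Space N] {p : C^∞⟮𝓡 n, N; 𝓡 m, M⟯} {B : C^∞⟮𝓡 n, N; ℝ⟯ →ₗ[ℝ] C^∞⟮𝓡 n, N; ℝ⟯}
    {A : C^∞⟮𝓡 m, M; ℝ⟯ →ₗ[ℝ] C^∞⟮𝓡 m, M; ℝ⟯}

/-- Sections of `E` lift locally to smooth horizontal vector fields on `N`, which are related to
them by `p`; so under Hörmander's condition `p` is a submersion. -/
theorem IsOver.surjective_mfderiv (hBA : IsOver p B A) (hA : IsDiffusionOperator A)
    (hB : IsDiffusionOperator B) {k : ℕ} (hk : ∀ x, Module.finrank ℝ (symbolImage A x) = k)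
    (hH : HormanderCondition (symbolImage A)) (u : N) :
    Function.Surjective (mfderiv (𝓡 n) (𝓡 m) p u) := by
  have hu := mem_extChartAt_source (I := 𝓡 n) u
  have hpu := mem_extChartAt_source (I := 𝓡 m) (p u)
  obtain ⟨YM, YN, hYM, hYN, hrel, -, hrangeM, -⟩ :=
    hBA.exists_horizontal_fields hA hB u (p u)
  obtain ⟨V, hVt, hV, hzV, C, hC, hCinv⟩ := exists_contDiffOn_rightInverse_range
    (isOpen_extChartAt_target (p u)) hYM ((extChartAt (𝓡 m) (p u)).map_source hpu)
    (finrank_range_of_map_symbolImage hk hrangeM)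
  have hP := contDiffOn_chartRep p.contMDiff u (p u)
  have hO := isOpen_chartRepDomain (m := m) (n := n) p.contMDiff.continuous u (p u)
  have hdom := extChartAt_mem_chartRepDomain (m := m) (n := n) hu hpu
  have hsurj := hH.surjective_fderiv (p u) (hP.continuousOn.isOpen_inter_preimage hO hV)
    (hP.mono inter_subset_left) (fun y hy => hVt hy.2) (fun W hW hWE =>
      ⟨fun y => YN y (C (chartRep m n p u (p u) y)
          (chartField (p u) W (chartRep m n p u (p u) y))), ?_, fun y hy => ?_⟩)
    (y := extChartAt (𝓡 n) u u)
    ⟨hdom, by rw [mem_preimage, chartRep_extChartAt _ hu]; exact hzV⟩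
  · exact (surjective_fderiv_chartRep p.contMDiff hu hpu).1 hsurj
  · refine (hYN.mono inter_subset_left).clm_apply (ContDiffOn.clm_apply ?_ ?_)
    · exact hC.comp (hP.mono inter_subset_left) fun y hy => hy.2
    · exact (contDiffOn_chartField (p u) hW).comp (hP.mono inter_subset_left)
        fun y hy => hVt hy.2
  · rw [hrel y hy.1]
    have hyt := hVt hy.2
    obtain ⟨β, hβ⟩ : chartField (p u) W (chartRep m n p u (p u) y) ∈
        LinearMap.range (YM (chartRep m n p u (p u) y)).toLinearMap := by
      have h1 := hrangeM _ ((extChartAt (𝓡 m) (p u)).map_target hyt)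
      rw [(extChartAt (𝓡 m) (p u)).right_inv hyt] at h1
      rw [h1, chartField_eq hyt]
      exact ⟨_, hWE _, rfl⟩
    rw [← hβ]
    exact hCinv _ hy.2 β

end HormanderSubmersion

/-! ### Submersions and their fibres -/

section SubmersionNormalForm

/-- A surjective linear map is the first component of a linear isomorphism onto a product. -/
theorem ContinuousLinearMap.exists_equiv_prod_of_surjective {E F : Type*}
    [NormedAddCommGroup E] [NormedSpace ℝ E] [FiniteDimensional ℝ E]
    [NormedAddCommGroup F] [NormedSpace ℝ F] [FiniteDimensional ℝ F]
    {D : E →L[ℝ] F} (hD : Function.Surjective D) {k : ℕ}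
    (hk : Module.finrank ℝ E = Module.finrank ℝ F + k) :
    ∃ T : E ≃L[ℝ] F × EuclideanSpace ℝ (Fin k), ∀ v, (T v).1 = D v := by
  have hr : LinearMap.range D.toLinearMap = ⊤ := LinearMap.range_eq_top.2 hD
  have hker : Module.finrank ℝ (LinearMap.ker D.toLinearMap) =
      Module.finrank ℝ (EuclideanSpace ℝ (Fin k)) := by
    have h1 := LinearMap.finrank_range_add_finrank_ker D.toLinearMap
    rw [hr, finrank_top] at h1
    rw [finrank_euclideanSpace_fin]
    omega
  let e := LinearEquiv.ofFinrankEq _ _ hker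
  obtain ⟨q, hq⟩ := (LinearMap.ker D.toLinearMap).exists_isCompl
  let π := (LinearMap.ker D.toLinearMap).projectionOnto q hq
  have hπr : LinearMap.range (e.toLinearMap ∘ₗ π) = ⊤ := by
    rw [LinearMap.range_comp, Submodule.range_projectionOnto]
    simp
  have hπk : LinearMap.ker (e.toLinearMap ∘ₗ π) = q := by
    rw [LinearEquiv.ker_comp, Submodule.ker_projectionOnto]
  let T := LinearMap.equivProdOfSurjectiveOfIsCompl D.toLinearMap (e.toLinearMap ∘ₗ π) hr hπr
    (by rw [hπk]; exact hq)
  exact ⟨T.toContinuousLinearEquiv, fun v => rfl⟩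

/-- A map with surjective derivative is a linear projection in suitable coordinates. -/
theorem ContDiffOn.exists_submersion_coordinates {E F : Type*}
    [NormedAddCommGroup E] [NormedSpace ℝ E] [FiniteDimensional ℝ E]
    [NormedAddCommGroup F] [NormedSpace ℝ F] [FiniteDimensional ℝ F]
    {f : E → F} {U : Set E} (hU : IsOpen U) (hf : ContDiffOn ℝ ∞ f U) {y : E} (hy : y ∈ U)
    (hs : Function.Surjective (fderiv ℝ f y)) {k : ℕ}
    (hk : Module.finrank ℝ E = Module.finrank ℝ F + k) :
    ∃ (T : E ≃L[ℝ] F × EuclideanSpace ℝ (Fin k)) (e : OpenPartialHomeomorph E E),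
      y ∈ e.source ∧ e.source ⊆ U ∧ ContDiffOn ℝ ∞ e e.source ∧ ContDiffOn ℝ ∞ e.symm e.target ∧
      ∀ w, (T (e w)).1 = f w := by
  obtain ⟨T, hT⟩ := ContinuousLinearMap.exists_equiv_prod_of_surjective hs hk
  let Φ : E → E := fun w => T.symm (f w, (T w).2)
  have hΦ : ContDiffOn ℝ ∞ Φ U := T.symm.contDiff.comp_contDiffOn
    (hf.prodMk (contDiff_snd.comp T.contDiff).contDiffOn)
  have hfd : HasFDerivAt f (fderiv ℝ f y) y :=
    ((hf.contDiffAt (hU.mem_nhds hy)).differentiableAt (by simp)).hasFDerivAt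
  have hd : HasFDerivAt Φ (ContinuousLinearMap.id ℝ E) y := by
    have h1 := T.symm.hasFDerivAt.comp y (hfd.prodMk
      (((ContinuousLinearMap.snd ℝ F (EuclideanSpace ℝ (Fin k))).comp T.toContinuousLinearMap)).hasFDerivAt)
    refine h1.congr_fderiv ?_
    ext1 v
    change T.symm (fderiv ℝ f y v, (T v).2) = v
    rw [← hT]
    exact T.symm_apply_apply v
  obtain ⟨e, hye, heU, heΦ, he, -⟩ := hΦ.exists_openPartialHomeomorph hU hy
    (by rw [hd.fderiv]; exact ⟨ContinuousLinearEquiv.refl ℝ E, rfl⟩)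
  refine ⟨T, e, hye, heU, by rw [heΦ]; exact hΦ.mono heU, he, fun w => ?_⟩
  rw [heΦ, T.apply_symm_apply]

variable {m n : ℕ} {M N : Type*}
  [TopologicalSpace M] [ChartedSpace (EuclideanSpace ℝ (Fin m)) M]
  [TopologicalSpace N] [ChartedSpace (EuclideanSpace ℝ (Fin n)) N]

/-- `d` is a chart of `N` in which `p` is, up to the linear isomorphism `T`, the first
projection. -/
structure IsSubmersionChart {k : ℕ} (p : N → M) (x : M)
    (T : EuclideanSpace ℝ (Fin n) ≃L[ℝ] EuclideanSpace ℝ (Fin m) × EuclideanSpace ℝ (Fin k))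
    (d : OpenPartialHomeomorph N (EuclideanSpace ℝ (Fin n))) : Prop where
  isLocalDiffeoOn : IsLocalDiffeoOn n n d
  mapsTo : ∀ w ∈ d.source, p w ∈ (extChartAt (𝓡 m) x).source
  fst_eq : ∀ w ∈ d.source, (T (d w)).1 = extChartAt (𝓡 m) x (p w)

variable [IsManifold (𝓡 m) ∞ M] [IsManifold (𝓡 n) ∞ N] {p : N → M}

omit [IsManifold (𝓡 m) ∞ M] [IsManifold (𝓡 n) ∞ N] in
theorem le_of_surjective_mfderiv {u : N} (hs : Function.Surjective (mfderiv (𝓡 n) (𝓡 m) p u)) :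
    m ≤ n := by
  let D : EuclideanSpace ℝ (Fin n) →L[ℝ] EuclideanSpace ℝ (Fin m) := mfderiv (𝓡 n) (𝓡 m) p u
  have := LinearMap.finrank_le_finrank_of_surjective (f := D.toLinearMap) hs
  simpa using this

theorem exists_isSubmersionChart (hp : ContMDiff (𝓡 n) (𝓡 m) ∞ p) {u : N} {x : M}
    (hpu : p u ∈ (extChartAt (𝓡 m) x).source)
    (hs : Function.Surjective (mfderiv (𝓡 n) (𝓡 m) p u)) :
    ∃ (T : EuclideanSpace ℝ (Fin n) ≃L[ℝ]
        EuclideanSpace ℝ (Fin m) × EuclideanSpace ℝ (Fin (n - m)))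
      (d : OpenPartialHomeomorph N (EuclideanSpace ℝ (Fin n))),
      u ∈ d.source ∧ IsSubmersionChart p x T d := by
  have hu := mem_extChartAt_source (I := 𝓡 n) u
  have hmn := le_of_surjective_mfderiv hs
  obtain ⟨T, e, hue, heU, he, he', hTe⟩ :=
    (contDiffOn_chartRep hp u x).exists_submersion_coordinates (k := n - m)
      (isOpen_chartRepDomain hp.continuous u x) (extChartAt_mem_chartRepDomain hu hpu)
      ((surjective_fderiv_chartRep hp hu hpu).2 hs)
      (by rw [finrank_euclideanSpace_fin, finrank_euclideanSpace_fin]; omega)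
  have hsrc : ∀ w ∈ ((chartAt (EuclideanSpace ℝ (Fin n)) u).trans e).source,
      w ∈ (extChartAt (𝓡 n) u).source ∧ extChartAt (𝓡 n) u w ∈ chartRepDomain m n p u x := by
    intro w hw
    rw [OpenPartialHomeomorph.trans_source] at hw
    exact ⟨by rw [extChartAt_source]; exact hw.1, heU (by simpa [mfld_simps] using hw.2)⟩
  refine ⟨T, (chartAt (EuclideanSpace ℝ (Fin n)) u).trans e, ?_,
    (isLocalDiffeoOn_chartAt u).trans
      ⟨contMDiffOn_iff_contDiffOn.2 he, contMDiffOn_iff_contDiffOn.2 he'⟩, ?_, ?_⟩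
  · rw [OpenPartialHomeomorph.trans_source]
    exact ⟨mem_chart_source _ u, by simpa [mfld_simps] using hue⟩
  · intro w hw
    obtain ⟨h1, -, h2⟩ := hsrc w hw
    rwa [mem_preimage, mem_preimage, (extChartAt (𝓡 n) u).left_inv h1] at h2
  · intro w hw
    rw [← chartRep_extChartAt p (hsrc w hw).1, ← hTe]
    simp [mfld_simps]

theorem isSubmersion_of_surjective_mfderiv (hp : ContMDiff (𝓡 n) (𝓡 m) ∞ p)
    (hs : ∀ u, Function.Surjective (mfderiv (𝓡 n) (𝓡 m) p u)) :
    Manifold.IsSubmersion (𝓡 n) (𝓡 m) ∞ p := by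
  refine ⟨EuclideanSpace ℝ (Fin (n - m)), inferInstance, inferInstance, fun u => ?_⟩
  obtain ⟨T, d, hu, hd⟩ := exists_isSubmersionChart hp (mem_extChartAt_source (p u)) (hs u)
  refine Manifold.IsSubmersionAtOfComplement.mk_of_continuousAt hp.continuous.continuousAt T d
    (chartAt (EuclideanSpace ℝ (Fin m)) (p u)) hu (mem_chart_source _ _)
    (OpenPartialHomeomorph.mem_maximalAtlas_of_contMDiffOn _ hd.isLocalDiffeoOn.1
      hd.isLocalDiffeoOn.2) (IsManifold.chart_mem_maximalAtlas _) fun y hy => ?_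
  have hy' : y ∈ d.target := by simpa [mfld_simps] using hy
  have := hd.fst_eq _ (d.map_target hy')
  rw [d.right_inv hy'] at this
  simp only [Function.comp_apply]
  rw [this]
  simp [mfld_simps]

end SubmersionNormalForm

section Fibre

variable {m n k : ℕ} {M : Type u} {N : Type v}
  [TopologicalSpace M] [ChartedSpace (EuclideanSpace ℝ (Fin m)) M]
  [TopologicalSpace N] [ChartedSpace (EuclideanSpace ℝ (Fin n)) N] {p : N → M} {x : M}
  {T : EuclideanSpace ℝ (Fin n) ≃L[ℝ] EuclideanSpace ℝ (Fin m) × EuclideanSpace ℝ (Fin k)}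
  {d : OpenPartialHomeomorph N (EuclideanSpace ℝ (Fin n))}

theorem IsSubmersionChart.symm_mem_fibre (hd : IsSubmersionChart p x T d)
    {v : EuclideanSpace ℝ (Fin k)} (hv : T.symm (extChartAt (𝓡 m) x x, v) ∈ d.target) :
    d.symm (T.symm (extChartAt (𝓡 m) x x, v)) ∈ (p ⁻¹' {x} : Set N) := by
  have h1 := hd.fst_eq _ (d.map_target hv)
  rw [d.right_inv hv, T.apply_symm_apply] at h1
  exact ((extChartAt (𝓡 m) x).injOn (mem_extChartAt_source x)
    (hd.mapsTo _ (d.map_target hv)) h1).symm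

theorem IsSubmersionChart.symm_eq (hd : IsSubmersionChart p x T d) {w : N} (hw : w ∈ d.source)
    (hpw : p w = x) : T.symm (extChartAt (𝓡 m) x x, (T (d w)).2) = d w := by
  have h1 := hd.fst_eq w hw
  rw [hpw] at h1
  rw [← h1]
  exact T.symm_apply_apply _

open Classical in
/-- The chart of the fibre over `x` induced by a submersion chart. The value of its inverse outside
of the target is arbitrary. -/
noncomputable def IsSubmersionChart.fibreChart (hd : IsSubmersionChart p x T d)
    (u : (p ⁻¹' {x} : Set N)) :
    OpenPartialHomeomorph (p ⁻¹' {x} : Set N) (EuclideanSpace ℝ (Fin k)) where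
  toFun w := (T (d w)).2
  invFun v := if h : T.symm (extChartAt (𝓡 m) x x, v) ∈ d.target then
    ⟨d.symm (T.symm (extChartAt (𝓡 m) x x, v)), hd.symm_mem_fibre h⟩ else u
  source := {w | (w : N) ∈ d.source}
  target := {v | T.symm (extChartAt (𝓡 m) x x, v) ∈ d.target}
  map_source' w hw := by
    change T.symm _ ∈ d.target
    rw [hd.symm_eq hw w.2]
    exact d.map_source hw
  map_target' v hv := by
    have hv' : T.symm (extChartAt (𝓡 m) x x, v) ∈ d.target := hv
    rw [dif_pos hv']
    exact d.map_target hv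
  left_inv' w hw := by
    have h1 := hd.symm_eq hw w.2
    have h2 : T.symm (extChartAt (𝓡 m) x x, (T (d w)).2) ∈ d.target := by
      rw [h1]; exact d.map_source hw
    rw [dif_pos h2]
    refine Subtype.ext ?_
    change d.symm _ = (w : N)
    rw [h1, d.left_inv hw]
  right_inv' v hv := by
    have hv' : T.symm (extChartAt (𝓡 m) x x, v) ∈ d.target := hv
    rw [dif_pos hv']
    change (T (d (d.symm _))).2 = v
    rw [d.right_inv hv', T.apply_symm_apply]
  open_source := d.open_source.preimage continuous_subtype_val
  open_target := d.open_target.preimage (T.symm.continuous.comp (by fun_prop))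
  continuousOn_toFun := by
    refine continuous_snd.comp_continuousOn (T.continuous.comp_continuousOn ?_)
    exact d.continuousOn.comp continuous_subtype_val.continuousOn fun w hw => hw
  continuousOn_invFun := by
    rw [IsInducing.subtypeVal.continuousOn_iff]
    have h1 : ContinuousOn (fun v => d.symm (T.symm (extChartAt (𝓡 m) x x, v)))
        {v | T.symm (extChartAt (𝓡 m) x x, v) ∈ d.target} :=
      d.continuousOn_symm.comp (T.symm.continuous.comp (by fun_prop)).continuousOn fun v hv => hv
    refine h1.congr fun v hv => ?_
    have hv' : T.symm (extChartAt (𝓡 m) x x, v) ∈ d.target := hv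
    simp only [Function.comp_apply]
    rw [dif_pos hv']

open Classical in
theorem IsSubmersionChart.coe_fibreChart_symm (hd : IsSubmersionChart p x T d)
    (u : (p ⁻¹' {x} : Set N)) {v : EuclideanSpace ℝ (Fin k)} (hv : v ∈ (hd.fibreChart u).target) :
    (((hd.fibreChart u).symm v : (p ⁻¹' {x} : Set N)) : N) =
      d.symm (T.symm (extChartAt (𝓡 m) x x, v)) := by
  have hv' : T.symm (extChartAt (𝓡 m) x x, v) ∈ d.target := hv
  change ((dite _ _ _ : (p ⁻¹' {x} : Set N)) : N) = _
  rw [dif_pos hv']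

theorem IsSubmersionChart.contDiffOn_fibreChart_trans (hd : IsSubmersionChart p x T d)
    (u : (p ⁻¹' {x} : Set N))
    {T' : EuclideanSpace ℝ (Fin n) ≃L[ℝ] EuclideanSpace ℝ (Fin m) × EuclideanSpace ℝ (Fin k)}
    {d' : OpenPartialHomeomorph N (EuclideanSpace ℝ (Fin n))} (hd' : IsSubmersionChart p x T' d')
    (u' : (p ⁻¹' {x} : Set N)) :
    ContDiffOn ℝ ∞ ((hd.fibreChart u).symm.trans (hd'.fibreChart u'))
      ((hd.fibreChart u).symm.trans (hd'.fibreChart u')).source := by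
  have h0 : IsLocalDiffeoOn n n (d.symm.trans d') :=
    hd.isLocalDiffeoOn.symm.trans hd'.isLocalDiffeoOn
  have h1 := contMDiffOn_iff_contDiffOn.1 h0.1
  have h2 : ContDiff ℝ ∞ (fun v : EuclideanSpace ℝ (Fin k) =>
      T.symm (extChartAt (𝓡 m) x x, v)) :=
    T.symm.contDiff.comp (contDiff_const.prodMk contDiff_id)
  have h3 : ∀ v ∈ ((hd.fibreChart u).symm.trans (hd'.fibreChart u')).source,
      v ∈ (hd.fibreChart u).target ∧
        ((hd.fibreChart u).symm v : N) ∈ d'.source := fun v hv => by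
    rw [OpenPartialHomeomorph.trans_source] at hv
    exact ⟨hv.1, hv.2⟩
  have h4 : ContDiffOn ℝ ∞ (fun v => (T' ((d.symm.trans d') (T.symm (extChartAt (𝓡 m) x x, v)))).2)
      ((hd.fibreChart u).symm.trans (hd'.fibreChart u')).source := by
    refine contDiff_snd.comp_contDiffOn (T'.contDiff.comp_contDiffOn (h1.comp h2.contDiffOn ?_))
    intro v hv
    obtain ⟨h5, h6⟩ := h3 v hv
    rw [hd.coe_fibreChart_symm u h5] at h6
    rw [OpenPartialHomeomorph.trans_source]
    exact ⟨h5, h6⟩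
  refine h4.congr fun v hv => ?_
  rw [OpenPartialHomeomorph.coe_trans, OpenPartialHomeomorph.coe_trans]
  simp only [Function.comp_apply]
  change (T' (d' _)).2 = _
  rw [hd.coe_fibreChart_symm u (h3 v hv).1]

variable [IsManifold (𝓡 m) ∞ M] [IsManifold (𝓡 n) ∞ N]

/-- The fibre over a regular value is an embedded submanifold. -/
theorem IsRegularValue.isEmbeddedSubmanifold (hp : ContMDiff (𝓡 n) (𝓡 m) ∞ p)
    (hx : IsRegularValue m n p x) : IsEmbeddedSubmanifold n (n - m) (p ⁻¹' {x} : Set N) := by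
  have hex : ∀ u : (p ⁻¹' {x} : Set N), ∃ (T : EuclideanSpace ℝ (Fin n) ≃L[ℝ]
        EuclideanSpace ℝ (Fin m) × EuclideanSpace ℝ (Fin (n - m)))
      (d : OpenPartialHomeomorph N (EuclideanSpace ℝ (Fin n))),
      (u : N) ∈ d.source ∧ IsSubmersionChart p x T d := by
    rintro ⟨u, rfl⟩
    exact exists_isSubmersionChart hp (mem_extChartAt_source (p u)) (hx u rfl)
  choose T d hu hd using hex
  let cs : ChartedSpace (EuclideanSpace ℝ (Fin (n - m))) (p ⁻¹' {x} : Set N) :=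
    { atlas := range fun u => (hd u).fibreChart u
      chartAt := fun u => (hd u).fibreChart u
      mem_chart_source := fun u => hu u
      chart_mem_atlas := fun u => mem_range_self u }
  have hM : IsManifold (𝓡 (n - m)) ∞ (p ⁻¹' {x} : Set N) := by
    refine isManifold_of_contDiffOn _ _ _ ?_
    rintro _ _ ⟨u, rfl⟩ ⟨u', rfl⟩
    have := (hd u).contDiffOn_fibreChart_trans u (hd u') u'
    simpa [mfld_simps] using this
  refine ⟨(p ⁻¹' {x} : Set N), inferInstance, cs, hM, Subtype.val,
    ⟨⟨EuclideanSpace ℝ (Fin m), inferInstance, inferInstance, fun u => ?_⟩, IsEmbedding.subtypeVal⟩,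
    Subtype.range_coe⟩
  -- translate the chart so that the fibre becomes a linear subspace
  let a := (T u).symm (extChartAt (𝓡 m) x x, 0)
  let τ := Homeomorph.addRight (-a)
  have hτ : IsLocalDiffeoOn n n τ.toOpenPartialHomeomorph := by
    refine ⟨contMDiffOn_iff_contDiffOn.2 ?_, contMDiffOn_iff_contDiffOn.2 ?_⟩
    · exact (contDiff_id.add contDiff_const).contDiffOn
    · exact (contDiff_id.add contDiff_const).contDiffOn
  have hdτ := (hd u).isLocalDiffeoOn.trans hτ
  refine Manifold.IsImmersionAtOfComplement.mk_of_continuousAt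
    continuous_subtype_val.continuousAt ((ContinuousLinearEquiv.prodComm ℝ _ _).trans (T u).symm)
    (chartAt _ u) ((d u).trans τ.toOpenPartialHomeomorph) (mem_chart_source _ u) ?_
    (IsManifold.chart_mem_maximalAtlas u)
    (OpenPartialHomeomorph.mem_maximalAtlas_of_contMDiffOn _ hdτ.1 hdτ.2) ?_
  · rw [OpenPartialHomeomorph.trans_source]
    exact ⟨hu u, trivial⟩
  · intro v hv
    have hv' : v ∈ ((hd u).fibreChart u).target := by
      have h0 : v ∈ (chartAt (EuclideanSpace ℝ (Fin (n - m))) u).target := by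
        simpa [mfld_simps] using hv
      exact h0
    have h1 := (hd u).coe_fibreChart_symm u hv'
    have hv2 : (T u).symm (extChartAt (𝓡 m) x x, v) ∈ (d u).target := hv'
    have h2 : (((d u).trans τ.toOpenPartialHomeomorph).extend (𝓡 n))
        (((hd u).fibreChart u).symm v : N) = (T u).symm (0, v) := by
      rw [h1]
      change d u ((d u).symm _) + -a = _
      rw [(d u).right_inv hv2, ← sub_eq_add_neg, ← map_sub]
      simp
    exact h2

end Fibre

/-! ### Accessibility under Hörmander's condition -/

/-- Injectivity of a continuous family of linear maps is an open condition. -/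
theorem eventually_injective {X E F : Type*} [TopologicalSpace X]
    [NormedAddCommGroup E] [NormedSpace ℝ E] [FiniteDimensional ℝ E]
    [NormedAddCommGroup F] [NormedSpace ℝ F] [FiniteDimensional ℝ F]
    {S : X → E →L[ℝ] F} {x : X} (hS : ContinuousAt S x) (hx : Function.Injective (S x)) :
    ∀ᶠ y in 𝓝 x, Function.Injective (S y) := by
  obtain ⟨Q', hQ'⟩ := LinearMap.exists_leftInverse_of_injective (S x).toLinearMap
    (LinearMap.ker_eq_bot.2 hx)
  let Q : F →L[ℝ] E := LinearMap.toContinuousLinearMap Q'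
  have hc : ContinuousAt (fun y => Q ∘L S y) x := continuousAt_const.clm_comp hS
  have h1 : Q ∘L S x = 1 := by
    ext1 g
    exact congrArg (fun B : E →ₗ[ℝ] E => B g) hQ'
  have hU : {B : E →L[ℝ] E | IsUnit B} ∈ 𝓝 (Q ∘L S x) :=
    (Units.isOpen (R := E →L[ℝ] E)).mem_nhds (by rw [h1]; exact isUnit_one)
  filter_upwards [hc.preimage_mem_nhds hU] with y hy
  obtain ⟨B, hB⟩ := hy
  intro v w hvw
  have h2 : ∀ v, (B.inv (Q (S y v)) : E) = v := fun v => by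
    have := congrArg (fun A : E →L[ℝ] E => A v) B.inv_mul
    rw [hB] at this
    exact this
  rw [← h2 v, hvw, h2 w]

section Accessibility

variable {m : ℕ} {M : Type*} [TopologicalSpace M] [ChartedSpace (EuclideanSpace ℝ (Fin m)) M]

/-- `z'` is the image of `z` under a local homeomorphism of the model space which, in the chart
centered at `c`, moves points only inside the classes of `R`. -/
def IsLocallyRelated (R : M → M → Prop) (c : M) (z z' : EuclideanSpace ℝ (Fin m)) : Prop :=
  ∃ e : OpenPartialHomeomorph (EuclideanSpace ℝ (Fin m)) (EuclideanSpace ℝ (Fin m)),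
    z ∈ e.source ∧ e z = z' ∧ ∀ r ∈ e.source,
      R ((extChartAt (𝓡 m) c).symm r) ((extChartAt (𝓡 m) c).symm (e r))

variable {R : M → M → Prop} {c : M}

theorem IsLocallyRelated.refl (hR : Equivalence R) (z : EuclideanSpace ℝ (Fin m)) :
    IsLocallyRelated R c z z :=
  ⟨OpenPartialHomeomorph.refl _, mem_univ z, rfl, fun _ _ => hR.refl _⟩

theorem IsLocallyRelated.trans (hR : Equivalence R) {z z' z'' : EuclideanSpace ℝ (Fin m)}
    (h : IsLocallyRelated R c z z') (h' : IsLocallyRelated R c z' z'') :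
    IsLocallyRelated R c z z'' := by
  obtain ⟨e, he, rfl, heR⟩ := h
  obtain ⟨e', he', rfl, heR'⟩ := h'
  refine ⟨e.trans e', ?_, rfl, fun r hr => ?_⟩
  · rw [OpenPartialHomeomorph.trans_source]; exact ⟨he, he'⟩
  · rw [OpenPartialHomeomorph.trans_source] at hr
    exact hR.trans (heR r hr.1) (heR' _ hr.2)

/-- The class of `z` is a neighbourhood of `z` as soon as it is a neighbourhood of one of the points
to which `z` is moved by local homeomorphisms. -/
theorem IsLocallyRelated.eventually (hR : Equivalence R) {z z' : EuclideanSpace ℝ (Fin m)}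
    (h : IsLocallyRelated R c z z')
    (h' : ∀ᶠ r in 𝓝 z', IsLocallyRelated R c z r) :
    ∀ᶠ r in 𝓝 z, R ((extChartAt (𝓡 m) c).symm z) ((extChartAt (𝓡 m) c).symm r) := by
  obtain ⟨e, he, rfl, heR⟩ := h
  filter_upwards [e.open_source.mem_nhds he, (e.continuousAt he).eventually h'] with r hr hr'
  obtain ⟨e', he', h1, heR'⟩ := hr'
  have h2 := heR' z he'
  rw [h1] at h2
  exact hR.trans h2 (hR.symm (heR r hr))

variable [IsManifold (𝓡 m) ∞ M] {E : ∀ x : M, Submodule ℝ (TangentSpace (𝓡 m) x)}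

/-- Integral curves of sections of `E` are horizontal. -/
theorem isHorizontalCurve_of_isControlSol {V : ∀ x : M, TangentSpace (𝓡 m) x}
    (hE : ∀ x, V x ∈ E x) {s : ℝ} {γ : ℝ → EuclideanSpace ℝ (Fin m)}
    (hγ : IsControlSol (fun y => (ContinuousLinearMap.id ℝ ℝ).smulRight (chartField c V y))
      (fun _ => s) (Icc (-1) 1) γ)
    (hγt : ∀ t, γ t ∈ (extChartAt (𝓡 m) c).target) :
    IsHorizontalCurve E (fun t => (extChartAt (𝓡 m) c).symm (γ t)) 1 := by
  have hsub : Icc (0 : ℝ) 1 ⊆ Icc (-1) 1 := Icc_subset_Icc (by norm_num) le_rfl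
  have hs : ∀ t, (extChartAt (𝓡 m) c).symm (γ t) ∈ (extChartAt (𝓡 m) c).source := fun t =>
    (extChartAt (𝓡 m) c).map_target (hγt t)
  have hcont : ContinuousOn (fun t => (extChartAt (𝓡 m) c).symm (γ t)) (Icc (-1) 1) :=
    (continuousOn_extChartAt_symm c).comp hγ.continuousOn fun t _ => hγt t
  have hchart : ∀ t, extChartAt (𝓡 m) c ((extChartAt (𝓡 m) c).symm (γ t)) = γ t := fun t =>
    (extChartAt (𝓡 m) c).right_inv (hγt t)
  refine ⟨⟨hcont.mono hsub, fun t ht => ?_⟩, ?_⟩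
  · obtain ⟨K, hK⟩ := hγ.1
    refine exists_lipschitzOnWith_extChartAt (c := c) (hcont.mono hsub t ht) (hs t)
      (mem_extChartAt_source _) ⟨K, _, self_mem_nhdsWithin, ?_⟩
    simp only [hchart]
    exact hK.mono hsub
  · rw [ae_restrict_iff' measurableSet_Ioo]
    filter_upwards [hγ.2] with t ht hmem
    have hmem' : t ∈ Ioo (-1 : ℝ) 1 := ⟨by linarith [hmem.1], hmem.2⟩
    have hd := ht (Ioo_subset_Icc_self hmem')
    have h1 := mdifferentiableAt_of_hasDerivAt_extChartAt (c := c)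
      (v := s • chartField c V (γ t)) (σ := fun t => (extChartAt (𝓡 m) c).symm (γ t)) (t := t)
      (hcont.continuousAt (Icc_mem_nhds hmem'.1 hmem'.2)) (hs t)
      (by simp only [hchart]; exact hd)
    refine ⟨h1.1, ?_⟩
    obtain ⟨D, hD⟩ := isInvertible_chartDeriv (hs t)
    have h2 := h1.2
    rw [chartField_eq (hγt t), ← map_smul, ← hD] at h2
    have h3 := D.injective h2
    rw [h3]
    exact (E _).smul_mem s (hE _)

/-- The flow of a section of `E` in a chart moves points inside the classes of `R`. -/
theorem exists_flow_isLocallyRelated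
    (hRE : ∀ (σ : ℝ → M), IsHorizontalCurve E σ 1 → R (σ 0) (σ 1))
    {V : ∀ x : M, TangentSpace (𝓡 m) x}
    (hV : ContMDiff (𝓡 m) (𝓡 m).tangent ∞ (fun x => (⟨x, V x⟩ : TangentBundle (𝓡 m) M)))
    (hE : ∀ x, V x ∈ E x) {z : EuclideanSpace ℝ (Fin m)}
    (hz : z ∈ (extChartAt (𝓡 m) c).target) :
    ∃ U : Set (EuclideanSpace ℝ (Fin m)), IsOpen U ∧ z ∈ U ∧ U ⊆ (extChartAt (𝓡 m) c).target ∧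
      ∃ η > 0, ∃ Γ : ℝ → EuclideanSpace ℝ (Fin m) → EuclideanSpace ℝ (Fin m),
      ContDiffOn ℝ ∞ (fun q : ℝ × EuclideanSpace ℝ (Fin m) => Γ q.1 q.2)
        (Metric.ball 0 η ×ˢ U) ∧
      (∀ u ∈ U, Γ 0 u = u ∧ HasDerivAt (fun s => Γ s u) (chartField c V u) 0) ∧
      ∀ s ∈ Metric.ball (0 : ℝ) η, ∀ u ∈ U,
        Γ s u ∈ (extChartAt (𝓡 m) c).target ∧ IsLocallyRelated R c u (Γ s u) := by
  let Y : EuclideanSpace ℝ (Fin m) → ℝ →L[ℝ] EuclideanSpace ℝ (Fin m) := fun y =>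
    (ContinuousLinearMap.id ℝ ℝ).smulRight (chartField c V y)
  have hY : ContDiffOn ℝ ∞ Y (extChartAt (𝓡 m) c).target :=
    contDiffOn_const.smulRight (contDiffOn_chartField c hV)
  obtain ⟨U, hU, hzU, η, hη, Γ, hΓ, hsm, hinv, hder⟩ :=
    exists_controlFlow_const (isOpen_extChartAt_target c) hY hz
  have h1 : (1 : ℝ) ∈ Icc (-1 : ℝ) 1 := by simp
  have h0 : (0 : ℝ) ∈ Icc (-1 : ℝ) 1 := by simp
  have hUt : U ⊆ (extChartAt (𝓡 m) c).target := fun u hu => by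
    have := hΓ 0 (Metric.mem_ball_self hη) u hu
    rw [← this.1]
    exact this.2.2 0
  refine ⟨U, hU, hzU, hUt, η, hη, fun s u => Γ s u 1, hsm 1, fun u hu => ⟨?_, ?_⟩,
    fun s hs u hu => ⟨(hΓ s hs u hu).2.2 1, ?_⟩⟩
  · obtain ⟨e1, ⟨⟨K, hK⟩, e2⟩, -⟩ := hΓ 0 (Metric.mem_ball_self hη) u hu
    have h3 := hK.integral_eq_sub_of_ae_hasDerivAt e2 h0 h1
    simp only [map_zero, intervalIntegral.integral_zero, e1] at h3
    exact (sub_eq_zero.1 h3.symm)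
  · have := (hder u hu 1 h1).hasDerivAt
    simpa [Y] using this
  · have hs1 : ContDiffOn ℝ ∞ (fun u => Γ s u 1) U :=
      (hsm 1).comp (contDiff_const.prodMk contDiff_id).contDiffOn fun w hw => ⟨hs, hw⟩
    obtain ⟨e, hue, heU, he, -, -⟩ := hs1.exists_openPartialHomeomorph hU hu (hinv s hs u hu 1)
    refine ⟨e, hue, by rw [he], fun r hr => ?_⟩
    have h4 := hRE _ (isHorizontalCurve_of_isControlSol hE (hΓ s hs r (heU hr)).2.1
      (hΓ s hs r (heU hr)).2.2)
    rw [(hΓ s hs r (heU hr)).1] at h4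
    rw [he]
    exact h4

/-- A family of points to which `z` can be moved is, if its dimension `j` is less than `m`,
transversal somewhere to a section of `E`, by Hörmander's condition. Flowing along this section
adds a dimension. -/
theorem HormanderCondition.exists_immersion (hH : HormanderCondition E) (hR : Equivalence R)
    (hRE : ∀ (σ : ℝ → M), IsHorizontalCurve E σ 1 → R (σ 0) (σ 1))
    {z : EuclideanSpace ℝ (Fin m)} (hz : z ∈ (extChartAt (𝓡 m) c).target) {j : ℕ} (hj : j ≤ m) :
    ∃ (Ψ : EuclideanSpace ℝ (Fin j) → EuclideanSpace ℝ (Fin m))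
      (O : Set (EuclideanSpace ℝ (Fin j))), IsOpen O ∧ O.Nonempty ∧ ContDiffOn ℝ ∞ Ψ O ∧
      (∀ w ∈ O, Function.Injective (fderiv ℝ Ψ w)) ∧
      ∀ w ∈ O, Ψ w ∈ (extChartAt (𝓡 m) c).target ∧ IsLocallyRelated R c z (Ψ w) := by
  induction j with
  | zero =>
    exact ⟨fun _ => z, univ, isOpen_univ, univ_nonempty, contDiffOn_const,
      fun w _ a b _ => Subsingleton.elim a b, fun w _ => ⟨hz, .refl hR z⟩⟩
  | succ j ih =>
    obtain ⟨Ψ, O, hO, ⟨w₁, hw₁⟩, hΨ, hinj, hrel⟩ := ih (by omega)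
    have hΨ' : ContDiffOn ℝ ∞ (fderiv ℝ Ψ) O := hΨ.fderiv_of_isOpen hO (by simp)
    obtain ⟨V, hV, hVE, w₀, hw₀, htrans⟩ : ∃ V : ∀ x : M, TangentSpace (𝓡 m) x,
        ContMDiff (𝓡 m) (𝓡 m).tangent ∞ (fun x => (⟨x, V x⟩ : TangentBundle (𝓡 m) M)) ∧
        (∀ x, V x ∈ E x) ∧ ∃ w₀ ∈ O,
          chartField c V (Ψ w₀) ∉ LinearMap.range (fderiv ℝ Ψ w₀).toLinearMap := by
      by_contra! hcon
      -- all sections are tangent to the family, so `Ψ` is a submersion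
      obtain ⟨O', hO'O, hO', hw₁', C, hC, hCinv⟩ := exists_contDiffOn_rightInverse_range hO hΨ' hw₁
        (r := j) fun w hw => by
          rw [LinearMap.finrank_range_of_inj (hinj w hw), finrank_euclideanSpace_fin]
      have hs := hH.surjective_fderiv c hO' (hΨ.mono hO'O) (fun w hw => (hrel w (hO'O hw)).1)
        (fun W hW hWE => ⟨fun w => C w (chartField c W (Ψ w)), hC.clm_apply
          ((contDiffOn_chartField c hW).comp (hΨ.mono hO'O) fun w hw => (hrel w (hO'O hw)).1),
          fun w hw => by
            obtain ⟨g, hg⟩ := hcon W hW hWE w (hO'O hw)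
            have hg' : fderiv ℝ Ψ w g = chartField c W (Ψ w) := hg
            have h1 := hCinv w hw g
            rw [hg'] at h1
            exact h1⟩) hw₁'
      have := LinearMap.finrank_le_finrank_of_surjective (f := (fderiv ℝ Ψ w₁).toLinearMap) hs
      rw [finrank_euclideanSpace_fin, finrank_euclideanSpace_fin] at this
      omega
    -- the new family is `Φ (s, w) = Γ s (Ψ w)`, with `Γ` the flow of `V`; its differential at
    -- `(0, w₀)` maps `(s, a)` to `s V + dΨ a`, and is injective as `V` is transversal
    obtain ⟨U, hU, hzU, -, η, hη, Γ, hΓ, hΓ0, hΓR⟩ :=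
      exists_flow_isLocallyRelated hRE hV hVE (hrel w₀ hw₀).1
    let T : EuclideanSpace ℝ (Fin (j + 1)) ≃L[ℝ] ℝ × EuclideanSpace ℝ (Fin j) :=
      ContinuousLinearEquiv.ofFinrankEq (by simp [add_comm])
    let O₁ : Set (ℝ × EuclideanSpace ℝ (Fin j)) := Metric.ball 0 η ×ˢ (O ∩ Ψ ⁻¹' U)
    have hO₁ : IsOpen O₁ :=
      Metric.isOpen_ball.prod (hΨ.continuousOn.isOpen_inter_preimage hO hU)
    let Φ : ℝ × EuclideanSpace ℝ (Fin j) → EuclideanSpace ℝ (Fin m) := fun q => Γ q.1 (Ψ q.2)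
    have hΦ : ContDiffOn ℝ ∞ Φ O₁ := hΓ.comp
      (contDiff_fst.contDiffOn.prodMk (hΨ.comp contDiff_snd.contDiffOn fun q hq => hq.2.1))
      fun q hq => ⟨hq.1, hq.2.2⟩
    have hmem₀ : ((0 : ℝ), w₀) ∈ O₁ := ⟨Metric.mem_ball_self hη, hw₀, hzU⟩
    have hΦd : HasFDerivAt Φ (fderiv ℝ Φ (0, w₀)) (0, w₀) :=
      ((hΦ.contDiffAt (hO₁.mem_nhds hmem₀)).differentiableAt (by simp)).hasFDerivAt
    have hd1 : ∀ s : ℝ, fderiv ℝ Φ (0, w₀) (s, 0) = s • chartField c V (Ψ w₀) := by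
      have h1 : HasFDerivAt (fun s : ℝ => (s, w₀)) (ContinuousLinearMap.inl ℝ ℝ _) 0 :=
        hasFDerivAt_prodMk_left 0 w₀
      have h2 := (hΦd.comp (f := fun s : ℝ => (s, w₀)) (0 : ℝ) h1).unique
        (hΓ0 _ hzU).2.hasFDerivAt
      intro s
      have h3 := congrArg (fun A : ℝ →L[ℝ] EuclideanSpace ℝ (Fin m) => A s) h2
      simpa using h3
    have hd2 : ∀ a, fderiv ℝ Φ (0, w₀) (0, a) = fderiv ℝ Ψ w₀ a := by
      have h1 : HasFDerivAt (fun w : EuclideanSpace ℝ (Fin j) => ((0 : ℝ), w))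
        (ContinuousLinearMap.inr ℝ ℝ _) w₀ := hasFDerivAt_prodMk_right 0 w₀
      have h2 := hΦd.comp w₀ h1
      have hev : Φ ∘ (fun w : EuclideanSpace ℝ (Fin j) => ((0 : ℝ), w)) =ᶠ[𝓝 w₀] Ψ := by
        filter_upwards [(hΨ.continuousOn.isOpen_inter_preimage hO hU).mem_nhds ⟨hw₀, hzU⟩]
          with w hw
        exact (hΓ0 _ hw.2).1
      intro a
      rw [← hev.fderiv_eq, h2.fderiv]
      simp
    have hinj₀ : Function.Injective (fderiv ℝ Φ (0, w₀)) := by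
      rw [injective_iff_map_eq_zero]
      rintro ⟨s, a⟩ hsa
      have h1 : ((s, a) : ℝ × EuclideanSpace ℝ (Fin j)) = (s, 0) + (0, a) := by simp
      rw [h1, map_add, hd1, hd2] at hsa
      have hs : s = 0 := by
        by_contra hs
        refine htrans ⟨-(s⁻¹ • a), ?_⟩
        change fderiv ℝ Ψ w₀ (-(s⁻¹ • a)) = _
        rw [map_neg, map_smul, eq_neg_of_add_eq_zero_right hsa, smul_neg, neg_neg, smul_smul,
          inv_mul_cancel₀ hs, one_smul]
      rw [hs, zero_smul, zero_add] at hsa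
      rw [hs, (injective_iff_map_eq_zero _).1 (hinj w₀ hw₀) a hsa]
      rfl
    have hΦ' : ContDiffOn ℝ ∞ (fderiv ℝ Φ) O₁ := hΦ.fderiv_of_isOpen hO₁ (by simp)
    obtain ⟨O₂, hO₂, hO₂open, hmem₂⟩ := mem_nhds_iff.1 (eventually_injective
      (hΦ'.continuousOn.continuousAt (hO₁.mem_nhds hmem₀)) hinj₀)
    refine ⟨Φ ∘ T, T ⁻¹' (O₁ ∩ O₂), (hO₁.inter hO₂open).preimage T.continuous,
      ⟨T.symm (0, w₀), by rw [mem_preimage, T.apply_symm_apply]; exact ⟨hmem₀, hmem₂⟩⟩,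
      hΦ.comp T.contDiff.contDiffOn fun w hw => hw.1, fun w hw => ?_, fun w hw => ?_⟩
    · have h1 : HasFDerivAt Φ (fderiv ℝ Φ (T w)) (T w) :=
        ((hΦ.contDiffAt (hO₁.mem_nhds hw.1)).differentiableAt (by simp)).hasFDerivAt
      rw [(h1.comp w T.hasFDerivAt).fderiv]
      exact (hO₂ hw.2).comp T.injective
    · obtain ⟨h1, h2⟩ := hΓR _ hw.1.1 _ hw.1.2.2
      exact ⟨h1, (hrel _ hw.1.2.1).2.trans hR h2⟩

/-- Under Hörmander's condition, the points which are equivalent to `x` for an equivalence relation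
containing accessibility form a neighbourhood of `x`. -/
theorem HormanderCondition.eventually_rel (hH : HormanderCondition E) (hR : Equivalence R)
    (hRE : ∀ (σ : ℝ → M), IsHorizontalCurve E σ 1 → R (σ 0) (σ 1)) (x : M) :
    ∀ᶠ y in 𝓝 x, R x y := by
  have hx := mem_extChartAt_source (I := 𝓡 m) x
  have hz := (extChartAt (𝓡 m) x).map_source hx
  obtain ⟨Ψ, O, hO, ⟨w, hw⟩, hΨ, hinj, hrel⟩ :=
    hH.exists_immersion (c := x) hR hRE hz (le_refl m)
  -- a family of full dimension has open image
  have hsurj : Function.Surjective (fderiv ℝ Ψ w) :=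
    LinearMap.surjective_of_injective (f := (fderiv ℝ Ψ w).toLinearMap) (hinj w hw)
  have hst : HasStrictFDerivAt Ψ (fderiv ℝ Ψ w) w :=
    (hΨ.contDiffAt (hO.mem_nhds hw)).hasStrictFDerivAt (by simp)
  have hmap := hst.map_nhds_eq_of_surj (LinearMap.range_eq_top.2 hsurj)
  have hev : ∀ᶠ r in 𝓝 (Ψ w), IsLocallyRelated R x (extChartAt (𝓡 m) x x) r := by
    rw [← hmap, eventually_map]
    filter_upwards [hO.mem_nhds hw] with w' hw' using (hrel w' hw').2
  have h1 := (continuousAt_extChartAt (I := 𝓡 m) x).eventually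
    ((hrel w hw).2.eventually hR hev)
  filter_upwards [h1, (isOpen_extChartAt_source (I := 𝓡 m) x).mem_nhds hx] with y hy hys
  rwa [(extChartAt (𝓡 m) x).left_inv hx, (extChartAt (𝓡 m) x).left_inv hys] at hy

/-- A form of Chow's theorem: on a connected manifold with Hörmander's condition, an equivalence
relation containing accessibility has only one class, because its classes are open. -/
theorem HormanderCondition.rel_of_preconnectedSpace [PreconnectedSpace M]
    (hH : HormanderCondition E) (hR : Equivalence R)
    (hRE : ∀ (σ : ℝ → M), IsHorizontalCurve E σ 1 → R (σ 0) (σ 1)) (x y : M) : R x y :=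
  have : Std.Symm R := hR.stdSymm
  PreconnectedSpace.induction₂ R (fun x => hH.eventually_rel hR hRE x) hR.isTrans x y

end Accessibility

section HormanderFibres

variable {m n : ℕ} {M : Type u} {N : Type v}
  [TopologicalSpace M] [ChartedSpace (EuclideanSpace ℝ (Fin m)) M] [IsManifold (𝓡 m) ∞ M]
  [T2Space M]
  [TopologicalSpace N] [ChartedSpace (EuclideanSpace ℝ (Fin n)) N] [IsManifold (𝓡 n) ∞ N]
  [T2Space N] {p : C^∞⟮𝓡 n, N; 𝓡 m, M⟯} {B : C^∞⟮𝓡 n, N; ℝ⟯ →ₗ[ℝ] C^∞⟮𝓡 n, N; ℝ⟯}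
    {A : C^∞⟮𝓡 m, M; ℝ⟯ →ₗ[ℝ] C^∞⟮𝓡 m, M; ℝ⟯}

/-- Having diffeomorphic fibres is an equivalence relation, which contains accessibility by
holonomy. -/
theorem HormanderCondition.exists_isDiffeoBetween_fibres [PreconnectedSpace M]
    (hH : HormanderCondition (symbolImage A)) (hA : IsDiffusionOperator A)
    (hB : IsDiffusionOperator B) (hBA : IsOver p B A) {k : ℕ}
    (hk : ∀ x, Module.finrank ℝ (symbolImage A x) = k)
    (hcomplete : IsCompleteSemiConnection p (symbolImage A) (horizontalSpace p B)) (x y : M) :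
    ∃ f : (p ⁻¹' {x} : Set N) ≃ (p ⁻¹' {y} : Set N), IsDiffeoBetween n f := by
  refine hH.rel_of_preconnectedSpace (R := fun x y : M =>
    ∃ f : (p ⁻¹' {x} : Set N) ≃ (p ⁻¹' {y} : Set N), IsDiffeoBetween n f)
    ⟨fun x => ⟨_, IsDiffeoBetween.refl⟩, fun ⟨f, hf⟩ => ⟨f.symm, hf.symm⟩,
      fun ⟨f, hf⟩ ⟨g, hg⟩ => ⟨f.trans g, hf.trans hg⟩⟩ (fun σ hσ => ?_) x y
  obtain ⟨hol, -, h⟩ := exists_holonomy hA hB hBA hk hcomplete zero_le_one hσ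
  exact ⟨hol, h.isDiffeoBetween⟩

end HormanderFibres

/-! ### Critical values -/

section ScalarSard

variable {E : Type*} [NormedAddCommGroup E] [NormedSpace ℝ E]

/-- A bound for the derivative by a power of the distance to `x` integrates to a bound for the
increment by the next power. -/
theorem norm_sub_le_mul_pow_of_norm_fderiv_le {F : Type*} [NormedAddCommGroup F] [NormedSpace ℝ F]
    {g : E → F} (hg : Differentiable ℝ g) {C : ℝ} (hC : 0 ≤ C) {x y : E} {i : ℕ}
    (h : ∀ z ∈ segment ℝ x y, ‖fderiv ℝ g z‖ ≤ C * ‖z - x‖ ^ i) :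
    ‖g y - g x‖ ≤ C * ‖y - x‖ ^ (i + 1) := by
  have h1 : ∀ z ∈ segment ℝ x y, ‖fderiv ℝ g z‖ ≤ C * ‖y - x‖ ^ i := fun z hz => by
    refine (h z hz).trans ?_
    have := norm_sub_le_of_mem_segment hz
    gcongr
  have h2 := (convex_segment x y).norm_image_sub_le_of_norm_fderiv_le
    (fun z _ => hg z) h1 (left_mem_segment ℝ x y) (right_mem_segment ℝ x y)
  rwa [pow_succ, ← mul_assoc]

/-- Taylor's estimate at the points where the derivatives of orders `1, …, n` vanish. -/
theorem norm_sub_le_mul_pow_of_iteratedFDeriv_eq_zero [FiniteDimensional ℝ E] {f : E → ℝ}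
    (hf : ContDiff ℝ ∞ f) (n : ℕ) (x₀ : E) :
    ∃ C : ℝ, 0 ≤ C ∧ ∀ x ∈ Metric.closedBall x₀ 1, (∀ j ∈ Icc 1 n, iteratedFDeriv ℝ j f x = 0) →
      ∀ y ∈ Metric.closedBall x₀ 1, ‖f y - f x‖ ≤ C * ‖y - x‖ ^ (n + 1) := by
  have hlt : ∀ k : ℕ, ((k : ℕ∞ω)) < ∞ := fun k => by exact_mod_cast ENat.natCast_lt_top k
  obtain ⟨C, hC⟩ := (isCompact_closedBall x₀ (1 : ℝ)).exists_bound_of_continuousOn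
    (hf.continuous_iteratedFDeriv (m := n + 1) (by exact_mod_cast le_top)).continuousOn
  have hC0 : 0 ≤ C := (norm_nonneg _).trans (hC x₀ (Metric.mem_closedBall_self zero_le_one))
  refine ⟨C, hC0, fun x hx hflat => ?_⟩
  have key : ∀ i ≤ n, ∀ y ∈ Metric.closedBall x₀ 1,
      ‖iteratedFDeriv ℝ (n + 1 - i) f y‖ ≤ C * ‖y - x‖ ^ i := by
    intro i
    induction i with
    | zero => intro _ y hy; simpa using hC y hy
    | succ i ih =>
      intro hi y hy
      have e1 : n + 1 - i = (n + 1 - (i + 1)) + 1 := by omega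
      have h2 := norm_sub_le_mul_pow_of_norm_fderiv_le (x := x) (y := y) (i := i)
        (hf.differentiable_iteratedFDeriv (hlt (n + 1 - (i + 1)))) hC0 fun z hz => by
          rw [norm_fderiv_iteratedFDeriv, ← e1]
          exact ih (by omega) z ((convex_closedBall x₀ 1).segment_subset hx hy hz)
      rwa [hflat _ ⟨by omega, by omega⟩, sub_zero] at h2
  intro y hy
  refine norm_sub_le_mul_pow_of_norm_fderiv_le (hf.differentiable (by simp)) hC0 fun z hz => ?_
  have := key n le_rfl z ((convex_closedBall x₀ 1).segment_subset hx hy hz)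
  rw [Nat.add_sub_cancel_left, norm_iteratedFDeriv_one] at this
  exact this

/-- The image of the points where the derivatives up to the dimension of the space vanish is null,
because the function is Hölder continuous there with an exponent above the dimension. -/
theorem volume_image_flat_eq_zero [FiniteDimensional ℝ E] {f : E → ℝ} (hf : ContDiff ℝ ∞ f)
    {n : ℕ} (hn : Module.finrank ℝ E = n) :
    volume (f '' {x | ∀ j ∈ Icc 1 n, iteratedFDeriv ℝ j f x = 0}) = 0 := by
  set S := {x | ∀ j ∈ Icc 1 n, iteratedFDeriv ℝ j f x = 0} with hS
  have : ProperSpace E := FiniteDimensional.proper_real E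
  have h1 : dimH (f '' S) ≤ dimH S / ((n + 1 : NNReal) : ENNReal) := by
    refine dimH_image_le_of_locally_holder_on (by positivity) fun x₀ _ => ?_
    obtain ⟨C, hC, hfC⟩ := norm_sub_le_mul_pow_of_iteratedFDeriv_eq_zero hf n x₀
    refine ⟨C.toNNReal, S ∩ Metric.closedBall x₀ 1, inter_mem self_mem_nhdsWithin
      (mem_nhdsWithin_of_mem_nhds (Metric.closedBall_mem_nhds x₀ one_pos)), fun x hx y hy => ?_⟩
    have h2 := hfC y hy.2 hy.1 x hx.2
    have e1 : ((n + 1 : NNReal) : ℝ) = ((n + 1 : ℕ) : ℝ) := by push_cast; rfl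
    rw [e1, ENNReal.rpow_natCast, edist_nndist, edist_nndist, ← ENNReal.coe_pow, ← ENNReal.coe_mul,
      ENNReal.coe_le_coe, ← NNReal.coe_le_coe]
    push_cast
    rw [dist_eq_norm, dist_eq_norm, Real.coe_toNNReal C hC]
    exact h2
  have h2 : dimH S ≤ n := by
    rw [← hn, ← Real.dimH_univ_eq_finrank E]
    exact dimH_mono (subset_univ S)
  have h3 : dimH (f '' S) < ((1 : NNReal) : ENNReal) := by
    refine h1.trans_lt ?_
    rw [ENNReal.div_lt_iff (Or.inl (by positivity)) (Or.inl ENNReal.coe_ne_top)]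
    refine h2.trans_lt ?_
    have : (n : ENNReal) < ((n + 1 : NNReal) : ENNReal) := by
      rw [show (n : ENNReal) = ((n : NNReal) : ENNReal) by simp, ENNReal.coe_lt_coe]
      exact lt_add_one _
    simpa using this
  have h4 := hausdorffMeasure_of_dimH_lt h3
  rwa [NNReal.coe_one, hausdorffMeasure_real] at h4

/-- A version of the Sard theorem for functions on an open set, from the one for functions defined
everywhere. -/
theorem volume_image_criticalPoints_of_forall [FiniteDimensional ℝ E]
    (h : ∀ f : E → ℝ, ContDiff ℝ ∞ f → volume (f '' {x | fderiv ℝ f x = 0}) = 0) {f : E → ℝ}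
    {U : Set E} (hU : IsOpen U) (hf : ContDiffOn ℝ ∞ f U) :
    volume (f '' {x ∈ U | fderiv ℝ f x = 0}) = 0 := by
  have : ProperSpace E := FiniteDimensional.proper_real E
  choose! g hg r hr hrU hgf using fun x (hx : x ∈ U) =>
    hf.exists_contDiff_eqOn_ball hU hx
  obtain ⟨t, htU, htc, ht⟩ := TopologicalSpace.countable_cover_nhdsWithin (s := U)
    (f := fun x => Metric.ball x (r x)) fun x hx =>
      mem_nhdsWithin_of_mem_nhds (Metric.ball_mem_nhds x (hr x hx))
  refine measure_mono_null (t := ⋃ x ∈ t, g x '' {y | fderiv ℝ (g x) y = 0}) ?_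
    ((measure_biUnion_null_iff htc).2 fun x hx => h _ (hg x (htU hx)))
  rintro _ ⟨y, ⟨hyU, hy⟩, rfl⟩
  obtain ⟨x, hx, hyx⟩ := mem_iUnion₂.1 (ht hyU)
  have hev : g x =ᶠ[𝓝 y] f := (hgf x (htU hx)).eventuallyEq_of_mem (Metric.isOpen_ball.mem_nhds hyx)
  exact mem_iUnion₂.2 ⟨x, hx, y, by rw [mem_ofPred_eq, hev.fderiv_eq, hy], hev.eq_of_nhds⟩

/-- The critical values of a smooth function form a null set. At a critical point at which not all
derivatives vanish, some partial derivative of `f` vanishes but has nonzero differential, and the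
critical points of `f` are locally critical for the restriction of `f` to a hypersurface. -/
theorem volume_image_criticalPoints {n : ℕ} {f : EuclideanSpace ℝ (Fin n) → ℝ}
    {U : Set (EuclideanSpace ℝ (Fin n))} (hU : IsOpen U) (hf : ContDiffOn ℝ ∞ f U) :
    volume (f '' {x ∈ U | fderiv ℝ f x = 0}) = 0 := by
  induction n with
  | zero =>
    refine volume_image_criticalPoints_of_forall (fun f hf => ?_) hU hf
    refine measure_mono_null (image_mono ?_) (volume_image_flat_eq_zero hf (n := 0) (by simp))
    intro x _ j hj
    exact absurd (hj.1.trans hj.2) (by norm_num)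
  | succ n ih =>
    refine volume_image_criticalPoints_of_forall (fun f hf => ?_) hU hf
    -- the critical points at which the derivative of order `j` vanishes but the next one does not
    let S : ℕ → Set (EuclideanSpace ℝ (Fin (n + 1))) := fun j =>
      {x | fderiv ℝ f x = 0 ∧ iteratedFDeriv ℝ j f x = 0 ∧ iteratedFDeriv ℝ (j + 1) f x ≠ 0}
    have hcover : {x | fderiv ℝ f x = 0} ⊆
        {x | ∀ j ∈ Icc 1 (n + 1), iteratedFDeriv ℝ j f x = 0} ∪ ⋃ j, S j := by
      intro x hx
      by_contra hcon
      simp only [mem_union, mem_iUnion, not_or, not_exists, S] at hcon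
      obtain ⟨h1, h2⟩ := hcon
      refine h1 fun j hj => ?_
      have key : ∀ j, iteratedFDeriv ℝ (j + 1) f x = 0 := by
        intro j
        induction j with
        | zero =>
          rw [← norm_eq_zero, norm_iteratedFDeriv_one, norm_eq_zero]
          exact hx
        | succ j ihj =>
          by_contra h3
          exact h2 (j + 1) ⟨hx, ihj, h3⟩
      obtain ⟨i, rfl⟩ : ∃ i, j = i + 1 := ⟨j - 1, by have := hj.1; omega⟩
      exact key i
    have hSnull : ∀ j, volume (f '' S j) = 0 := by
      intro j
      have hloc : ∀ x ∈ S j, ∃ W ∈ 𝓝[S j] x, volume (f '' (S j ∩ W)) = 0 := by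
        rintro x ⟨hx1, hx2, hx3⟩
        have hlt : (j : ℕ∞ω) < ∞ := by exact_mod_cast ENat.natCast_lt_top j
        have hD : ContDiff ℝ ∞ (iteratedFDeriv ℝ j f) := by
          refine hf.iteratedFDeriv_right (m := ∞) ?_
          exact_mod_cast le_top
        obtain ⟨v, hv⟩ : ∃ v, iteratedFDeriv ℝ (j + 1) f x v ≠ 0 := by
          by_contra! hcon
          exact hx3 (by ext v; exact hcon v)
        rw [iteratedFDeriv_succ_apply_left] at hv
        -- `h` is a partial derivative of order `j` of `f`
        let ev := ContinuousMultilinearMap.apply ℝ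
          (fun _ : Fin j => EuclideanSpace ℝ (Fin (n + 1))) ℝ (Fin.tail v)
        let h : EuclideanSpace ℝ (Fin (n + 1)) → ℝ := fun y => ev (iteratedFDeriv ℝ j f y)
        have hh : ContDiff ℝ ∞ h := ev.contDiff.comp hD
        have hhd : fderiv ℝ h x (v 0) ≠ 0 := by
          have h1 := (ev.hasFDerivAt (x := iteratedFDeriv ℝ j f x)).comp x
            ((hD.differentiable (by simp)) x).hasFDerivAt
          rw [show h = ev ∘ iteratedFDeriv ℝ j f from rfl, h1.fderiv]
          exact hv
        have hs : Function.Surjective (fderiv ℝ h x) := fun a =>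
          ⟨(a / fderiv ℝ h x (v 0)) • v 0, by
            rw [map_smul, smul_eq_mul, div_mul_cancel₀ _ hhd]⟩
        obtain ⟨T, e, hxe, -, he, he', hT⟩ := hh.contDiffOn.exists_submersion_coordinates
          (k := n) isOpen_univ (mem_univ x) hs (by simp [add_comm])
        -- the hypersurface `h = 0`
        let ι : EuclideanSpace ℝ (Fin n) → EuclideanSpace ℝ (Fin (n + 1)) := fun w => T.symm (0, w)
        have hι : ContDiff ℝ ∞ ι := T.symm.contDiff.comp (contDiff_const.prodMk contDiff_id)
        have hO : IsOpen (ι ⁻¹' e.target) := e.open_target.preimage hι.continuous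
        have hei : ContDiffOn ℝ ∞ (fun w => e.symm (ι w)) (ι ⁻¹' e.target) :=
          he'.comp hι.contDiffOn fun w hw => hw
        have hnull := ih hO (hf.comp_contDiffOn hei)
        refine ⟨e.source, mem_nhdsWithin_of_mem_nhds (e.open_source.mem_nhds hxe),
          measure_mono_null ?_ hnull⟩
        rintro _ ⟨y, ⟨hy, hye⟩, rfl⟩
        have hy0 : (T (e y)).1 = 0 := by
          rw [hT]
          change ev (iteratedFDeriv ℝ j f y) = 0
          rw [hy.2.1, map_zero]
        have hy1 : ι (T (e y)).2 = e y := by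
          change T.symm (0, (T (e y)).2) = e y
          rw [← hy0]
          exact T.symm_apply_apply _
        have hy2 : (T (e y)).2 ∈ ι ⁻¹' e.target := by
          rw [mem_preimage, hy1]; exact e.map_source hye
        have hy3 : e.symm (ι (T (e y)).2) = y := by rw [hy1, e.left_inv hye]
        refine ⟨(T (e y)).2, ⟨hy2, ?_⟩, congrArg f hy3⟩
        -- `df` vanishes at `y`, and so does the differential of the restriction of `f`
        have hd1 : DifferentiableAt ℝ (fun w => e.symm (ι w)) (T (e y)).2 :=
          ((hei.contDiffAt (hO.mem_nhds hy2)).differentiableAt (by simp))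
        have hd2 : HasFDerivAt f (0 : EuclideanSpace ℝ (Fin (n + 1)) →L[ℝ] ℝ)
            (e.symm (ι (T (e y)).2)) := by
          rw [hy3, ← hy.1]
          exact (hf.differentiable (by simp) y).hasFDerivAt
        have := (hd2.comp (f := fun w => e.symm (ι w)) _ hd1.hasFDerivAt).fderiv
        rw [ContinuousLinearMap.zero_comp] at this
        exact this
      choose! W hW hWnull using hloc
      obtain ⟨t, htS, htc, ht⟩ := TopologicalSpace.countable_cover_nhdsWithin hW
      refine measure_mono_null (t := ⋃ x ∈ t, f '' (S j ∩ W x)) ?_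
        ((measure_biUnion_null_iff htc).2 fun x hx => hWnull x (htS hx))
      rintro _ ⟨y, hy, rfl⟩
      obtain ⟨x, hx, hyx⟩ := mem_iUnion₂.1 (ht hy)
      exact mem_iUnion₂.2 ⟨x, hx, y, ⟨hy, hyx⟩, rfl⟩
    refine measure_mono_null (image_mono hcover) ?_
    rw [image_union, image_iUnion]
    exact measure_union_null (volume_image_flat_eq_zero hf (by simp))
      (measure_iUnion_null hSnull)

end ScalarSard

/-! ### Existence of a regular value -/

section Sard

/-- Near a critical point of rank `s`, the critical points of rank at most `s` are in a compact set
whose image has empty interior. In coordinates in which the components of `f` along the range of its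
differential are linear, the differential of the remaining components in the remaining directions
vanishes at these points; so an open set in the image would give an interval of critical values
of a function. -/
theorem exists_isCompact_interior_image_eq_empty {n : ℕ} {F : Type*} [NormedAddCommGroup F]
    [NormedSpace ℝ F] [FiniteDimensional ℝ F] {f : EuclideanSpace ℝ (Fin n) → F}
    {U : Set (EuclideanSpace ℝ (Fin n))} (hU : IsOpen U) (hf : ContDiffOn ℝ ∞ f U)
    {y : EuclideanSpace ℝ (Fin n)} (hy : y ∈ U) (hs : ¬ Function.Surjective (fderiv ℝ f y)) :
    ∃ K ∈ 𝓝 y, K ⊆ U ∧ ∃ Z ⊆ K, IsCompact Z ∧ interior (f '' Z) = ∅ ∧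
      ∀ w ∈ K, Module.finrank ℝ (LinearMap.range (fderiv ℝ f w).toLinearMap) ≤
        Module.finrank ℝ (LinearMap.range (fderiv ℝ f y).toLinearMap) → w ∈ Z := by
  set R := LinearMap.range (fderiv ℝ f y).toLinearMap with hR
  obtain ⟨q, hq⟩ := R.exists_isCompl
  let π : F →L[ℝ] R := LinearMap.toContinuousLinearMap (R.projectionOnto q hq)
  have hRtop : R < ⊤ := lt_top_iff_ne_top.2 fun h => hs (LinearMap.range_eq_top.1 h)
  obtain ⟨ℓ', hℓ0, hℓR⟩ := R.exists_le_ker_of_lt_top hRtop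
  let ℓ : F →L[ℝ] ℝ := LinearMap.toContinuousLinearMap ℓ'
  -- a direction in the kernel of the projection on which `ℓ` does not vanish
  obtain ⟨ζ, hζq, hζ⟩ : ∃ ζ ∈ q, ℓ ζ ≠ 0 := by
    by_contra! hcon
    refine hℓ0 (LinearMap.ker_eq_top.1 (top_le_iff.1 ?_))
    rw [← hq.sup_eq_top]
    exact sup_le hℓR fun v hv => hcon v hv
  have hπζ : π ζ = 0 := (Submodule.projectionOnto_apply_eq_zero_iff hq).2 hζq
  have hπf : ContDiffOn ℝ ∞ (fun w => π (f w)) U := π.contDiff.comp_contDiffOn hf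
  have hfd : ∀ w ∈ U, HasFDerivAt f (fderiv ℝ f w) w := fun w hw =>
    ((hf.contDiffAt (hU.mem_nhds hw)).differentiableAt (by simp)).hasFDerivAt
  have hπd : ∀ w ∈ U, fderiv ℝ (fun w => π (f w)) w = π ∘L fderiv ℝ f w := fun w hw =>
    (π.hasFDerivAt.comp w (hfd w hw)).fderiv
  have hπs : Function.Surjective (fderiv ℝ (fun w => π (f w)) y) := by
    rw [hπd y hy]
    rintro ⟨r, v, rfl⟩
    exact ⟨v, (Submodule.projectionOnto_apply_left hq ⟨fderiv ℝ f y v, v, rfl⟩)⟩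
  have hle : Module.finrank ℝ R ≤ n := by
    have := LinearMap.finrank_range_le (fderiv ℝ f y).toLinearMap
    rwa [finrank_euclideanSpace_fin] at this
  obtain ⟨T, e, hye, heU, he, he', hT⟩ := hπf.exists_submersion_coordinates
    (k := n - Module.finrank ℝ R) hU hy hπs (by rw [finrank_euclideanSpace_fin]; omega)
  let ψ : R × EuclideanSpace ℝ (Fin (n - Module.finrank ℝ R)) → EuclideanSpace ℝ (Fin n) :=
    fun x => e.symm (T.symm x)
  have hO : IsOpen (T.symm ⁻¹' e.target) := e.open_target.preimage T.symm.continuous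
  have hψ : ContDiffOn ℝ ∞ ψ (T.symm ⁻¹' e.target) :=
    he'.comp T.symm.contDiff.contDiffOn fun w hw => hw
  have hψt : ∀ w ∈ e.source, T (e w) ∈ T.symm ⁻¹' e.target ∧ ψ (T (e w)) = w := fun w hw => by
    have h1 : T.symm (T (e w)) = e w := T.symm_apply_apply _
    refine ⟨by rw [mem_preimage, h1]; exact e.map_source hw, ?_⟩
    change e.symm (T.symm (T (e w))) = w
    rw [h1, e.left_inv hw]
  have hψd : ∀ x ∈ T.symm ⁻¹' e.target, HasFDerivAt ψ (fderiv ℝ ψ x) x := fun x hx =>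
    ((hψ.contDiffAt (hO.mem_nhds hx)).differentiableAt (by simp)).hasFDerivAt
  have hψπ : ∀ x ∈ T.symm ⁻¹' e.target, π (f (ψ x)) = x.1 := fun x hx => by
    rw [← hT, e.right_inv hx, T.apply_symm_apply]
  have hψU : ∀ x ∈ T.symm ⁻¹' e.target, ψ x ∈ U := fun x hx => heU (e.map_target hx)
  -- the directions in which the distinguished components of `f` are constant
  let b : EuclideanSpace ℝ (Fin (n - Module.finrank ℝ R)) → EuclideanSpace ℝ (Fin n) →
    EuclideanSpace ℝ (Fin n) := fun a w => fderiv ℝ ψ (T (e w)) (0, a)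
  have hbπ : ∀ a, ∀ w ∈ e.source, π (fderiv ℝ f w (b a w)) = 0 := by
    intro a w hw
    obtain ⟨h1, h2⟩ := hψt w hw
    have h3 : HasFDerivAt (fun x => π (f (ψ x))) (π ∘L (fderiv ℝ f w ∘L fderiv ℝ ψ (T (e w))))
        (T (e w)) := by
      refine π.hasFDerivAt.comp _ (HasFDerivAt.comp (g := f) _ ?_ (hψd _ h1))
      rw [h2]; exact hfd w (heU hw)
    have h4 : (fun x => π (f (ψ x))) =ᶠ[𝓝 (T (e w))] Prod.fst := by
      filter_upwards [hO.mem_nhds h1] with x hx using hψπ x hx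
    have h5 := (h3.congr_of_eventuallyEq h4.symm).unique hasFDerivAt_fst
    have h6 := congrArg (fun A : R × EuclideanSpace ℝ (Fin (n - Module.finrank ℝ R)) →L[ℝ] R =>
      A (0, a)) h5
    exact h6
  have hbc : ∀ a, ContinuousOn (fun w => ℓ (fderiv ℝ f w (b a w))) e.source := by
    intro a
    have h1 : ContinuousOn (fun w => fderiv ℝ ψ (T (e w))) e.source :=
      (hψ.fderiv_of_isOpen (m := ∞) hO (by simp)).continuousOn.comp
        (T.continuous.comp_continuousOn he.continuousOn) fun w hw => (hψt w hw).1
    exact ℓ.continuous.comp_continuousOn ((((hf.fderiv_of_isOpen (m := ∞) hU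
      (by simp)).continuousOn.mono heU)).clm_apply (h1.clm_apply continuousOn_const))
  obtain ⟨ρ, hρ, hρe⟩ := Metric.nhds_basis_closedBall.mem_iff.1 (e.open_source.mem_nhds hye)
  have hdet : ∀ w ∈ Metric.closedBall y ρ,
      Module.finrank ℝ (LinearMap.range (fderiv ℝ f w).toLinearMap) ≤ Module.finrank ℝ R →
      Function.Surjective (fderiv ℝ (fun w => π (f w)) w) →
      ∀ a, ℓ (fderiv ℝ f w (b a w)) = 0 := by
    intro w hw hrank hsurj a
    rw [hπd w (heU (hρe hw))] at hsurj
    let π' : LinearMap.range (fderiv ℝ f w).toLinearMap →ₗ[ℝ] R :=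
      π.toLinearMap.domRestrict _
    have h1 : Function.Surjective π' := fun r => by
      obtain ⟨v, hv⟩ := hsurj r
      exact ⟨⟨fderiv ℝ f w v, v, rfl⟩, hv⟩
    have h2 : Function.Injective π' :=
      (LinearMap.injective_iff_surjective_of_finrank_eq_finrank (le_antisymm hrank
        (LinearMap.finrank_le_finrank_of_surjective h1))).2 h1
    have h3 : π' ⟨fderiv ℝ f w (b a w), _, rfl⟩ = π' 0 := by
      rw [map_zero]; exact hbπ a w (hρe hw)
    -- `π` is injective on the range of `df w`, and vanishes on `df w (b a w)`
    have h4 := congrArg Subtype.val (h2 h3)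
    have h5 : fderiv ℝ f w (b a w) = 0 := h4
    rw [h5, map_zero]
  have hsurjK : ∀ w ∈ e.source, Function.Surjective (fderiv ℝ (fun w => π (f w)) w) := by
    intro w hw r
    obtain ⟨h1, h2⟩ := hψt w hw
    rw [hπd w (heU hw)]
    refine ⟨fderiv ℝ ψ (T (e w)) (r, 0), ?_⟩
    have h3 : HasFDerivAt (fun x => π (f (ψ x))) (π ∘L (fderiv ℝ f w ∘L fderiv ℝ ψ (T (e w))))
        (T (e w)) := by
      refine π.hasFDerivAt.comp _ (HasFDerivAt.comp (g := f) _ ?_ (hψd _ h1))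
      rw [h2]; exact hfd w (heU hw)
    have h4 : (fun x => π (f (ψ x))) =ᶠ[𝓝 (T (e w))] Prod.fst := by
      filter_upwards [hO.mem_nhds h1] with x hx using hψπ x hx
    have h5 := (h3.congr_of_eventuallyEq h4.symm).unique hasFDerivAt_fst
    exact congrArg (fun A : R × EuclideanSpace ℝ (Fin (n - Module.finrank ℝ R)) →L[ℝ] R =>
      A (r, 0)) h5
  -- `Z` is the set where `ℓ ∘ df` vanishes in all these directions; it contains the points of small
  -- rank, as there `π` is injective on the range of `df`
  let Z : Set (EuclideanSpace ℝ (Fin n)) :=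
    ⋂ a, (Metric.closedBall y ρ ∩ (fun w => ℓ (fderiv ℝ f w (b a w))) ⁻¹' {0})
  have hZmem : ∀ w, w ∈ Z ↔ w ∈ Metric.closedBall y ρ ∧ ∀ a, ℓ (fderiv ℝ f w (b a w)) = 0 := by
    intro w
    simp only [Z, mem_iInter, mem_inter_iff, mem_preimage, mem_singleton_iff]
    exact ⟨fun h => ⟨(h 0).1, fun a => (h a).2⟩, fun h a => ⟨h.1, h.2 a⟩⟩
  have hZcl : IsClosed Z := isClosed_iInter fun a =>
    ((hbc a).mono hρe).preimage_isClosed_of_isClosed Metric.isClosed_closedBall isClosed_singleton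
  refine ⟨Metric.closedBall y ρ, Metric.closedBall_mem_nhds y hρ, hρe.trans heU, Z,
    fun w hw => ((hZmem w).1 hw).1,
    (isCompact_closedBall y ρ).of_isClosed_subset hZcl fun w hw => ((hZmem w).1 hw).1, ?_,
    fun w hw hrank => (hZmem w).2 ⟨hw, hdet w hw hrank (hsurjK w (hρe hw))⟩⟩
  by_contra hne
  obtain ⟨o, ho⟩ := nonempty_iff_ne_empty.2 hne
  -- the function `ℓ ∘ f` on the slice `π ∘ f = π o`: the points of `Z` in this slice are critical,
  -- and the line through the interior point `o` in the direction `ζ` lies over this slice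
  let j : EuclideanSpace ℝ (Fin (n - Module.finrank ℝ R)) →
    R × EuclideanSpace ℝ (Fin (n - Module.finrank ℝ R)) := fun v => (π o, v)
  have hj : ContDiff ℝ ∞ j := contDiff_const.prodMk contDiff_id
  have hOj : IsOpen (j ⁻¹' (T.symm ⁻¹' e.target)) := hO.preimage hj.continuous
  have hg : ContDiffOn ℝ ∞ (fun v => ℓ (f (ψ (j v)))) (j ⁻¹' (T.symm ⁻¹' e.target)) :=
    ℓ.contDiff.comp_contDiffOn (hf.comp (hψ.comp hj.contDiffOn fun v hv => hv)
      fun v hv => hψU _ hv)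
  have hnull := volume_image_criticalPoints hOj hg
  have hcont : ContinuousAt (fun t : ℝ => o + ((t - ℓ o) / ℓ ζ) • ζ) (ℓ o) := by fun_prop
  have hmem : ∀ᶠ t in 𝓝 (ℓ o), o + ((t - ℓ o) / ℓ ζ) • ζ ∈ interior (f '' Z) :=
    hcont.eventually (isOpen_interior.mem_nhds (by simpa using ho))
  have hsub : ∀ᶠ t in 𝓝 (ℓ o), t ∈ (fun v => ℓ (f (ψ (j v)))) ''
      {v ∈ j ⁻¹' (T.symm ⁻¹' e.target) | fderiv ℝ (fun v => ℓ (f (ψ (j v)))) v = 0} := by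
    filter_upwards [hmem] with t ht
    obtain ⟨w, hwZ, hw⟩ := interior_subset ht
    obtain ⟨hwK, hwb⟩ := (hZmem w).1 hwZ
    obtain ⟨h1, h2⟩ := hψt w (hρe hwK)
    have h3 : j (T (e w)).2 = T (e w) := by
      refine Prod.ext ?_ rfl
      change π o = (T (e w)).1
      rw [hT, hw, map_add, map_smul, hπζ, smul_zero, add_zero]
    refine ⟨(T (e w)).2, ⟨by rw [mem_preimage, h3]; exact h1, ?_⟩, ?_⟩
    · have h4 : HasFDerivAt j (ContinuousLinearMap.inr ℝ R _) (T (e w)).2 :=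
        hasFDerivAt_prodMk_right _ _
      have h5 : HasFDerivAt ψ (fderiv ℝ ψ (T (e w))) (j (T (e w)).2) := by
        rw [h3]; exact hψd _ h1
      have h6 : HasFDerivAt f (fderiv ℝ f w) (ψ (j (T (e w)).2)) := by
        rw [h3, h2]; exact hfd w (heU (hρe hwK))
      have h7 := ℓ.hasFDerivAt.comp _ (h6.comp (f := fun v => ψ (j v)) _
        (h5.comp (f := j) _ h4))
      refine h7.fderiv.trans ?_
      ext1 a
      exact hwb a
    · simp only [h3, h2, hw, map_add, map_smul, smul_eq_mul]
      rw [div_mul_cancel₀ _ hζ]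
      ring
  obtain ⟨ε, hε, hball⟩ := Metric.eventually_nhds_iff_ball.1 hsub
  have := measure_mono_null (fun t ht => hball t ht) hnull
  rw [Real.volume_ball, ENNReal.ofReal_eq_zero] at this
  linarith

variable {m n : ℕ} {M N : Type*}
  [TopologicalSpace M] [ChartedSpace (EuclideanSpace ℝ (Fin m)) M] [IsManifold (𝓡 m) ∞ M]
  [TopologicalSpace N] [ChartedSpace (EuclideanSpace ℝ (Fin n)) N] [IsManifold (𝓡 n) ∞ N]

theorem finrank_range_fderiv_chartRep {p : N → M} (hp : ContMDiff (𝓡 n) (𝓡 m) ∞ p) {c : N}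
    {c' : M} {u : N} (hu : u ∈ (extChartAt (𝓡 n) c).source)
    (hpu : p u ∈ (extChartAt (𝓡 m) c').source) :
    Module.finrank ℝ (LinearMap.range
        (fderiv ℝ (chartRep m n p c c') (extChartAt (𝓡 n) c u)).toLinearMap) =
      Module.finrank ℝ (LinearMap.range (mfderiv (𝓡 n) (𝓡 m) p u).toLinearMap) := by
  obtain ⟨D, hD⟩ := isInvertible_chartDeriv hpu
  obtain ⟨D', hD'⟩ := isInvertible_chartDeriv hu
  have h1 := fun v => fderiv_chartRep_comp_chartDeriv hp hu hpu v
  rw [← hD, ← hD'] at h1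
  have h2 : LinearMap.range
        (fderiv ℝ (chartRep m n p c c') (extChartAt (𝓡 n) c u)).toLinearMap =
      (LinearMap.range (mfderiv (𝓡 n) (𝓡 m) p u).toLinearMap).map D.toLinearEquiv.toLinearMap := by
    ext v
    constructor
    · rintro ⟨w, rfl⟩
      refine ⟨_, ⟨D'.symm w, rfl⟩, ?_⟩
      refine (h1 (D'.symm w)).symm.trans ?_
      exact congrArg _ (D'.apply_symm_apply w)
    · rintro ⟨_, ⟨w, rfl⟩, rfl⟩
      exact ⟨D' w, h1 w⟩
  rw [h2]
  exact LinearEquiv.finrank_map_eq D.toLinearEquiv _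

/-- A consequence of Sard's theorem: a smooth map has a regular value. The critical points of a
given rank are covered by countably many sets whose images lie in closed sets without interior, and by
Baire's theorem these do not exhaust the manifold. -/
theorem exists_isRegularValue [Nonempty M] [T2Space M] [SecondCountableTopology N] {p : N → M}
    (hp : ContMDiff (𝓡 n) (𝓡 m) ∞ p) : ∃ x, IsRegularValue m n p x := by
  by_contra! hcon
  -- the critical points of rank `s`
  let A : ℕ → Set N := fun s =>
    {u | Module.finrank ℝ (LinearMap.range (mfderiv (𝓡 n) (𝓡 m) p u).toLinearMap) = s ∧
      ¬ Function.Surjective (mfderiv (𝓡 n) (𝓡 m) p u)}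
  have hloc : ∀ u : N, ¬ Function.Surjective (mfderiv (𝓡 n) (𝓡 m) p u) →
      ∃ W ∈ 𝓝 u, ∃ Y : Set M, IsClosed Y ∧ interior Y = ∅ ∧ ∀ w ∈ W,
        Module.finrank ℝ (LinearMap.range (mfderiv (𝓡 n) (𝓡 m) p w).toLinearMap) =
        Module.finrank ℝ (LinearMap.range (mfderiv (𝓡 n) (𝓡 m) p u).toLinearMap) → p w ∈ Y := by
    intro u hnu
    have hu := mem_extChartAt_source (I := 𝓡 n) u
    have hpu := mem_extChartAt_source (I := 𝓡 m) (p u)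
    have hf := contDiffOn_chartRep hp u (p u)
    have hdom := isOpen_chartRepDomain (m := m) (n := n) hp.continuous u (p u)
    obtain ⟨K, hK, hKU, Z, hZK, hZ, hZint, hZmem⟩ :=
      exists_isCompact_interior_image_eq_empty hdom hf (extChartAt_mem_chartRepDomain hu hpu)
        (by rwa [surjective_fderiv_chartRep hp hu hpu])
    have hPt : chartRep m n p u (p u) '' Z ⊆ (extChartAt (𝓡 m) (p u)).target := by
      rintro _ ⟨w, hw, rfl⟩
      exact (extChartAt (𝓡 m) (p u)).map_source (hKU (hZK hw)).2
    refine ⟨(extChartAt (𝓡 n) u).source ∩ extChartAt (𝓡 n) u ⁻¹' K,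
      inter_mem ((isOpen_extChartAt_source u).mem_nhds hu)
        ((continuousAt_extChartAt u).preimage_mem_nhds hK),
      (extChartAt (𝓡 m) (p u)).symm '' (chartRep m n p u (p u) '' Z), ?_, ?_, ?_⟩
    · exact ((hZ.image_of_continuousOn (hf.continuousOn.mono (hZK.trans hKU))).image_of_continuousOn
        ((continuousOn_extChartAt_symm (p u)).mono hPt)).isClosed
    · by_contra hne
      obtain ⟨o, ho⟩ := nonempty_iff_ne_empty.2 hne
      obtain ⟨z, hz, hzo⟩ := interior_subset ho
      have hzt := hPt hz
      have h1 : (extChartAt (𝓡 m) (p u)).symm ⁻¹' interior ((extChartAt (𝓡 m) (p u)).symm ''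
          (chartRep m n p u (p u) '' Z)) ∩ (extChartAt (𝓡 m) (p u)).target ∈ 𝓝 z := by
        refine inter_mem ?_ ((isOpen_extChartAt_target (p u)).mem_nhds hzt)
        refine ((continuousOn_extChartAt_symm (p u)).continuousAt
          ((isOpen_extChartAt_target (p u)).mem_nhds hzt)).preimage_mem_nhds ?_
        rw [hzo]
        exact isOpen_interior.mem_nhds ho
      have h2 : z ∈ interior (chartRep m n p u (p u) '' Z) := by
        refine mem_interior_iff_mem_nhds.2 (mem_of_superset h1 ?_)
        rintro z' ⟨hz1, hz2⟩
        obtain ⟨z'', hz3, hz4⟩ := interior_subset hz1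
        rwa [← (extChartAt (𝓡 m) (p u)).symm.injOn (hPt hz3) hz2 hz4]
      rw [hZint] at h2
      exact h2
    · rintro w ⟨hws, hwK⟩ hrank
      have hpw : p w ∈ (extChartAt (𝓡 m) (p u)).source := by
        have := (hKU hwK).2
        rwa [mem_preimage, mem_preimage, (extChartAt (𝓡 n) u).left_inv hws] at this
      have h1 := hZmem _ hwK (by
        rw [finrank_range_fderiv_chartRep hp hws hpw, finrank_range_fderiv_chartRep hp hu hpu,
          hrank])
      exact ⟨_, ⟨_, h1, rfl⟩, by
        rw [chartRep_extChartAt p hws, (extChartAt (𝓡 m) (p u)).left_inv hpw]⟩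
  choose! W hW Y hYc hYi hYmem using hloc
  have hcov := fun s => TopologicalSpace.countable_cover_nhdsWithin (s := A s) (f := W)
    fun u hu => mem_nhdsWithin_of_mem_nhds (hW u hu.2)
  choose t htA htc ht using hcov
  have hlc : LocallyCompactSpace M :=
    ChartedSpace.locallyCompactSpace (EuclideanSpace ℝ (Fin m)) M
  have hun : (⋃ s, ⋃ u ∈ t s, Y u) = univ := by
    refine eq_univ_of_forall fun x => ?_
    have hx := hcon x
    rw [IsRegularValue] at hx
    push Not at hx
    obtain ⟨w, rfl, hw⟩ := hx
    have hwA : w ∈ A _ := ⟨rfl, hw⟩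
    obtain ⟨u, hut, hwu⟩ := mem_iUnion₂.1 (ht _ hwA)
    exact mem_iUnion.2 ⟨_, mem_iUnion₂.2 ⟨u, hut,
      hYmem u (htA _ hut).2 w hwu (htA _ hut).1.symm⟩⟩
  have hbi : (⋃ i ∈ ⋃ s, t s, Y i) = univ := by
    rw [← hun, biUnion_iUnion]
  have hct : Countable (⋃ s, t s) := (countable_iUnion htc).to_subtype
  have hmem : ∀ i : ⋃ s, t s, ¬ Function.Surjective (mfderiv (𝓡 n) (𝓡 m) p i) := fun i => by
    obtain ⟨s, hs⟩ := mem_iUnion.1 i.2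
    exact (htA s hs).2
  obtain ⟨i, hint⟩ := nonempty_interior_of_iUnion_of_closed (f := fun i : ⋃ s, t s => Y i)
    (fun i => hYc i (hmem i)) (by rw [← hbi, iUnion_coe_set])
  rw [hYi i (hmem i)] at hint
  exact not_nonempty_empty hint

end Sard

/-! ### Proper maps with dense reachable sets -/

/-- Surjectivity of a continuous family of linear maps is an open condition. -/
theorem eventually_surjective {X E F : Type*} [TopologicalSpace X]
    [NormedAddCommGroup E] [NormedSpace ℝ E] [FiniteDimensional ℝ E]
    [NormedAddCommGroup F] [NormedSpace ℝ F] [FiniteDimensional ℝ F]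
    {S : X → E →L[ℝ] F} {x : X} (hS : ContinuousAt S x) (hx : Function.Surjective (S x)) :
    ∀ᶠ y in 𝓝 x, Function.Surjective (S y) := by
  obtain ⟨Q', hQ'⟩ := LinearMap.exists_rightInverse_of_surjective (S x).toLinearMap
    (LinearMap.range_eq_top.2 hx)
  let Q : F →L[ℝ] E := LinearMap.toContinuousLinearMap Q'
  have hc : ContinuousAt (fun y => S y ∘L Q) x := hS.clm_comp continuousAt_const
  have h1 : S x ∘L Q = 1 := by
    ext1 g
    exact congrArg (fun B : F →ₗ[ℝ] F => B g) hQ'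
  have hU : {B : F →L[ℝ] F | IsUnit B} ∈ 𝓝 (S x ∘L Q) :=
    (Units.isOpen (R := F →L[ℝ] F)).mem_nhds (by rw [h1]; exact isUnit_one)
  filter_upwards [hc.preimage_mem_nhds hU] with y hy v
  obtain ⟨B, hB⟩ := hy
  refine ⟨Q (B.inv v), ?_⟩
  have := congrArg (fun A : F →L[ℝ] F => A v) B.mul_inv
  rw [hB] at this
  exact this

section RegularValues

variable {m n : ℕ} {M : Type u} {N : Type v}
  [TopologicalSpace M] [ChartedSpace (EuclideanSpace ℝ (Fin m)) M]
  [TopologicalSpace N] [ChartedSpace (EuclideanSpace ℝ (Fin n)) N]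
  [IsManifold (𝓡 m) ∞ M] [IsManifold (𝓡 n) ∞ N] {p : N → M}

theorem isOpen_setOf_surjective_mfderiv (hp : ContMDiff (𝓡 n) (𝓡 m) ∞ p) :
    IsOpen {u : N | Function.Surjective (mfderiv (𝓡 n) (𝓡 m) p u)} := by
  rw [isOpen_iff_mem_nhds]
  intro u hu
  have hu0 := mem_extChartAt_source (I := 𝓡 n) u
  have hpu := mem_extChartAt_source (I := 𝓡 m) (p u)
  have hD := extChartAt_mem_chartRepDomain (f := p) hu0 hpu
  have h1 : ContinuousAt (fderiv ℝ (chartRep m n p u (p u))) (extChartAt (𝓡 n) u u) :=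
    (((contDiffOn_chartRep hp u (p u)).fderiv_of_isOpen (m := ∞)
      (isOpen_chartRepDomain hp.continuous u (p u)) (by simp)).continuousOn.continuousAt
      ((isOpen_chartRepDomain hp.continuous u (p u)).mem_nhds hD))
  have h2 := (continuousAt_extChartAt (I := 𝓡 n) u).eventually
    (eventually_surjective h1 ((surjective_fderiv_chartRep hp hu0 hpu).2 hu))
  filter_upwards [h2, (isOpen_extChartAt_source (I := 𝓡 n) u).mem_nhds hu0,
    hp.continuous.continuousAt.preimage_mem_nhds
      ((isOpen_extChartAt_source (I := 𝓡 m) (p u)).mem_nhds hpu)] with w hw hw1 hw2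
  exact (surjective_fderiv_chartRep hp hw1 hw2).1 hw

/-- The regular values of a proper map form an open set. -/
theorem isOpen_setOf_isRegularValue (hp : ContMDiff (𝓡 n) (𝓡 m) ∞ p) (hproper : IsProperMap p) :
    IsOpen {x : M | IsRegularValue m n p x} := by
  have h := hproper.isClosedMap _ (isOpen_setOf_surjective_mfderiv hp).isClosed_compl
  convert h.isOpen_compl using 1
  ext x
  simp only [IsRegularValue, mem_ofPred_eq, mem_compl_iff, mem_image, not_exists, not_and]
  exact ⟨fun h u hu hx => hu (h u hx), fun h u hx => by_contra fun hu => h u hu hx⟩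

/-- If all reachable sets are dense and `p` is proper, then all values of `p` are regular: by
Sard's theorem there is one, hence there is an open set of them, and regularity is invariant under
the holonomy. -/
theorem IsRegularValue.of_dense_reachableSet [T2Space M] [SecondCountableTopology M] [T2Space N]
    [SecondCountableTopology N] {p : C^∞⟮𝓡 n, N; 𝓡 m, M⟯}
    {A : C^∞⟮𝓡 m, M; ℝ⟯ →ₗ[ℝ] C^∞⟮𝓡 m, M; ℝ⟯} {B : C^∞⟮𝓡 n, N; ℝ⟯ →ₗ[ℝ] C^∞⟮𝓡 n, N; ℝ⟯}
    (hA : IsDiffusionOperator A) (hB : IsDiffusionOperator B) (hBA : IsOver p B A) {r : ℕ}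
    (hk : ∀ x : M, Module.finrank ℝ (symbolImage A x) = r)
    (hcomplete : IsCompleteSemiConnection p (symbolImage A) (horizontalSpace p B))
    (hdense : ∀ x : M, Dense (reachableSet (symbolImage A) x)) (hproper : IsProperMap p) (x : M) :
    IsRegularValue m n p x := by
  have : Nonempty M := ⟨x⟩
  obtain ⟨y, hy⟩ := exists_isRegularValue p.contMDiff
  obtain ⟨z, hz, T, σ, hT, hσ, rfl, rfl⟩ :=
    (hdense x).inter_open_nonempty _ (isOpen_setOf_isRegularValue p.contMDiff hproper) ⟨y, hy⟩
  exact hz.of_isHorizontalCurve hA hB hBA hk hcomplete hT hσ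

end RegularValues

/-! ### Lifts of coordinate fields and their flows -/

section LiftedFields

variable {m n : ℕ} {M : Type u} {N : Type v}
  [TopologicalSpace M] [ChartedSpace (EuclideanSpace ℝ (Fin m)) M]
  [TopologicalSpace N] [ChartedSpace (EuclideanSpace ℝ (Fin n)) N]
  [IsManifold (𝓡 m) ∞ M] [IsManifold (𝓡 n) ∞ N]

omit [IsManifold (𝓡 n) ∞ N] in
theorem IsLocalDiffeoOn.isInvertible_mfderiv
    {d : OpenPartialHomeomorph N (EuclideanSpace ℝ (Fin n))} (hd : IsLocalDiffeoOn n n d) {u : N}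
    (hu : u ∈ d.source) :
    (mfderiv (𝓡 n) 𝓘(ℝ, EuclideanSpace ℝ (Fin n)) d u).IsInvertible := by
  let h : d.MDifferentiable (𝓡 n) 𝓘(ℝ, EuclideanSpace ℝ (Fin n)) :=
    ⟨hd.1.mdifferentiableOn (by simp), hd.2.mdifferentiableOn (by simp)⟩
  exact ⟨h.mfderiv hu, rfl⟩

/-- Over a closed set on which the chart of `M` centered at `x` is defined, a constant vector field
of this chart lifts to `N`. Local lifts come from submersion charts; they are glued by a partition
of unity, as the possible values of a lift form an affine subspace. -/
theorem exists_lift_constant_field [T2Space N] [SecondCountableTopology N] {p : N → M}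
    (hp : ContMDiff (𝓡 n) (𝓡 m) ∞ p)
    (hs : ∀ u, Function.Surjective (mfderiv (𝓡 n) (𝓡 m) p u)) {x : M} {K : Set M}
    (hK : IsClosed K) (hKx : K ⊆ (extChartAt (𝓡 m) x).source) (v : EuclideanSpace ℝ (Fin m)) :
    ∃ V : ∀ u : N, TangentSpace (𝓡 n) u,
      ContMDiff (𝓡 n) (𝓡 n).tangent ∞ (fun u => (⟨u, V u⟩ : TangentBundle (𝓡 n) N)) ∧
      ∀ u, p u ∈ K → mfderiv (𝓡 n) 𝓘(ℝ, EuclideanSpace ℝ (Fin m))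
        (fun w => extChartAt (𝓡 m) x (p w)) u (V u) = v := by
  have : LocallyCompactSpace N := ChartedSpace.locallyCompactSpace (EuclideanSpace ℝ (Fin n)) N
  let f : N → EuclideanSpace ℝ (Fin m) := fun w => extChartAt (𝓡 m) x (p w)
  let t : ∀ u : N, Set (TangentSpace (𝓡 n) u) := fun u =>
    {V | p u ∈ K → mfderiv (𝓡 n) 𝓘(ℝ, EuclideanSpace ℝ (Fin m)) f u V = v}
  suffices h : (∀ u, Convex ℝ (t u)) ∧ ∀ u₀ : N, ∃ U ∈ 𝓝 u₀, ∃ V : ∀ u : N, TangentSpace (𝓡 n) u,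
      ContMDiffOn (𝓡 n) (𝓡 n).tangent ∞ (fun u => (⟨u, V u⟩ : TangentBundle (𝓡 n) N)) U ∧
      ∀ u ∈ U, V u ∈ t u by
    obtain ⟨s, hs⟩ := exists_contMDiffSection_forall_mem_convex_of_local (𝓡 n) (n := ⊤)
      (V := fun u : N => TangentSpace (𝓡 n) u) (F_fiber := EuclideanSpace ℝ (Fin n)) t h.1 h.2
    exact ⟨s, s.contMDiff, hs⟩
  refine ⟨?_, ?_⟩
  · intro u V hV W hW a b ha hb hab hu
    rw [map_add, map_smul, map_smul, hV hu, hW hu]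
    exact (add_smul a b v).symm.trans (by rw [hab, one_smul])
  · intro u
    by_cases hu : p u ∈ K
    · obtain ⟨T, d, hud, hd⟩ := exists_isSubmersionChart hp (hKx hu) (hs u)
      refine ⟨d.source, d.open_source.mem_nhds hud, VectorField.mpullback (𝓡 n)
        𝓘(ℝ, EuclideanSpace ℝ (Fin n)) d (fun _ => T.symm (v, 0)), fun w hw => ?_, fun w hw _ => ?_⟩
      · have h1 : ContMDiffAt (𝓡 n) 𝓘(ℝ, EuclideanSpace ℝ (Fin n)) ∞ d w :=
          hd.isLocalDiffeoOn.contMDiffOn.contMDiffAt (d.open_source.mem_nhds hw)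
        refine (ContMDiffAt.mpullback_vectorField_preimage (m := ∞) ?_ h1
          (hd.isLocalDiffeoOn.isInvertible_mfderiv hw) (by simp)).contMDiffWithinAt
        exact contMDiffAt_vectorSpace_iff_contDiffAt.2 contDiffAt_const
      · obtain ⟨D, hD⟩ := hd.isLocalDiffeoOn.isInvertible_mfderiv hw
        have h1 : MDifferentiableAt (𝓡 n) 𝓘(ℝ, EuclideanSpace ℝ (Fin n)) d w :=
          (hd.isLocalDiffeoOn.contMDiffOn.contMDiffAt
            (d.open_source.mem_nhds hw)).mdifferentiableAt (by simp)
        let S : EuclideanSpace ℝ (Fin n) →L[ℝ] EuclideanSpace ℝ (Fin m) :=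
          (ContinuousLinearMap.fst ℝ _ _).comp T.toContinuousLinearMap
        have h2 : f =ᶠ[𝓝 w] S ∘ d := by
          filter_upwards [d.open_source.mem_nhds hw] with y hy using (hd.fst_eq y hy).symm
        have h3 := (S.hasFDerivAt (x := d w)).hasMFDerivAt.comp w h1.hasMFDerivAt
        have h4 : VectorField.mpullback (𝓡 n) 𝓘(ℝ, EuclideanSpace ℝ (Fin n)) d
            (fun _ => T.symm (v, 0)) w = D.symm (T.symm (v, 0)) := by
          change (mfderiv (𝓡 n) 𝓘(ℝ, EuclideanSpace ℝ (Fin n)) d w).inverse _ = _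
          rw [← hD, ContinuousLinearMap.inverse_equiv]
          rfl
        rw [h2.mfderiv_eq, h3.mfderiv, h4, ← hD]
        change (T (D (D.symm (T.symm (v, 0))))).1 = v
        exact (congrArg (fun z : EuclideanSpace ℝ (Fin n) => (T z).1)
          (D.apply_symm_apply (T.symm (v, 0)))).trans (congrArg Prod.fst (T.apply_symm_apply _))
    · refine ⟨p ⁻¹' Kᶜ, (hK.isOpen_compl.preimage hp.continuous).mem_nhds hu, fun _ => 0,
        ?_, fun w hw hw' => absurd hw' hw⟩
      exact (Bundle.contMDiff_zeroSection ℝ (fun u : N => TangentSpace (𝓡 n) u)).contMDiffOn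

end LiftedFields

section ParametricFlow

variable {m n : ℕ} {N : Type v} [TopologicalSpace N] [ChartedSpace (EuclideanSpace ℝ (Fin n)) N]

/-- `Γ w u` is, on `(-1, 1)`, the integral curve starting at `u` of the field `∑ wᵢ Vᵢ`, for all
`u ∈ U` and all small `w`. It stays in `O` and depends smoothly on `w` and `u`. -/
structure IsParametricFlow (V : Fin m → ∀ u : N, TangentSpace (𝓡 n) u) (O U : Set N) (η : ℝ)
    (Γ : EuclideanSpace ℝ (Fin m) → N → ℝ → N) : Prop where
  zero : ∀ w ∈ Metric.ball 0 η, ∀ u ∈ U, Γ w u 0 = u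
  integral : ∀ w ∈ Metric.ball 0 η, ∀ u ∈ U,
    IsMIntegralCurveOn (I := 𝓡 n) (Γ w u) (fun v => ∑ i, w i • V i v) (Ioo (-1) 1)
  mem : ∀ w ∈ Metric.ball 0 η, ∀ u ∈ U, ∀ t, Γ w u t ∈ O
  contMDiffOn : ∀ t ∈ Ioo (-1 : ℝ) 1, ContMDiffOn (𝓘(ℝ, EuclideanSpace ℝ (Fin m)).prod (𝓡 n))
    (𝓡 n) ∞ (fun q : EuclideanSpace ℝ (Fin m) × N => Γ q.1 q.2 t) (Metric.ball 0 η ×ˢ U)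

variable {V : Fin m → ∀ u : N, TangentSpace (𝓡 n) u} {O U U' : Set N} {η η' : ℝ}
  {Γ Γ' : EuclideanSpace ℝ (Fin m) → N → ℝ → N}

theorem IsParametricFlow.mono (h : IsParametricFlow V O U η Γ) (hU : U' ⊆ U) (hη : η' ≤ η) :
    IsParametricFlow V O U' η' Γ where
  zero w hw u hu := h.zero w (Metric.ball_subset_ball hη hw) u (hU hu)
  integral w hw u hu := h.integral w (Metric.ball_subset_ball hη hw) u (hU hu)
  mem w hw u hu := h.mem w (Metric.ball_subset_ball hη hw) u (hU hu)
  contMDiffOn t ht := (h.contMDiffOn t ht).mono (prod_mono (Metric.ball_subset_ball hη) hU)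

variable [IsManifold (𝓡 n) ∞ N]

theorem contMDiff_sum_smul_section
    (hV : ∀ i, ContMDiff (𝓡 n) (𝓡 n).tangent ∞ (fun u => (⟨u, V i u⟩ : TangentBundle (𝓡 n) N)))
    (w : EuclideanSpace ℝ (Fin m)) :
    ContMDiff (𝓡 n) (𝓡 n).tangent ∞
      (fun u => (⟨u, ∑ i, w i • V i u⟩ : TangentBundle (𝓡 n) N)) :=
  ContMDiff.sum_section fun i _ => (hV i).const_smul_section

/-- Parametric flows of the same fields agree where both are defined. -/
theorem IsParametricFlow.eq [T2Space N]
    (hV : ∀ i, ContMDiff (𝓡 n) (𝓡 n).tangent ∞ (fun u => (⟨u, V i u⟩ : TangentBundle (𝓡 n) N)))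
    (h : IsParametricFlow V O U η Γ) (h' : IsParametricFlow V O U' η' Γ')
    {w : EuclideanSpace ℝ (Fin m)} (hw : w ∈ Metric.ball 0 η) (hw' : w ∈ Metric.ball 0 η') {u : N}
    (hu : u ∈ U) (hu' : u ∈ U') {t : ℝ} (ht : t ∈ Ioo (-1 : ℝ) 1) : Γ w u t = Γ' w u t := by
  have : IsManifold (𝓡 n) 1 N := .of_le (n := ∞) (by exact_mod_cast le_top)
  exact isMIntegralCurveOn_Ioo_eqOn_of_contMDiff_boundaryless (t₀ := 0) (by simp)
    ((contMDiff_sum_smul_section hV w).of_le (by exact_mod_cast le_top))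
    (h.integral w hw u hu) (h'.integral w hw' u hu') (by rw [h.zero w hw u hu, h'.zero w hw' u hu'])
    ht

/-- A continuous solution of a controlled equation with a constant control is a classical
solution. -/
theorem IsControlSol.hasDerivAt {E G : Type*} [NormedAddCommGroup E] [NormedSpace ℝ E]
    [FiniteDimensional ℝ E] [NormedAddCommGroup G] [NormedSpace ℝ G] {Y : E → G →L[ℝ] E} {w : G}
    {y : ℝ → E} {Ω : Set E} (hY : ContinuousOn Y Ω)
    (h : IsControlSol Y (fun _ => w) (Icc (-1) 1) y) (hy : ∀ t, y t ∈ Ω) {t : ℝ}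
    (ht : t ∈ Ioo (-1 : ℝ) 1) : HasDerivAt y (Y (y t) w) t := by
  obtain ⟨K, hK⟩ := h.1
  have hc : ContinuousOn (fun r => Y (y r) w) (Icc (-1) 1) :=
    ((hY.comp h.continuousOn fun r _ => hy r)).clm_apply continuousOn_const
  have h0 : (0 : ℝ) ∈ Icc (-1 : ℝ) 1 := by simp
  have ht' := Ioo_subset_Icc_self ht
  have hct : ContinuousAt (fun r => Y (y r) w) t := hc.continuousAt (Icc_mem_nhds ht.1 ht.2)
  have hd : HasDerivAt (fun s => ∫ r in (0 : ℝ)..s, Y (y r) w) (Y (y t) w) t := by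
    refine intervalIntegral.integral_hasDerivAt_right
      ((hc.mono (uIcc_subset_Icc h0 ht')).intervalIntegrable) ?_ hct
    exact (hc.mono Ioo_subset_Icc_self).stronglyMeasurableAtFilter isOpen_Ioo t ht
  refine (hd.const_add (y 0)).congr_of_eventuallyEq ?_
  filter_upwards [Icc_mem_nhds ht.1 ht.2] with s hs
  rw [hK.integral_eq_sub_of_ae_hasDerivAt h.2 h0 hs]
  abel

/-- Near a point, the flow is obtained in a chart from an equation with the constant control `w`, so
that it exists up to time `1` for small `w`. -/
theorem exists_isParametricFlow_nhds
    (hV : ∀ i, ContMDiff (𝓡 n) (𝓡 n).tangent ∞ (fun u => (⟨u, V i u⟩ : TangentBundle (𝓡 n) N)))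
    (hO : IsOpen O) {c : N} (hc : c ∈ O) :
    ∃ U, IsOpen U ∧ c ∈ U ∧ ∃ η > 0, ∃ Γ, IsParametricFlow V O U η Γ := by
  let Y : EuclideanSpace ℝ (Fin n) → EuclideanSpace ℝ (Fin m) →L[ℝ] EuclideanSpace ℝ (Fin n) :=
    fun y => ∑ i, (EuclideanSpace.proj i : EuclideanSpace ℝ (Fin m) →L[ℝ] ℝ).smulRight
      (chartField c (V i) y)
  let Ω : Set (EuclideanSpace ℝ (Fin n)) :=
    (extChartAt (𝓡 n) c).target ∩ (extChartAt (𝓡 n) c).symm ⁻¹' O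
  have hΩ : IsOpen Ω := (continuousOn_extChartAt_symm c).isOpen_inter_preimage
    (isOpen_extChartAt_target c) hO
  have hcs := mem_extChartAt_source (I := 𝓡 n) c
  have hcΩ : extChartAt (𝓡 n) c c ∈ Ω :=
    ⟨mem_extChartAt_target c, by rwa [mem_preimage, (extChartAt (𝓡 n) c).left_inv hcs]⟩
  have hY : ContDiffOn ℝ ∞ Y Ω := by
    refine ContDiffOn.sum fun i _ => ?_
    exact contDiffOn_const.smulRight ((contDiffOn_chartField c (hV i)).mono inter_subset_left)
  obtain ⟨U, hU, hcU, η, hη, Γ, hΓ, hsm, -, -⟩ := exists_controlFlow_const hΩ hY hcΩ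
  let U' : Set N := (extChartAt (𝓡 n) c).source ∩ extChartAt (𝓡 n) c ⁻¹' U
  refine ⟨U', (continuousOn_extChartAt c).isOpen_inter_preimage (isOpen_extChartAt_source c) hU,
    ⟨hcs, hcU⟩, η, hη, fun w u t => (extChartAt (𝓡 n) c).symm (Γ w (extChartAt (𝓡 n) c u) t),
    fun w hw u hu => ?_, fun w hw u hu t ht => ?_, fun w hw u hu t => ?_, fun t ht => ?_⟩
  · rw [(hΓ w hw _ hu.2).1, (extChartAt (𝓡 n) c).left_inv hu.1]
  · obtain ⟨-, hsol, hmem⟩ := hΓ w hw _ hu.2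
    have hchart : ∀ t, extChartAt (𝓡 n) c ((extChartAt (𝓡 n) c).symm
        (Γ w (extChartAt (𝓡 n) c u) t)) = Γ w (extChartAt (𝓡 n) c u) t := fun t =>
      (extChartAt (𝓡 n) c).right_inv (hmem t).1
    have hs := (extChartAt (𝓡 n) c).map_target (hmem t).1
    have hcont : ContinuousOn (fun t => (extChartAt (𝓡 n) c).symm
        (Γ w (extChartAt (𝓡 n) c u) t)) (Icc (-1) 1) :=
      (continuousOn_extChartAt_symm c).comp hsol.continuousOn fun t _ => (hmem t).1
    obtain ⟨h1, h2⟩ := mdifferentiableAt_of_hasDerivAt_extChartAt (c := c)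
      (σ := fun t => (extChartAt (𝓡 n) c).symm (Γ w (extChartAt (𝓡 n) c u) t)) (t := t)
      (v := Y (Γ w (extChartAt (𝓡 n) c u) t) w)
      (hcont.continuousAt (Icc_mem_nhds ht.1 ht.2)) hs
      (by simp only [hchart]; exact hsol.hasDerivAt hY.continuousOn hmem ht)
    obtain ⟨D, hD⟩ := isInvertible_chartDeriv hs
    have h3 : Y (Γ w (extChartAt (𝓡 n) c u) t) w = D (∑ i, w i • V i ((extChartAt (𝓡 n) c).symm
        (Γ w (extChartAt (𝓡 n) c u) t))) := by
      simp only [Y, sum_apply, ContinuousLinearMap.smulRight_apply, map_sum, map_smul]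
      refine Finset.sum_congr rfl fun i _ => ?_
      rw [chartField_eq (hmem t).1, ← hD]
      rfl
    rw [h3, ← hD] at h2
    have h4 := D.injective h2
    have h5 : ∀ (A : ℝ →L[ℝ] EuclideanSpace ℝ (Fin n)) (v : EuclideanSpace ℝ (Fin n)), A 1 = v →
        A = (1 : ℝ →L[ℝ] ℝ).smulRight v := by
      rintro A _ rfl
      ext
      simp
    exact (h1.hasMFDerivAt.congr_mfderiv (h5 _ _ h4)).hasMFDerivWithinAt
  · exact ((hΓ w hw _ hu.2).2.2 t).2
  · have ha : ContMDiffOn (𝓘(ℝ, EuclideanSpace ℝ (Fin m)).prod (𝓡 n))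
        𝓘(ℝ, EuclideanSpace ℝ (Fin m)) ∞ (fun q : EuclideanSpace ℝ (Fin m) × N => q.1)
        (Metric.ball 0 η ×ˢ U') := contMDiff_fst.contMDiffOn
    have hb : ContMDiffOn (𝓘(ℝ, EuclideanSpace ℝ (Fin m)).prod (𝓡 n))
        𝓘(ℝ, EuclideanSpace ℝ (Fin n)) ∞
        (fun q : EuclideanSpace ℝ (Fin m) × N => extChartAt (𝓡 n) c q.2)
        (Metric.ball 0 η ×ˢ U') := by
      refine (contMDiffOn_extChartAt (n := ∞) (x := c)).comp contMDiff_snd.contMDiffOn fun q hq => ?_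
      rw [← extChartAt_source (𝓡 n)]
      exact hq.2.1
    have h1 := ha.prodMk_space hb
    have h2 := contMDiffOn_iff_contDiffOn.2 (hsm t)
    have h3 := h2.comp h1 fun q hq => ⟨hq.1, hq.2.2⟩
    exact (contMDiffOn_extChartAt_symm c).comp h3 fun q hq => ((hΓ q.1 hq.1 _ hq.2.2).2.2 t).1

/-- Near a compact set, the integral curves exist up to time `1` for uniformly small parameters: the
local flows agree where their domains overlap, so they can be glued. -/
theorem exists_isParametricFlow_of_isCompact [T2Space N]
    (hV : ∀ i, ContMDiff (𝓡 n) (𝓡 n).tangent ∞ (fun u => (⟨u, V i u⟩ : TangentBundle (𝓡 n) N)))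
    (hO : IsOpen O) {C : Set N} (hC : IsCompact C) (hCO : C ⊆ O) :
    ∃ U, IsOpen U ∧ C ⊆ U ∧ ∃ η > 0, ∃ Γ, IsParametricFlow V O U η Γ := by
  classical
  refine hC.induction_on ?_ ?_ ?_ ?_
    (p := fun C => ∃ U, IsOpen U ∧ C ⊆ U ∧ ∃ η > 0, ∃ Γ, IsParametricFlow V O U η Γ)
  · exact ⟨∅, isOpen_empty, Subset.rfl, 1, one_pos, fun _ u _ => u, by simp, by simp, by simp,
      fun t _ => by rw [prod_empty]; exact contMDiffOn_empty⟩
  · rintro C C' hCC' ⟨U, hU, hCU, h⟩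
    exact ⟨U, hU, hCC'.trans hCU, h⟩
  · rintro C C' ⟨U, hU, hCU, η, hη, Γ, hΓ⟩ ⟨U', hU', hCU', η', hη', Γ', hΓ'⟩
    replace hΓ := hΓ.mono Subset.rfl (min_le_left η η')
    replace hΓ' := hΓ'.mono Subset.rfl (min_le_right η η')
    -- the two flows agree on `U ∩ U'`, so that the glued one is smooth
    let Δ : EuclideanSpace ℝ (Fin m) → N → ℝ → N := fun w u t =>
      if u ∈ U then Γ w u t else Γ' w u t
    have hpos : ∀ u ∈ U, (fun w => Δ w u) = fun w => Γ w u := fun u hu => by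
      ext w t; exact if_pos hu
    have hneg : ∀ u ∉ U, (fun w => Δ w u) = fun w => Γ' w u := fun u hu => by
      ext w t; exact if_neg hu
    refine ⟨U ∪ U', hU.union hU', union_subset_union hCU hCU', min η η', lt_min hη hη', Δ,
      fun w hw u hu => ?_, fun w hw u hu => ?_, fun w hw u hu => ?_, fun t ht q hq => ?_⟩
    · by_cases h : u ∈ U
      · rw [congrFun (hpos u h) w, hΓ.zero w hw u h]
      · rw [congrFun (hneg u h) w, hΓ'.zero w hw u (hu.resolve_left h)]
    · by_cases h : u ∈ U
      · rw [congrFun (hpos u h) w]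
        exact hΓ.integral w hw u h
      · rw [congrFun (hneg u h) w]
        exact hΓ'.integral w hw u (hu.resolve_left h)
    · by_cases h : u ∈ U
      · rw [congrFun (hpos u h) w]
        exact hΓ.mem w hw u h
      · rw [congrFun (hneg u h) w]
        exact hΓ'.mem w hw u (hu.resolve_left h)
    · rcases hq.2 with h | h
      · have hnhds := (Metric.isOpen_ball.prod hU).mem_nhds ⟨hq.1, h⟩
        refine (((hΓ.contMDiffOn t ht).contMDiffAt hnhds).congr_of_eventuallyEq
          ?_).contMDiffWithinAt
        filter_upwards [hnhds] with q hq
        exact if_pos hq.2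
      · have hnhds := (Metric.isOpen_ball.prod hU').mem_nhds ⟨hq.1, h⟩
        refine (((hΓ'.contMDiffOn t ht).contMDiffAt hnhds).congr_of_eventuallyEq
          ?_).contMDiffWithinAt
        filter_upwards [hnhds] with q hq
        by_cases h' : q.2 ∈ U
        · exact (if_pos h').trans (hΓ.eq hV hΓ' hq.1 hq.1 h' hq.2 ht)
        · exact if_neg h'
  · intro u hu
    obtain ⟨U, hU, huU, h⟩ := exists_isParametricFlow_nhds hV hO (hCO hu)
    exact ⟨U, mem_nhdsWithin_of_mem_nhds (hU.mem_nhds huU), U, hU, Subset.rfl, h⟩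

end ParametricFlow

/-! ### Local product structures of a proper submersion -/

section ProductStructure

variable {m n : ℕ} {M : Type u} {N : Type v}
  [TopologicalSpace M] [ChartedSpace (EuclideanSpace ℝ (Fin m)) M]
  [TopologicalSpace N] [ChartedSpace (EuclideanSpace ℝ (Fin n)) N]

section Flow

variable {V : Fin m → ∀ u : N, TangentSpace (𝓡 n) u} {O U : Set N} {η : ℝ}
  {Γ : EuclideanSpace ℝ (Fin m) → N → ℝ → N} {w : EuclideanSpace ℝ (Fin m)} {u : N}

/-- Flowing along the opposite field leads back to the starting point. -/
theorem IsParametricFlow.neg [IsManifold (𝓡 n) ∞ N] [T2Space N]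
    (hV : ∀ i, ContMDiff (𝓡 n) (𝓡 n).tangent ∞ (fun u => (⟨u, V i u⟩ : TangentBundle (𝓡 n) N)))
    (h : IsParametricFlow V O U η Γ) (hw : w ∈ Metric.ball 0 η) (hu : u ∈ U)
    (hu' : Γ w u (1 / 2) ∈ U) : Γ (-w) (Γ w u (1 / 2)) (1 / 2) = u := by
  have : IsManifold (𝓡 n) 1 N := .of_le (n := ∞) (by exact_mod_cast le_top)
  have hw' : -w ∈ Metric.ball (0 : EuclideanSpace ℝ (Fin m)) η := by simpa using hw
  have h1 := ((h.integral w hw u hu).comp_add (1 / 2)).comp_mul (-1)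
  have h2 : ((-1 : ℝ) • fun v => ∑ i, w i • V i v) = fun v => ∑ i, (-w) i • V i v := by
    ext1 v
    rw [Pi.smul_apply, neg_one_smul, ← Finset.sum_neg_distrib]
    exact Finset.sum_congr rfl fun i _ => (neg_smul _ _).symm
  rw [h2] at h1
  have h3 := isMIntegralCurveOn_Ioo_eqOn_of_contMDiff_boundaryless (t₀ := 0) (a := -1 / 2) (b := 1)
    (by norm_num) ((contMDiff_sum_smul_section hV (-w)).of_le (by exact_mod_cast le_top))
    ((h.integral (-w) hw' _ hu').mono (Ioo_subset_Ioo (by norm_num) le_rfl))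
    (h1.mono fun s hs => ?_) ?_
  · rw [h3 (x := 1 / 2) (by norm_num)]
    simp only [Function.comp_apply]
    norm_num
    exact h.zero w hw u hu
  · obtain ⟨hs1, hs2⟩ := hs
    constructor <;> linarith
  · rw [h.zero _ hw' _ hu']
    simp

/-- If the fields `Vᵢ` are lifts of the coordinate fields, then the flow is a translation in the
coordinates of the base. -/
theorem IsParametricFlow.map_eq (h : IsParametricFlow V O U η Γ)
    {f : N → EuclideanSpace ℝ (Fin m)}
    (hf : ∀ v ∈ O, MDifferentiableAt (𝓡 n) 𝓘(ℝ, EuclideanSpace ℝ (Fin m)) f v)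
    (hVf : ∀ i, ∀ v ∈ O, mfderiv (𝓡 n) 𝓘(ℝ, EuclideanSpace ℝ (Fin m)) f v (V i v) =
      EuclideanSpace.single i (1 : ℝ))
    (hw : w ∈ Metric.ball 0 η) (hu : u ∈ U) {t : ℝ} (ht : t ∈ Ioo (-1 : ℝ) 1) :
    f (Γ w u t) = f u + t • w := by
  have hd : ∀ t ∈ Ioo (-1 : ℝ) 1, HasDerivAt (fun t => f (Γ w u t)) w t := by
    intro t ht
    have h1 := (h.integral w hw u hu t ht).hasMFDerivAt (Ioo_mem_nhds ht.1 ht.2)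
    have h2 := (hf _ (h.mem w hw u hu t)).hasMFDerivAt.comp t h1
    let D : ℝ →L[ℝ] EuclideanSpace ℝ (Fin m) :=
      (mfderiv (𝓡 n) 𝓘(ℝ, EuclideanSpace ℝ (Fin m)) f (Γ w u t)).comp
        ((1 : ℝ →L[ℝ] ℝ).smulRight (∑ i, w i • V i (Γ w u t)))
    have h3 : HasFDerivAt (fun t => f (Γ w u t)) D t := hasMFDerivAt_iff_hasFDerivAt.1 h2
    refine h3.hasDerivAt.congr_deriv ?_
    change mfderiv (𝓡 n) 𝓘(ℝ, EuclideanSpace ℝ (Fin m)) f (Γ w u t)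
      ((1 : ℝ) • ∑ i, w i • V i (Γ w u t)) = w
    rw [one_smul, map_sum]
    refine (Finset.sum_congr rfl fun i _ => ?_).trans (?_ : ∑ i, w i • EuclideanSpace.single i (1 : ℝ) = w)
    · rw [map_smul, hVf i _ (h.mem w hw u hu t)]
      rfl
    · ext j
      simp [Pi.single_apply]
  have hd' : ∀ t ∈ Ioo (-1 : ℝ) 1, HasDerivAt (fun t => f (Γ w u t) - t • w) 0 t := fun t ht =>
    ((hd t ht).fun_sub ((hasDerivAt_id t).smul_const w)).congr_deriv (by simp)
  have h1 := isOpen_Ioo.is_const_of_deriv_eq_zero isPreconnected_Ioo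
    (fun t ht => (hd' t ht).differentiableAt.differentiableWithinAt)
    (fun t ht => (hd' t ht).deriv) ht (show (0 : ℝ) ∈ Ioo (-1 : ℝ) 1 by simp)
  simp only [zero_smul, sub_zero, h.zero w hw u hu] at h1
  rw [← h1]
  abel

end Flow

/-- A product structure of `p⁻¹(B)` over the open set `B`: a smooth map `r` to the fibre over `x`
and a smooth family `s` of maps from the fibre over `x`, to the fibre over each `y ∈ B`, with
`u = s (p u) (r u)`. The maps `s y` are extended to a neighbourhood `U` of the fibre over `x`. -/
structure IsProductStructure (m n : ℕ) {M : Type u} {N : Type v}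
    [TopologicalSpace M] [ChartedSpace (EuclideanSpace ℝ (Fin m)) M]
    [TopologicalSpace N] [ChartedSpace (EuclideanSpace ℝ (Fin n)) N] (p : N → M) (x : M)
    (B : Set M) (U : Set N) (r : N → N) (s : M → N → N) : Prop where
  isOpen_base : IsOpen B
  mem_base : x ∈ B
  isOpen : IsOpen U
  fibre_subset : p ⁻¹' {x} ⊆ U
  contMDiffOn_r : ContMDiffOn (𝓡 n) (𝓡 n) ∞ r (p ⁻¹' B)
  contMDiffOn_s : ContMDiffOn ((𝓡 m).prod (𝓡 n)) (𝓡 n) ∞ (fun q : M × N => s q.1 q.2) (B ×ˢ U)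
  map_r : ∀ u, p u ∈ B → p (r u) = x
  map_s : ∀ y ∈ B, ∀ f, p f = x → p (s y f) = y
  r_s : ∀ y ∈ B, ∀ f, p f = x → r (s y f) = f
  s_r : ∀ u, p u ∈ B → s (p u) (r u) = u

/-- Ehresmann's theorem: a proper submersion has local product structures. They are given by the
flows of lifts of the coordinate fields. -/
theorem exists_isProductStructure [IsManifold (𝓡 m) ∞ M] [IsManifold (𝓡 n) ∞ N] [T2Space M]
    [T2Space N] [SecondCountableTopology N] {p : N → M} (hp : ContMDiff (𝓡 n) (𝓡 m) ∞ p)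
    (hs : ∀ u, Function.Surjective (mfderiv (𝓡 n) (𝓡 m) p u)) (hproper : IsProperMap p) (x : M) :
    ∃ B U r s, IsProductStructure m n p x B U r s := by
  have : LocallyCompactSpace M := ChartedSpace.locallyCompactSpace (EuclideanSpace ℝ (Fin m)) M
  let φ := extChartAt (𝓡 m) x
  have hxs : x ∈ φ.source := mem_extChartAt_source x
  have hφo : IsOpen φ.source := isOpen_extChartAt_source x
  obtain ⟨K, hKx, hK, hKs⟩ := exists_mem_nhds_isClosed_subset (hφo.mem_nhds hxs)
  choose V hV hVφ using fun i : Fin m => exists_lift_constant_field hp hs hK hKs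
    (EuclideanSpace.single i (1 : ℝ))
  let O : Set N := p ⁻¹' interior K
  have hO : IsOpen O := isOpen_interior.preimage hp.continuous
  have hxO : p ⁻¹' {x} ⊆ O := fun u hu => by
    have hu' : p u = x := hu
    change p u ∈ interior K
    rw [hu']
    exact mem_interior_iff_mem_nhds.2 hKx
  obtain ⟨U, hU, hxU, η, hη, Γ, hΓ⟩ := exists_isParametricFlow_of_isCompact hV hO
    (hproper.isCompact_preimage isCompact_singleton) hxO
  have hφd : ∀ y ∈ φ.source, ContMDiffAt (𝓡 m) 𝓘(ℝ, EuclideanSpace ℝ (Fin m)) ∞ φ y :=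
    fun y hy => contMDiffAt_extChartAt' (by rwa [← extChartAt_source (𝓡 m)])
  have hOφ : ∀ u ∈ O, p u ∈ φ.source := fun u hu => hKs (interior_subset hu)
  have hmap : ∀ w ∈ Metric.ball (0 : EuclideanSpace ℝ (Fin m)) η, ∀ u ∈ U,
      φ (p (Γ w u (1 / 2))) = φ (p u) + (1 / 2 : ℝ) • w := fun w hw u hu =>
    hΓ.map_eq (f := fun u => φ (p u))
      (fun v hv => (((hφd _ (hOφ v hv)).comp v (hp v)).mdifferentiableAt (by simp)))
      (fun i v hv => hVφ i v (interior_subset hv)) hw hu (by norm_num)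
  -- properness: the preimages of small neighbourhoods of `x` are in `U`
  obtain ⟨B', hB', hxB', hB'U⟩ : ∃ B', IsOpen B' ∧ x ∈ B' ∧ p ⁻¹' B' ⊆ U := by
    refine ⟨(p '' Uᶜ)ᶜ, (hproper.isClosedMap _ hU.isClosed_compl).isOpen_compl, ?_, ?_⟩
    · rintro ⟨u, hu, hux⟩
      exact hu (hxU hux)
    · intro u hu
      by_contra h
      exact hu ⟨u, h, rfl⟩
  let B : Set M := (B' ∩ interior K) ∩ (φ.source ∩ φ ⁻¹' Metric.ball (φ x) (η / 2))
  have hB : IsOpen B := (hB'.inter isOpen_interior).inter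
    ((continuousOn_extChartAt x).isOpen_inter_preimage hφo Metric.isOpen_ball)
  have hxB : x ∈ B := ⟨⟨hxB', mem_interior_iff_mem_nhds.2 hKx⟩, hxs,
    Metric.mem_ball_self (half_pos hη)⟩
  have hBU : ∀ u, p u ∈ B → u ∈ U := fun u hu => hB'U hu.1.1
  -- the field whose flow moves the fibre over `x` to the one over `y` in time `1 / 2`
  let ξ : M → EuclideanSpace ℝ (Fin m) := fun y => (2 : ℝ) • (φ y - φ x)
  have hξ : ∀ y ∈ B, ξ y ∈ Metric.ball (0 : EuclideanSpace ℝ (Fin m)) η := by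
    intro y hy
    have := hy.2.2
    rw [mem_preimage, mem_ball_iff_norm] at this
    rw [mem_ball_zero_iff, norm_smul, Real.norm_ofNat]
    linarith
  have hξ' : ∀ y ∈ B, -ξ y ∈ Metric.ball (0 : EuclideanSpace ℝ (Fin m)) η := fun y hy => by
    have := hξ y hy
    rwa [mem_ball_zero_iff, ← norm_neg, ← mem_ball_zero_iff] at this
  have hξs : ContMDiffOn (𝓡 m) 𝓘(ℝ, EuclideanSpace ℝ (Fin m)) ∞ ξ B := fun y hy =>
    (((contDiff_id.sub contDiff_const).const_smul (2 : ℝ)).contMDiff.contMDiffAt.comp y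
      (hφd y hy.2.1)).contMDiffWithinAt
  have hhalf : ∀ y, (1 / 2 : ℝ) • ξ y = φ y - φ x := fun y => by
    rw [smul_smul]; norm_num
  have hr : ∀ u, p u ∈ B → p (Γ (-ξ (p u)) u (1 / 2)) = x := by
    intro u hu
    refine φ.injOn (hOφ _ (hΓ.mem _ (hξ' _ hu) _ (hBU u hu) _)) hxs ?_
    rw [hmap _ (hξ' _ hu) _ (hBU u hu), smul_neg, hhalf]
    abel
  have hs' : ∀ y ∈ B, ∀ f, p f = x → p (Γ (ξ y) f (1 / 2)) = y := by
    intro y hy f hf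
    refine φ.injOn (hOφ _ (hΓ.mem _ (hξ _ hy) _ (hxU hf) _)) hy.2.1 ?_
    rw [hmap _ (hξ _ hy) _ (hxU hf), hhalf, hf]
    abel
  refine ⟨B, U, fun u => Γ (-ξ (p u)) u (1 / 2), fun y f => Γ (ξ y) f (1 / 2), hB, hxB, hU, hxU,
    ?_, ?_, hr, hs', fun y hy f hf => ?_, fun u hu => ?_⟩
  · refine (hΓ.contMDiffOn (1 / 2) (by norm_num)).comp (f := fun u => (-ξ (p u), u))
      (ContMDiffOn.prodMk ?_ contMDiffOn_id) fun u hu => ⟨hξ' _ hu, hBU u hu⟩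
    exact contDiff_neg.contMDiff.comp_contMDiffOn (hξs.comp hp.contMDiffOn fun u hu => hu)
  · refine (hΓ.contMDiffOn (1 / 2) (by norm_num)).comp (f := fun q : M × N => (ξ q.1, q.2))
      (ContMDiffOn.prodMk ?_ contMDiff_snd.contMDiffOn) fun q hq => ⟨hξ _ hq.1, hq.2⟩
    exact hξs.comp contMDiff_fst.contMDiffOn fun q hq => hq.1
  · have h1 := hs' y hy f hf
    simp only [h1]
    exact hΓ.neg hV (hξ y hy) (hxU hf) (hBU _ (by rw [h1]; exact hy))
  · have h1 := hΓ.neg hV (hξ' _ hu) (hBU u hu) (hxU (hr u hu))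
    rwa [neg_neg] at h1

end ProductStructure

/-! ### Trivializations -/

section Trivialization

variable {m n : ℕ} {M : Type u} {N : Type v}
  [TopologicalSpace M] [ChartedSpace (EuclideanSpace ℝ (Fin m)) M]
  [TopologicalSpace N] [ChartedSpace (EuclideanSpace ℝ (Fin n)) N]
  {p : N → M} {x : M} {B : Set M} {U : Set N} {r : N → N} {s : M → N → N}

/-- The fibres over the base of a product structure are diffeomorphic to the central one. -/
theorem IsProductStructure.exists_isDiffeoBetween (h : IsProductStructure m n p x B U r s)
    (hp : Continuous p) {y : M} (hy : y ∈ B) :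
    ∃ f : (p ⁻¹' {x} : Set N) ≃ (p ⁻¹' {y} : Set N), IsDiffeoBetween n f := by
  have hyB : ∀ u : (p ⁻¹' {y} : Set N), p u ∈ B := fun u => by
    rw [show p u = y from u.2]
    exact hy
  refine ⟨⟨fun f => ⟨s y f, h.map_s y hy f f.2⟩, fun u => ⟨r u, h.map_r u (hyB u)⟩,
    fun f => Subtype.ext (h.r_s y hy f f.2), fun u => Subtype.ext ?_⟩, fun f => ?_, fun u => ?_⟩
  · have := h.s_r u (hyB u)
    rwa [show p u = y from u.2] at this
  · refine ⟨U, s y, h.isOpen, h.fibre_subset f.2, ?_, fun _ _ => rfl⟩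
    exact h.contMDiffOn_s.comp (f := fun f => (y, f))
      (contMDiffOn_const.prodMk contMDiffOn_id) fun f hf => ⟨hy, hf⟩
  · exact ⟨p ⁻¹' B, r, h.isOpen_base.preimage hp, hyB u, h.contMDiffOn_r, fun _ _ => rfl⟩

variable [IsManifold (𝓡 n) ∞ N] {k : ℕ} {P : Type v} [TopologicalSpace P]
  [ChartedSpace (EuclideanSpace ℝ (Fin k)) P] [IsManifold (𝓡 k) ∞ P] {i : P → N}

/-- A product structure around `x` yields a trivialization whose fibre is any manifold `P` which is
embedded with an image diffeomorphic to the fibre over `x`. -/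
theorem IsProductStructure.exists_trivialization [Nonempty P]
    (h : IsProductStructure m n p x B U r s) (hp : ContMDiff (𝓡 n) (𝓡 m) ∞ p)
    (hi : Manifold.IsSmoothEmbedding (𝓡 k) (𝓡 n) ∞ i) {S : Set N} (hS : range i = S)
    {g : (p ⁻¹' {x} : Set N) ≃ S} (hg : IsDiffeoBetween n g) :
    ∃ e : Bundle.Trivialization P p, x ∈ e.baseSet ∧
      ContMDiffOn (𝓡 n) ((𝓡 m).prod (𝓡 k)) ∞ e e.source ∧
      ContMDiffOn ((𝓡 m).prod (𝓡 k)) (𝓡 n) ∞ e.toOpenPartialHomeomorph.symm e.target := by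
  classical
  let ι : P ≃ S := (Equiv.ofInjective i hi.isEmbedding.injective).trans (Equiv.setCongr hS)
  have hι : ∀ q, (ι q : N) = i q := fun q => rfl
  have hι' : ∀ z : S, i (ι.symm z) = z := fun z => by rw [← hι, ι.apply_symm_apply]
  -- the fibre component of the trivialization, with an arbitrary value outside of `p⁻¹(B)`
  let j : N → P := fun u => if hu : p u ∈ B then ι.symm (g ⟨r u, h.map_r u hu⟩)
    else Classical.arbitrary P
  have hj : ∀ u (hu : p u ∈ B), j u = ι.symm (g ⟨r u, h.map_r u hu⟩) := fun u hu => dif_pos hu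
  have hBo : IsOpen (p ⁻¹' B) := h.isOpen_base.preimage hp.continuous
  have hjs : ContMDiffOn (𝓡 n) (𝓡 k) ∞ j (p ⁻¹' B) := by
    intro u hu
    obtain ⟨O, G, hO, hrO, hG, hGg⟩ := hg.1 ⟨r u, h.map_r u hu⟩
    have hr : ContMDiffAt (𝓡 n) (𝓡 n) ∞ r u := h.contMDiffOn_r.contMDiffAt (hBo.mem_nhds hu)
    have hc : ContMDiffAt (𝓡 n) (𝓡 n) ∞ (i ∘ j) u := by
      refine ((hG.contMDiffAt (hO.mem_nhds hrO)).comp u hr).congr_of_eventuallyEq ?_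
      filter_upwards [hBo.mem_nhds hu, hr.continuousAt.preimage_mem_nhds (hO.mem_nhds hrO)]
        with w hw hw'
      simp only [Function.comp_apply]
      rw [hj w hw, hι', hGg ⟨r w, h.map_r w hw⟩ hw']
    -- as `i` is an immersion, `j` is smooth because `i ∘ j` is smooth
    refine ContMDiffAt.contMDiffWithinAt ?_
    exact (ContMDiffAt.iff_comp_isImmersionAt (hi.isImmersion.isImmersionAt _)).2
      ⟨hi.isEmbedding.isInducing.continuousAt_iff.2 hc.continuousAt, hc⟩
  let t : M × P → N := fun q => s q.1 (g.symm (ι q.2))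
  have hts : ContMDiffOn ((𝓡 m).prod (𝓡 k)) (𝓡 n) ∞ t (B ×ˢ univ) := by
    rintro ⟨y, q⟩ ⟨hy, -⟩
    obtain ⟨O, G, hO, hqO, hG, hGg⟩ := hg.2 (ι q)
    have hi' : ContMDiffAt ((𝓡 m).prod (𝓡 k)) (𝓡 n) ∞ (fun z : M × P => i z.2) (y, q) :=
      hi.contMDiff.contMDiffAt.comp _ contMDiffAt_snd
    have h1 : ContMDiffAt ((𝓡 m).prod (𝓡 k)) ((𝓡 m).prod (𝓡 n)) ∞
        (fun z : M × P => (z.1, G (i z.2))) (y, q) :=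
      contMDiffAt_fst.prodMk (ContMDiffAt.comp (g := G) (y, q)
        (hG.contMDiffAt (hO.mem_nhds (show i q ∈ O from hqO))) hi')
    have h2 : (y, G (i q)) ∈ B ×ˢ U := ⟨hy, h.fibre_subset (by
      have := hGg (ι q) hqO
      rw [hι] at this
      rw [this]
      exact (g.symm (ι q)).2)⟩
    refine (((h.contMDiffOn_s.contMDiffAt ((h.isOpen_base.prod h.isOpen).mem_nhds h2)).comp (y, q)
      h1).congr_of_eventuallyEq ?_).contMDiffWithinAt
    filter_upwards [hi'.continuousAt.preimage_mem_nhds (hO.mem_nhds hqO)] with z hz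
    simp only [Function.comp_apply, t]
    rw [← hGg (ι z.2) hz, hι]
  have hpt : ∀ q : M × P, q.1 ∈ B → p (t q) = q.1 := fun q hq => h.map_s q.1 hq _ (g.symm (ι q.2)).2
  let e : Bundle.Trivialization P p :=
    { toFun := fun u => (p u, j u)
      invFun := t
      source := p ⁻¹' B
      target := B ×ˢ univ
      map_source' := fun u hu => ⟨hu, mem_univ _⟩
      map_target' := fun q hq => by
        rw [mem_preimage, hpt q hq.1]
        exact hq.1
      left_inv' := fun u hu => by
        simp only [t]
        rw [hj u hu, ι.apply_symm_apply, g.symm_apply_apply]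
        exact h.s_r u hu
      right_inv' := fun q hq => by
        have h1 : p (t q) ∈ B := by rw [hpt q hq.1]; exact hq.1
        refine Prod.ext (hpt q hq.1) ?_
        change j (t q) = q.2
        rw [hj _ h1, Equiv.symm_apply_eq, ← Equiv.eq_symm_apply]
        exact Subtype.ext (h.r_s q.1 hq.1 _ (g.symm (ι q.2)).2)
      open_source := hBo
      open_target := h.isOpen_base.prod isOpen_univ
      continuousOn_toFun := hp.continuous.continuousOn.prodMk hjs.continuousOn
      continuousOn_invFun := hts.continuousOn
      baseSet := B
      open_baseSet := h.isOpen_base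
      source_eq := rfl
      target_eq := rfl
      proj_toFun := fun _ _ => rfl }
  exact ⟨e, h.mem_base, hp.contMDiffOn.prodMk hjs, hts⟩

end Trivialization

section Bundle

variable {m n : ℕ} {M : Type u} {N : Type v}
  [TopologicalSpace M] [ChartedSpace (EuclideanSpace ℝ (Fin m)) M]
  [TopologicalSpace N] [ChartedSpace (EuclideanSpace ℝ (Fin n)) N]

/-- If `N` is empty, then `p` is a bundle with empty fibre; trivializations with a nonempty fibre
do not exist. -/
theorem isLocallyTrivialBundle_of_isEmpty [IsEmpty N] {p : N → M} :
    IsLocallyTrivialBundle m n p := by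
  let cs : ChartedSpace (EuclideanSpace ℝ (Fin 0)) PEmpty.{v + 1} := ChartedSpace.empty _ _
  refine ⟨0, PEmpty, inferInstance, cs, inferInstance, inferInstance, inferInstance, fun x => ?_⟩
  let e : Bundle.Trivialization PEmpty.{v + 1} p :=
    { toFun := isEmptyElim
      invFun := isEmptyElim
      source := univ
      target := univ
      map_source' := isEmptyElim
      map_target' := isEmptyElim
      left_inv' := isEmptyElim
      right_inv' := isEmptyElim
      open_source := isOpen_univ
      open_target := isOpen_univ
      continuousOn_toFun := fun u => isEmptyElim u
      continuousOn_invFun := fun u => isEmptyElim u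
      baseSet := univ
      open_baseSet := isOpen_univ
      source_eq := rfl
      target_eq := univ_prod_univ.symm
      proj_toFun := isEmptyElim }
  exact ⟨e, mem_univ x, fun u => isEmptyElim u, fun q => isEmptyElim q⟩

variable [IsManifold (𝓡 m) ∞ M] [IsManifold (𝓡 n) ∞ N] [T2Space M] [T2Space N]
  [SecondCountableTopology N]

/-- By Ehresmann's theorem, all fibres over a neighbourhood of a point are diffeomorphic. So if the
points with a fibre diffeomorphic to a given one are dense, then all fibres are diffeomorphic, and
the local trivializations have a common typical fibre. -/
theorem isLocallyTrivialBundle_of_isProperMap {p : N → M} (hp : ContMDiff (𝓡 n) (𝓡 m) ∞ p)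
    (hs : ∀ u, Function.Surjective (mfderiv (𝓡 n) (𝓡 m) p u)) (hproper : IsProperMap p)
    (hdense : ∀ x₀ : M, Dense {y | ∃ f : (p ⁻¹' {x₀} : Set N) ≃ (p ⁻¹' {y} : Set N),
      IsDiffeoBetween n f}) : IsLocallyTrivialBundle m n p := by
  rcases isEmpty_or_nonempty N with hN | ⟨⟨u₀⟩⟩
  · exact isLocallyTrivialBundle_of_isEmpty
  obtain ⟨P, tP, cP, mP, i, hi, hrange⟩ := IsRegularValue.isEmbeddedSubmanifold (x := p u₀) hp
    fun u _ => hs u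
  have : T2Space P := hi.isEmbedding.t2Space
  have : SecondCountableTopology P := hi.isEmbedding.secondCountableTopology
  obtain ⟨q₀, -⟩ : u₀ ∈ range i := by rw [hrange]; rfl
  have : Nonempty P := ⟨q₀⟩
  refine ⟨n - m, P, tP, cP, mP, inferInstance, inferInstance, fun x => ?_⟩
  obtain ⟨B, U, r, s, h⟩ := exists_isProductStructure hp hs hproper x
  obtain ⟨y, hy, f, hf⟩ := (hdense (p u₀)).inter_open_nonempty B h.isOpen_base ⟨x, h.mem_base⟩
  obtain ⟨g, hg⟩ := h.exists_isDiffeoBetween hp.continuous hy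
  exact h.exists_trivialization hp hi hrange (hg.trans hf.symm)

end Bundle

theorem mainTheorem3 {m n : ℕ} {M : Type u} {N : Type v}
    [TopologicalSpace M] [ChartedSpace (EuclideanSpace ℝ (Fin m)) M] [IsManifold (𝓡 m) ∞ M]
    [T2Space M] [SecondCountableTopology M]
    [TopologicalSpace N] [ChartedSpace (EuclideanSpace ℝ (Fin n)) N] [IsManifold (𝓡 n) ∞ N]
    [T2Space N] [SecondCountableTopology N]
    (p : C^∞⟮𝓡 n, N; 𝓡 m, M⟯)
    (A : C^∞⟮𝓡 m, M; ℝ⟯ →ₗ[ℝ] C^∞⟮𝓡 m, M; ℝ⟯)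
    (B : C^∞⟮𝓡 n, N; ℝ⟯ →ₗ[ℝ] C^∞⟮𝓡 n, N; ℝ⟯)
    (hA : IsDiffusionOperator A) (hB : IsDiffusionOperator B) (hBA : IsOver p B A)
    (hcoh : IsCohesive A)
    (hcomplete : IsCompleteSemiConnection p (symbolImage A) (horizontalSpace p B)) :
    -- fibres over the end points of an `E`-horizontal curve
    (∀ (x z : M) (T : ℝ) (σ : ℝ → M), 0 ≤ T → IsHorizontalCurve (symbolImage A) σ T →
      σ 0 = x → σ T = z →
      (∃ hol : (p ⁻¹' {x} : Set N) ≃ (p ⁻¹' {z} : Set N),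
        (∀ (u : (p ⁻¹' {x} : Set N)) (τ : ℝ → N),
          IsHorizontalLift p (horizontalSpace p B) σ τ T → τ 0 = u → τ T = hol u) ∧
        IsDiffeoBetween n hol) ∧
      (∀ k : ℕ, IsEmbeddedSubmanifold n k (p ⁻¹' {x} : Set N) →
        IsEmbeddedSubmanifold n k (p ⁻¹' {z} : Set N)) ∧
      (IsRegularValue m n p z ↔ IsRegularValue m n p x)) ∧
    -- dense reachable sets and proper `p`
    ((∀ x : M, Dense (reachableSet (symbolImage A) x)) → IsProperMap p →
      IsLocallyTrivialBundle m n p) ∧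
    -- the Hörmander condition
    (PreconnectedSpace M → HormanderCondition (symbolImage A) →
      Manifold.IsSubmersion (𝓡 n) (𝓡 m) ∞ p ∧
      (∃ k : ℕ, ∀ x : M, IsEmbeddedSubmanifold n k (p ⁻¹' {x} : Set N)) ∧
      ∀ x y : M, ∃ f : (p ⁻¹' {x} : Set N) ≃ (p ⁻¹' {y} : Set N), IsDiffeoBetween n f) := by
  obtain ⟨r, -, hk⟩ := hcoh.constantRank
  refine ⟨fun x z T σ hT hσ hx hz => ?_, fun hdense hproper => ?_, fun hconn hH => ?_⟩
  · obtain ⟨hol, hlift, hdiff⟩ := exists_holonomy hA hB hBA hk hcomplete hT hσ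
    subst hx hz
    refine ⟨⟨hol, hlift, hdiff.isDiffeoBetween⟩, fun k hS => hS.of_isLocallyDiffeo hdiff,
      fun h => h.of_isHorizontalCurve hA hB hBA hk hcomplete hT hσ, fun h => ?_⟩
    -- the other implication is the same statement for the reversed curve
    have hrev := IsRegularValue.of_isHorizontalCurve hA hB hBA hk hcomplete hT hσ.reverse
      (by rw [sub_self]; exact h)
    rwa [sub_zero] at hrev
  · -- all values are regular, and the reachable sets consist of points with diffeomorphic fibres
    have hreg := IsRegularValue.of_dense_reachableSet hA hB hBA hk hcomplete hdense hproper
    refine isLocallyTrivialBundle_of_isProperMap p.contMDiff (fun u => hreg _ u rfl) hproper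
      fun x => (hdense x).mono ?_
    rintro _ ⟨T, σ, hT, hσ, rfl, rfl⟩
    obtain ⟨hol, -, h⟩ := exists_holonomy hA hB hBA hk hcomplete hT hσ
    exact ⟨hol, h.isDiffeoBetween⟩
  · have hs := hBA.surjective_mfderiv hA hB hk hH
    exact ⟨isSubmersion_of_surjective_mfderiv p.contMDiff hs,
      ⟨n - m, fun x => IsRegularValue.isEmbeddedSubmanifold p.contMDiff fun u _ => hs u⟩,
      hH.exists_isDiffeoBetween_fibres hA hB hBA hk hcomplete⟩
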